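/- **Setting.** Let $T>0$, $\mu_x,\mu_y\in\mathbb R$, $\sigma_x,\sigma_y>0$, $\rho\in[-1,1]$, and, for $k\in\{x,y,z\}$, $a_k>0$, $\alpha_k\ge 0$, $c_k^\pm\ge 0$, $\lambda^{k,\pm}\ge0$, and let $F^{k,\pm}$ be probability distributions on $[0,\infty)$ with finite fourth moment. Put $\mu_{\hat x}=\mu_{\hat z}=\mu_x$, $\mu_{\hat y}=\mu_y$, and, for exchange rates $x,y>0$, $\hat k=x$ for $k\in\{x,z\}$ and $\hat k=y$ for $k=y$. Let $\theta^{k,\pm}=\int r\,F^{k,\pm}(dr)$, $\eta^{k,\pm}=\int r^2F^{k,\pm}(dr)$, $\gamma^k=\lambda^{k,+}\theta^{k,+}-\lambda^{k,-}\theta^{k,-}$, $\delta^k=\lambda^{k,+}\eta^{k,+}+\lambda^{k,-}\eta^{k,-}$, $\psi^k=c_k^+\lambda^{k,+}\eta^{k,+}+c_k^-\lambda^{k,-}\eta^{k,-}$, $\upsilon_k=1-a_k\mu_{\hat k}/\alpha_k$, and $$h_2^k(t)=\begin{cases}\dfrac{a_k\mu_{\hat k}}{1-\upsilon_k e^{-\mu_{\hat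 k}(T-t)}},&\mu_{\hat k}\ne0,\\[2mm] \big(\alpha_k^{-1}+a_k^{-1}(T-t)\big)^{-1},&\mu_{\hat k}=0,\end{cases}$$ $$h_1^k(t)=\begin{cases}\dfrac{(1-2a_k\gamma^k)\mu_{\hat k}(t-T)+\upsilon_k(1-e^{-\mu_{\hat k}(T-t)})}{1-\upsilon_k e^{-\mu_{\hat k}(T-t)}},&\mu_{\hat k}\ne0,\\[2mm] 2\gamma^k(T-t)\big(\alpha_k^{-1}+a_k^{-1}(T-t)\big)^{-1},&\mu_{\hat k}=0\end{cases}$$ (for $\alpha_k=0$, the limits as $\alpha_k\downarrow0$), $$g^k(t)=\int_t^T e^{\mu_{\hat k}(u-t)}\Big(-\psi^k+\gamma^kh_1^k(u)+\delta^kh_2^k(u)-\tfrac1{4a_k}h_1^k(u)^2\Big)du,\qquad h_0^x=g^x+g^z,\quad h_0^y=g^y,$$ and, with $\boldsymbol q=(q^x,q^y,q^z)$, $$H_0(t,x,y,\boldsymbol q)=x(q^x+q^z)+yq^y-h_0^xx-h_0^yy-h_1^xxq^x-h_1^yyq^y-h_1^zxq^z-h_2^xx(q^x)^2-h_2^yy(q^y)^2-h_2^zx(q^z)^2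 .$$ Then $\partial_xH_0$ is a function of $(t,q^x,q^z)$ and $\partial_yH_0$ is a function of $(t,q^y)$. The first-order term $H_1(t,x,y,\boldsymbol q)$ solves, for $t\in[0,T)$, $x,y>0$, $\boldsymbol q\in\mathbb R^3$, the linear equation $$\begin{aligned}0=\partial_tH_1&+\mu_xx\,\partial_xH_1+\mu_yy\,\partial_yH_1+\tfrac12\sigma_x^2x^2\partial_{xx}H_1+\tfrac12\sigma_y^2y^2\partial_{yy}H_1+\rho\sigma_x\sigma_yxy\,\partial_{xy}H_1\\&-\sum_{k}\frac{\hat k-\partial_{q^k}H_0}{2a_k\hat k}\,\partial_{q^k}H_1+\sum_{k}\sum_{i=\pm}\lambda^{k,i}\int_{(0,\infty)}\big(H_1(t,x,y,\boldsymbol q+i\,r\,\boldsymbol 1^k)-H_1(t,x,y,\boldsymbol q)\big)F^{k,i}(dr)\\&-\tfrac12\big(\sigma_x^2x^2(\partial_xH_0)^2+2\rho\sigma_x\sigma_yxy\,\partial_xH_0\,\partial_yH_0+\sigma_y^2y^2(\partial_yH_0)^2\big)\end{aligned}\tag{E}$$ with $H_1(T,\cdot)=0$, where $\boldsymbol 1^k$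 is the $k$-th unit vector. A solution is understood in the classical sense: continuous for $t\in[0,T]$, continuously differentiable in $t$ (one-sidedly at $t=0$) and in $\boldsymbol q$ and twice continuously differentiable in $(x,y)$ for $t\in[0,T)$, with the integrals in (E) convergent. Let $O^{k,\pm}_t=\sum_{n=1}^{N^{k,\pm}_t}\xi^{k,\pm}_n$, where the $N^{k,\pm}$ are Poisson processes with intensities $\lambda^{k,\pm}$, $\xi_n^{k,\pm}\sim F^{k,\pm}$, and all the processes $N^{k,\pm}$ and all the variables $\xi^{k,\pm}_n$ are mutually independent. For $t\in[0,T]$ and $\mathfrak Q^k_t=q^k$ let $\mathfrak Q^k$ on $[t,T]$ solve $$d\mathfrak Q^k_u=\beta_k(u,\mathfrak Q^k_u)\,du-dO^{k,-}_u+dO^{k,+}_u,\qquad \beta_k(u,q)=-\tfrac1{2a_k}\big(h_1^k(u)+2h_2^k(u)q\big),$$ and write $\mathbb E_{t,\cdot}$ for expectations given these starting values. **Proposition.** For $t\in[0,T]$ and $q^x,q^y,q^z\in\mathbb R$ put $$\begin{aligned}H_{11}(t,q^x,q^z)&=-\int_t^Te^{(2\mu_x+\sigma_x^2)(u-t)}\,\tfrac12\sigma_x^2\;\mathbb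 E_{t,q^x,q^z}\big[(\partial_xH_0(u,\mathfrak Q^x_u,\mathfrak Q^z_u))^2\big]du,\\ H_{12}(t,q^y)&=-\int_t^Te^{(2\mu_y+\sigma_y^2)(u-t)}\,\tfrac12\sigma_y^2\;\mathbb E_{t,q^y}\big[(\partial_yH_0(u,\mathfrak Q^y_u))^2\big]du,\\ H_{13}(t,\boldsymbol q)&=-\int_t^Te^{(\mu_x+\mu_y+\rho\sigma_x\sigma_y)(u-t)}\,\rho\sigma_x\sigma_y\;\mathbb E_{t,\boldsymbol q}\big[\partial_xH_0(u,\mathfrak Q^x_u,\mathfrak Q^z_u)\,\partial_yH_0(u,\mathfrak Q^y_u)\big]du.\end{aligned}$$ 1. All these expectations and time integrals are finite. 2. $H_1=H_{11}(t,q^x,q^z)\,x^2+H_{12}(t,q^y)\,y^2+H_{13}(t,\boldsymbol q)\,xy$ is a classical solution of (E) with $H_1(T,\cdot)=0$, and its coefficients grow at most like the fourth power of the inventories, uniformly in $t\in[0,T]$. 3. Conversely, if functions $\tilde H_{11}(t,q^x,q^z)$, $\tilde H_{12}(t,q^y)$, $\tilde H_{13}(t,\boldsymbol q)$ make $\tilde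 H_{11}x^2+\tilde H_{12}y^2+\tilde H_{13}xy$ a classical solution of (E) with terminal value $0$, and have, uniformly in $t\in[0,T]$, polynomial growth of some integer degree $p\ge4$ in the inventories for which all $F^{k,\pm}$ have finite $p$-th moment, then they are given on $[0,T]$ by the formulas above. -/

import Mathlib

open MeasureTheory ProbabilityTheory Set
open scoped NNReal Matrix

noncomputable section

namespace FX

/-- The three currency pairs of the triplet. -/
inductive Pair
  | x | y | z
  deriving DecidableEq

instance : Fintype Pair where
  elems := {.x, .y, .z}
  complete k := by cases k <;> simp

/-- The two sides of the clients' order flow: market sells (superscript `+`), which raise the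
broker's inventory, and market buys (superscript `-`), which lower it. -/
inductive Side
  | sell | buy
  deriving DecidableEq

instance : Fintype Side where
  elems := {.sell, .buy}
  complete s := by cases s <;> simp

/-- The sign of the effect of a client order on the broker's inventory. -/
def Side.sgn : Side → ℝ
  | .sell => 1
  | .buy => -1

/-- The constants of the model: the horizon, the drifts, volatilities and correlation of the
mid-exchange rates, the temporary impacts `a`, the terminal penalties `α`, the service fees `c`,
the intensities `lam` and the volume distributions `F` of the clients' orders. -/
structure Model where
  T : ℝ
  μx : ℝ
  μy : ℝ
  σx : ℝ
  σy : ℝ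
  ρ : ℝ
  a : Pair → ℝ
  α : Pair → ℝ
  c : Pair → Side → ℝ
  lam : Pair → Side → ℝ≥0
  F : Pair → Side → Measure ℝ
  T_pos : 0 < T
  σx_pos : 0 < σx
  σy_pos : 0 < σy
  ρ_mem : ρ ∈ Icc (-1 : ℝ) 1
  a_pos : ∀ k, 0 < a k
  α_nonneg : ∀ k, 0 ≤ α k
  c_nonneg : ∀ k s, 0 ≤ c k s
  F_prob : ∀ k s, IsProbabilityMeasure (F k s)
  F_supp : ∀ k s, F k s (Iio 0) = 0

namespace Model

variable (m : Model)

/-- The drift of the mid-exchange rate in which trades in the pair `k` are marked to market. -/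
def muHat : Pair → ℝ
  | .x => m.μx
  | .y => m.μy
  | .z => m.μx

/-- First moment of the order volumes. -/
def theta (k : Pair) (s : Side) : ℝ := ∫ r in Ioi 0, r ∂(m.F k s)

/-- Second moment of the order volumes. -/
def eta (k : Pair) (s : Side) : ℝ := ∫ r in Ioi 0, r ^ 2 ∂(m.F k s)

def gamma (k : Pair) : ℝ :=
  m.lam k .sell * m.theta k .sell - m.lam k .buy * m.theta k .buy

def delta (k : Pair) : ℝ :=
  m.lam k .sell * m.eta k .sell + m.lam k .buy * m.eta k .buy

def psi (k : Pair) : ℝ :=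
  m.c k .buy * m.lam k .buy * m.eta k .buy + m.c k .sell * m.lam k .sell * m.eta k .sell

/-- The function `h₂ᵏ`, which solves `-h₂' + h₂² / a - μ̂ h₂ = 0`, `h₂(T) = α`.  With
`υ = 1 - a μ̂ / α` it is `a μ̂ / (1 - υ e^{-μ̂ (T-t)})` if `μ̂ ≠ 0`, and
`(α⁻¹ + a⁻¹ (T-t))⁻¹` if `μ̂ = 0`; the fractions are written with numerator and denominator
multiplied by `α` (and by `a`, for `μ̂ = 0`), so that they are also right for `α = 0`. -/
def h2 (k : Pair) (t : ℝ) : ℝ :=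
  if m.muHat k = 0 then m.α k * m.a k / (m.a k + m.α k * (m.T - t))
  else m.α k * (m.a k * m.muHat k) /
    (m.α k - (m.α k - m.a k * m.muHat k) * Real.exp (-m.muHat k * (m.T - t)))

/-- The function `h₁ᵏ`, which solves `-h₁' + μ̂ (1 - h₁) + h₂ h₁ / a - 2 γ h₂ = 0`, `h₁(T) = 0`.
It is `(1 - υ e^{-μ̂ (T-t)})⁻¹ ((1 - 2 a γ) μ̂ (t - T) + υ (1 - e^{-μ̂ (T-t)}))` if `μ̂ ≠ 0`, and
`2 γ (T-t) (α⁻¹ + a⁻¹ (T-t))⁻¹` if `μ̂ = 0`, written as in `h2`. -/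
def h1 (k : Pair) (t : ℝ) : ℝ :=
  if m.muHat k = 0 then
    2 * m.gamma k * (m.T - t) * (m.α k * m.a k / (m.a k + m.α k * (m.T - t)))
  else (m.α k * ((1 - 2 * m.a k * m.gamma k) * m.muHat k * (t - m.T)) +
      (m.α k - m.a k * m.muHat k) * (1 - Real.exp (-m.muHat k * (m.T - t)))) /
    (m.α k - (m.α k - m.a k * m.muHat k) * Real.exp (-m.muHat k * (m.T - t)))

/-- The contribution of the pair `k` to the functions `h₀`. -/
def h0part (k : Pair) (t : ℝ) : ℝ :=
  (-∫ u in t..m.T, Real.exp (m.muHat k * (u - t)) * m.psi k) +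
  (∫ u in t..m.T, Real.exp (m.muHat k * (u - t)) * (m.gamma k * m.h1 k u)) +
  (∫ u in t..m.T, Real.exp (m.muHat k * (u - t)) * (m.delta k * m.h2 k u)) -
  ∫ u in t..m.T, Real.exp (m.muHat k * (u - t)) * (1 / (4 * m.a k) * (m.h1 k u) ^ 2)

def h0x (t : ℝ) : ℝ := m.h0part .x t + m.h0part .z t

def h0y (t : ℝ) : ℝ := m.h0part .y t

/-- The value function, net of cash, of the ambiguity neutral broker. -/
def H0 (t x y : ℝ) (q : Pair → ℝ) : ℝ :=
  x * (q .x + q .z) + y * q .y - m.h0x t * x - m.h0y t * y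
    - m.h1 .x t * x * q .x - m.h1 .y t * y * q .y - m.h1 .z t * x * q .z
    - m.h2 .x t * x * q .x ^ 2 - m.h2 .y t * y * q .y ^ 2 - m.h2 .z t * x * q .z ^ 2

/-- `∂ₓ H₀`, which depends on `(t, qˣ, qᶻ)` only; see `hasDerivAt_H0_x`. -/
def dxH0 (t qx qz : ℝ) : ℝ :=
  (qx + qz) - m.h0x t - m.h1 .x t * qx - m.h1 .z t * qz - m.h2 .x t * qx ^ 2 - m.h2 .z t * qz ^ 2

/-- `∂_y H₀`, which depends on `(t, qʸ)` only; see `hasDerivAt_H0_y`. -/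
def dyH0 (t qy : ℝ) : ℝ :=
  qy - m.h0y t - m.h1 .y t * qy - m.h2 .y t * qy ^ 2

theorem hasDerivAt_H0_x (t x y : ℝ) (q : Pair → ℝ) :
    HasDerivAt (fun x' => m.H0 t x' y q) (m.dxH0 t (q .x) (q .z)) x := by
  have e : (fun x' => m.H0 t x' y q) =
      fun x' => x' * m.dxH0 t (q .x) (q .z) + y * m.dyH0 t (q .y) := by
    funext x'
    simp only [H0, dxH0, dyH0]
    ring
  rw [e]
  simpa using ((hasDerivAt_id x).mul_const (m.dxH0 t (q .x) (q .z))).add_const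
    (y * m.dyH0 t (q .y))

theorem hasDerivAt_H0_y (t x y : ℝ) (q : Pair → ℝ) :
    HasDerivAt (fun y' => m.H0 t x y' q) (m.dyH0 t (q .y)) y := by
  have e : (fun y' => m.H0 t x y' q) =
      fun y' => x * m.dxH0 t (q .x) (q .z) + y' * m.dyH0 t (q .y) := by
    funext y'
    simp only [H0, dxH0, dyH0]
    ring
  rw [e]
  simpa using ((hasDerivAt_id y).mul_const (m.dyH0 t (q .y))).const_add
    (x * m.dxH0 t (q .x) (q .z))

/-- The drift of the auxiliary inventory process of the pair `k`. -/
def beta (k : Pair) (t q : ℝ) : ℝ := -(1 / (2 * m.a k)) * (m.h1 k t + 2 * m.h2 k t * q)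

end Model

/-! ### Partial derivatives of functions of `(t, x, y, q)` -/

/-- Time derivative on `[0, T]` (one-sided at the end points). -/
def dT (T : ℝ) (H : ℝ → ℝ → ℝ → (Pair → ℝ) → ℝ) (t x y : ℝ) (q : Pair → ℝ) : ℝ :=
  derivWithin (fun s => H s x y q) (Icc 0 T) t

def dX (H : ℝ → ℝ → ℝ → (Pair → ℝ) → ℝ) (t x y : ℝ) (q : Pair → ℝ) : ℝ :=
  deriv (fun x' => H t x' y q) x

def dY (H : ℝ → ℝ → ℝ → (Pair → ℝ) → ℝ) (t x y : ℝ) (q : Pair → ℝ) : ℝ :=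
  deriv (fun y' => H t x y' q) y

def dQ (k : Pair) (H : ℝ → ℝ → ℝ → (Pair → ℝ) → ℝ) (t x y : ℝ) (q : Pair → ℝ) : ℝ :=
  deriv (fun v => H t x y (Function.update q k v)) (q k)

/-- A function of `(t, x, y, q)`, as a function on the product space. -/
def onProd (H : ℝ → ℝ → ℝ → (Pair → ℝ) → ℝ) (w : ℝ × ℝ × ℝ × (Pair → ℝ)) : ℝ :=
  H w.1 w.2.1 w.2.2.1 w.2.2.2

/-- The state space, with times in `I` and positive exchange rates. -/
def dom (I : Set ℝ) : Set (ℝ × ℝ × ℝ × (Pair → ℝ)) :=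
  I ×ˢ (Ioi 0 ×ˢ (Ioi 0 ×ˢ univ))

/-- Classical regularity: continuous on `[0, T]`, and on `[0, T)` continuously differentiable in
`t` and `q` and twice continuously differentiable in `(x, y)`. -/
structure IsRegular (T : ℝ) (H : ℝ → ℝ → ℝ → (Pair → ℝ) → ℝ) : Prop where
  cont : ContinuousOn (onProd H) (dom (Icc 0 T))
  diff_t : ∀ t ∈ Ico 0 T, ∀ x > 0, ∀ y > 0, ∀ q,
    DifferentiableWithinAt ℝ (fun s => H s x y q) (Icc 0 T) t
  diff_x : ∀ t ∈ Ico 0 T, ∀ x > 0, ∀ y > 0, ∀ q, DifferentiableAt ℝ (fun x' => H t x' y q) x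
  diff_y : ∀ t ∈ Ico 0 T, ∀ x > 0, ∀ y > 0, ∀ q, DifferentiableAt ℝ (fun y' => H t x y' q) y
  diff_xx : ∀ t ∈ Ico 0 T, ∀ x > 0, ∀ y > 0, ∀ q, DifferentiableAt ℝ (fun x' => dX H t x' y q) x
  diff_yy : ∀ t ∈ Ico 0 T, ∀ x > 0, ∀ y > 0, ∀ q, DifferentiableAt ℝ (fun y' => dY H t x y' q) y
  diff_xy : ∀ t ∈ Ico 0 T, ∀ x > 0, ∀ y > 0, ∀ q, DifferentiableAt ℝ (fun x' => dY H t x' y q) x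
  diff_q : ∀ k, ∀ t ∈ Ico 0 T, ∀ x > 0, ∀ y > 0, ∀ q : Pair → ℝ,
    DifferentiableAt ℝ (fun v => H t x y (Function.update q k v)) (q k)
  cont_t : ContinuousOn (onProd (dT T H)) (dom (Ico 0 T))
  cont_x : ContinuousOn (onProd (dX H)) (dom (Ico 0 T))
  cont_y : ContinuousOn (onProd (dY H)) (dom (Ico 0 T))
  cont_xx : ContinuousOn (onProd (dX (dX H))) (dom (Ico 0 T))
  cont_yy : ContinuousOn (onProd (dY (dY H))) (dom (Ico 0 T))
  cont_xy : ContinuousOn (onProd (dX (dY H))) (dom (Ico 0 T))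
  cont_q : ∀ k, ContinuousOn (onProd (dQ k H)) (dom (Ico 0 T))

/-! ### The linear equation for the first-order term `H₁` -/

namespace Model

variable (m : Model)

/-- The generator of the mid-exchange rates. -/
def genP (H : ℝ → ℝ → ℝ → (Pair → ℝ) → ℝ) (t x y : ℝ) (q : Pair → ℝ) : ℝ :=
  m.μx * x * dX H t x y q + m.μy * y * dY H t x y q
    + 1 / 2 * m.σx ^ 2 * x ^ 2 * dX (dX H) t x y q
    + 1 / 2 * m.σy ^ 2 * y ^ 2 * dY (dY H) t x y q
    + m.ρ * m.σx * m.σy * x * y * dX (dY H) t x y q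

/-- The vector `𝒟H = (σₓ x ∂ₓH, σ_y y ∂_yH)`. -/
def gradP (H : ℝ → ℝ → ℝ → (Pair → ℝ) → ℝ) (t x y : ℝ) (q : Pair → ℝ) : Fin 2 → ℝ :=
  ![m.σx * x * dX H t x y q, m.σy * y * dY H t x y q]

/-- The correlation matrix of the mid-exchange rates. -/
def corr : Matrix (Fin 2) (Fin 2) ℝ := !![1, m.ρ; m.ρ, 1]

/-- The rate in which trades in the pair `k` are marked to market. -/
def rateHat (k : Pair) (x y : ℝ) : ℝ :=
  match k with
  | .x => x
  | .y => y
  | .z => x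

/-- Inventory after a client order of volume `r` on side `s` in the pair `k`. -/
def afterOrder (q : Pair → ℝ) (k : Pair) (s : Side) (r : ℝ) : Pair → ℝ :=
  Function.update q k (q k + s.sgn * r)

/-- Change of a function that does not depend on the cash position, when a client order arrives. -/
def jump (H : ℝ → ℝ → ℝ → (Pair → ℝ) → ℝ) (k : Pair) (s : Side) (t x y : ℝ) (q : Pair → ℝ)
    (r : ℝ) : ℝ :=
  H t x y (afterOrder q k s r) - H t x y q

/-- The right-hand side of the linear partial integro-differential equation for `H₁`. -/
def pideRHS (H : ℝ → ℝ → ℝ → (Pair → ℝ) → ℝ) (t x y : ℝ) (q : Pair → ℝ) : ℝ :=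
  dT m.T H t x y q + m.genP H t x y q
    - ∑ k : Pair, (rateHat k x y - dQ k m.H0 t x y q) / (2 * m.a k * rateHat k x y) *
        dQ k H t x y q
    + ∑ k : Pair, ∑ s : Side, m.lam k s * ∫ r in Ioi 0, jump H k s t x y q r ∂(m.F k s)
    - 1 / 2 * (m.gradP m.H0 t x y q ⬝ᵥ (m.corr *ᵥ m.gradP m.H0 t x y q))

/-- Classical solutions of the equation for `H₁`, with terminal value zero. -/
structure IsSolutionH1 (H : ℝ → ℝ → ℝ → (Pair → ℝ) → ℝ) : Prop where
  regular : IsRegular m.T H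
  integrable : ∀ k s, ∀ t ∈ Ico 0 m.T, ∀ x > 0, ∀ y > 0, ∀ q,
    IntegrableOn (jump H k s t x y q) (Ioi 0) (m.F k s)
  pide : ∀ t ∈ Ico 0 m.T, ∀ x > 0, ∀ y > 0, ∀ q, m.pideRHS H t x y q = 0
  terminal : ∀ x > 0, ∀ y > 0, ∀ q, H m.T x y q = 0

/-- The ansatz `H₁ = H₁₁ x² + H₁₂ y² + H₁₃ x y`. -/
def ansatz (H11 : ℝ → ℝ → ℝ → ℝ) (H12 : ℝ → ℝ → ℝ) (H13 : ℝ → ℝ → ℝ → ℝ → ℝ)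
    (t x y : ℝ) (q : Pair → ℝ) : ℝ :=
  H11 t (q .x) (q .z) * x ^ 2 + H12 t (q .y) * y ^ 2 + H13 t (q .x) (q .y) (q .z) * (x * y)

/-- Polynomial growth of degree `p` in the inventories, uniformly on `[0, T]`. -/
def HasGrowth (p : ℕ) (H11 : ℝ → ℝ → ℝ → ℝ) (H12 : ℝ → ℝ → ℝ) (H13 : ℝ → ℝ → ℝ → ℝ → ℝ) : Prop :=
  ∃ C : ℝ, ∀ t ∈ Icc 0 m.T, ∀ qx qy qz : ℝ,
    |H11 t qx qz| ≤ C * (1 + |qx| + |qz|) ^ p ∧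
    |H12 t qy| ≤ C * (1 + |qy|) ^ p ∧
    |H13 t qx qy qz| ≤ C * (1 + |qx| + |qy| + |qz|) ^ p

end Model

/-! ### Client orders and the auxiliary inventory processes -/

section Probability

variable {Ω : Type*} [MeasurableSpace Ω]

/-- `N` is a Poisson process with intensity `l`. -/
structure IsPoissonProcess (P : Measure Ω) (l : ℝ≥0) (N : ℝ≥0 → Ω → ℕ) : Prop where
  measurable : ∀ t, Measurable (N t)
  zero : ∀ᵐ ω ∂P, N 0 ω = 0
  mono : ∀ᵐ ω ∂P, Monotone fun t => N t ω
  rightCont : ∀ᵐ ω ∂P, ∀ t, ContinuousWithinAt (fun s => N s ω) (Ici t) t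
  law : ∀ s t, s ≤ t → HasLaw (fun ω => N t ω - N s ω) (poissonMeasure (l * (t - s))) P
  indep : HasIndepIncrements N P

/-- The counting processes `N` and the order volumes `ξ` (the volume of the order number `n + 1`
is `ξ k s n`) of the clients' order flow: Poisson processes with the intensities of the model,
volumes with the distributions of the model, and all of them mutually independent. -/
structure IsOrderFlow (m : Model) (P : Measure Ω) (N : Pair → Side → ℝ≥0 → Ω → ℕ)
    (ξ : Pair → Side → ℕ → Ω → ℝ) : Prop where
  poisson : ∀ k s, IsPoissonProcess P (m.lam k s) (N k s)
  measurable : ∀ k s n, Measurable (ξ k s n)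
  law : ∀ k s n, HasLaw (ξ k s n) (m.F k s) P
  indep : iIndep
    (Sum.elim
      (fun j : Pair × Side =>
        ⨆ t : ℝ≥0, MeasurableSpace.comap (N j.1 j.2 t) inferInstance)
      (fun j : Pair × Side × ℕ =>
        MeasurableSpace.comap (ξ j.1 j.2.1 j.2.2) inferInstance)) P

/-- Cumulative volume up to time `t ≥ 0` of a compound Poisson order flow. -/
def cumVolume (N : ℝ≥0 → Ω → ℕ) (ξ : ℕ → Ω → ℝ) (t : ℝ) (ω : Ω) : ℝ :=
  ∑ n ∈ Finset.range (N t.toNNReal ω), ξ n ω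

/-- `Q` is an auxiliary inventory process of the pair `k` on `[t, T]` that starts from `q` at
time `t`: it solves `dQ = β_k(u, Q) du - ∫ r J^{k,-}(dr, du) + ∫ r J^{k,+}(dr, du)`, `Q_t = q`,
where `J^{k,±}` is the jump measure of the cumulative order volume, so that its integral over
`(t, u]` is the increment of that volume. -/
structure IsAuxInventory (m : Model) (P : Measure Ω) (N : Pair → Side → ℝ≥0 → Ω → ℕ)
    (ξ : Pair → Side → ℕ → Ω → ℝ) (k : Pair) (t q : ℝ) (Q : ℝ → Ω → ℝ) : Prop where
  measurable : ∀ u ∈ Icc t m.T, Measurable (Q u)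
  integrable : ∀ᵐ ω ∂P, IntervalIntegrable (fun s => m.beta k s (Q s ω)) volume t m.T
  sde : ∀ᵐ ω ∂P, ∀ u ∈ Icc t m.T,
    Q u ω = q + (∫ s in t..u, m.beta k s (Q s ω))
      - (cumVolume (N k .buy) (ξ k .buy) u ω - cumVolume (N k .buy) (ξ k .buy) t ω)
      + (cumVolume (N k .sell) (ξ k .sell) u ω - cumVolume (N k .sell) (ξ k .sell) t ω)

namespace Model

variable (m : Model) (P : Measure Ω) (Q : Pair → ℝ → ℝ → ℝ → Ω → ℝ)

/-! In what follows `Q k t q u` is the value at time `u` of the auxiliary inventory process of the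
pair `k` that starts from `q` at time `t`. -/

/-- Expectation in the representation of `H₁₁`. -/
def expXX (t qx qz u : ℝ) : ℝ :=
  ∫ ω, (m.dxH0 u (Q .x t qx u ω) (Q .z t qz u ω)) ^ 2 ∂P

/-- Expectation in the representation of `H₁₂`. -/
def expYY (t qy u : ℝ) : ℝ :=
  ∫ ω, (m.dyH0 u (Q .y t qy u ω)) ^ 2 ∂P

/-- Expectation in the representation of `H₁₃`. -/
def expXY (t qx qy qz u : ℝ) : ℝ :=
  ∫ ω, m.dxH0 u (Q .x t qx u ω) (Q .z t qz u ω) * m.dyH0 u (Q .y t qy u ω) ∂P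

def repH11 (t qx qz : ℝ) : ℝ :=
  -∫ u in t..m.T, Real.exp ((2 * m.μx + m.σx ^ 2) * (u - t)) * (1 / 2 * m.σx ^ 2) *
    m.expXX P Q t qx qz u

def repH12 (t qy : ℝ) : ℝ :=
  -∫ u in t..m.T, Real.exp ((2 * m.μy + m.σy ^ 2) * (u - t)) * (1 / 2 * m.σy ^ 2) *
    m.expYY P Q t qy u

def repH13 (t qx qy qz : ℝ) : ℝ :=
  -∫ u in t..m.T, Real.exp ((m.μx + m.μy + m.ρ * m.σx * m.σy) * (u - t)) *
    (m.ρ * m.σx * m.σy) * m.expXY P Q t qx qy qz u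

end Model

end Probability

end FX

end

/-!
The mid-exchange rates enter (E) through a quadratic form, so the coefficients of `x ^ 2`, `y ^ 2`
and `x * y` decouple: each of them solves `∂ₜG + 𝓛G + c G = K S` with terminal value zero, where `𝓛`
is the generator of the auxiliary inventories and the source `S`, a product of two first derivatives
of `H₀`, is a polynomial of degree four in the inventories.

The drift of an auxiliary inventory is affine.  Multiplied by an integrating factor, the inventory
is therefore a deterministic function plus an integral of that factor against the compound Poisson
order flow, and this integral has independent increments with explicit cumulants.  Generating
functions then give polynomials in the inventory, one of each degree, that are martingales along its
paths; they also annihilate `∂ₜ + 𝓛`.  In the basis of their products the Feynman-Kac formula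
becomes an integral over time of the coefficients of `S`, so that its regularity, the equation and
the growth of the solution are all immediate.

For uniqueness, the difference of two solutions is differentiated along the characteristics of the
drift.  This leaves a bounded jump operator, which halves the norm weighted by
`exp (R (T - t)) (1 + |q|) ^ p` once `R` is large.
-/

noncomputable section

namespace FX

open Filter Topology

/-! ### Bell polynomials and moments -/

/-- The binomial convolution of two sequences. -/
def binomConv (u v : ℕ → ℝ) (n : ℕ) : ℝ :=
  ∑ p ∈ Finset.HasAntidiagonal.antidiagonal n, (n.choose p.1 : ℝ) * (u p.1 * v p.2)

theorem binomConv_congr {u u' v v' : ℕ → ℝ} {n : ℕ} (hu : ∀ m ≤ n, u m = u' m)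
    (hv : ∀ m ≤ n, v m = v' m) : binomConv u v n = binomConv u' v' n :=
  Finset.sum_congr rfl fun _ hp => by
    rw [hu _ (Finset.HasAntidiagonal.antidiagonal.fst_le hp),
      hv _ (Finset.HasAntidiagonal.antidiagonal.snd_le hp)]

theorem binomConv_zero_left (v : ℕ → ℝ) (n : ℕ) : binomConv 0 v n = 0 :=
  Finset.sum_eq_zero fun p _ => by simp

theorem binomConv_add_left (u u' v : ℕ → ℝ) (n : ℕ) :
    binomConv (u + u') v n = binomConv u v n + binomConv u' v n := by
  simp only [binomConv, ← Finset.sum_add_distrib, Pi.add_apply, add_mul, mul_add]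

theorem binomConv_smul_left (c : ℝ) (u v : ℕ → ℝ) (n : ℕ) :
    binomConv (c • u) v n = c * binomConv u v n := by
  simp only [binomConv, Finset.mul_sum, Pi.smul_apply, smul_eq_mul, mul_assoc, mul_left_comm c]

theorem binomConv_single_left (m : ℕ) (c : ℝ) (v : ℕ → ℝ) (n : ℕ) :
    binomConv (Pi.single m c) v (m + n) = (m + n).choose m * (c * v n) := by
  rw [binomConv, Finset.sum_eq_single (m, n)]
  · simp
  · rintro ⟨i, j⟩ hp hne
    have hi : i ≠ m := fun h => hne (by
      have := Finset.HasAntidiagonal.mem_antidiagonal.1 hp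
      ext <;> grind)
    simp [hi]
  · simp

/-- The exponential generating function of a sequence. -/
def expGenFun (u : ℕ → ℝ) : PowerSeries ℝ := PowerSeries.mk fun n => u n / n.factorial

theorem expGenFun_injective : Function.Injective expGenFun := fun u v h => by
  ext n
  have hn : u n / n.factorial = v n / n.factorial := by
    simpa only [expGenFun, PowerSeries.coeff_mk] using congrArg (PowerSeries.coeff n) h
  have := Nat.factorial_ne_zero n
  field_simp at hn
  exact hn

theorem expGenFun_mul (u v : ℕ → ℝ) :
    expGenFun u * expGenFun v = expGenFun (binomConv u v) := by
  ext n
  rw [PowerSeries.coeff_mul, expGenFun, expGenFun, expGenFun, PowerSeries.coeff_mk, binomConv,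
    Finset.sum_div]
  refine Finset.sum_congr rfl fun p hp => ?_
  obtain ⟨i, j⟩ := p
  obtain rfl : i + j = n := Finset.HasAntidiagonal.mem_antidiagonal.1 hp
  rw [PowerSeries.coeff_mk, PowerSeries.coeff_mk, Nat.cast_add_choose]
  have := Nat.factorial_ne_zero (i + j)
  field_simp

theorem derivative_expGenFun (u : ℕ → ℝ) :
    PowerSeries.derivative ℝ (expGenFun u) = expGenFun fun n => u (n + 1) := by
  ext n
  rw [PowerSeries.coeff_derivative, expGenFun, expGenFun, PowerSeries.coeff_mk,
    PowerSeries.coeff_mk, Nat.factorial_succ]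
  have := Nat.factorial_ne_zero n
  push_cast
  field_simp

theorem eq_of_succ_eq_binomConv {u v w : ℕ → ℝ} (h0 : u 0 = v 0)
    (hu : ∀ n, u (n + 1) = binomConv w u n) (hv : ∀ n, v (n + 1) = binomConv w v n) : u = v := by
  ext n
  induction n using Nat.strong_induction_on with
  | _ n ih =>
    cases n with
    | zero => exact h0
    | succ n => rw [hu, hv, binomConv_congr (fun _ _ => rfl) fun m hm => ih m (by omega)]

/-- The complete Bell polynomial of degree `n` in `κ 1, …, κ n`, that is, the `n`-th moment of a
random variable with cumulants `κ`. The value `κ 0` is irrelevant. -/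
def completeBell (κ : ℕ → ℝ) : ℕ → ℝ
  | 0 => 1
  | n + 1 => ∑ j : Fin (n + 1), (n.choose j : ℝ) * (κ (j + 1) * completeBell κ (n - j))

@[simp]
theorem completeBell_zero (κ : ℕ → ℝ) : completeBell κ 0 = 1 := by
  rw [completeBell]

theorem completeBell_succ (κ : ℕ → ℝ) (n : ℕ) :
    completeBell κ (n + 1) = binomConv (fun r => κ (r + 1)) (completeBell κ) n := by
  rw [completeBell, binomConv, Finset.Nat.sum_antidiagonal_eq_sum_range_succ
    (fun i j => (n.choose i : ℝ) * (κ (i + 1) * completeBell κ j)), ← Fin.sum_univ_eq_sum_range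
    (fun j => (n.choose j : ℝ) * (κ (j + 1) * completeBell κ (n - j)))]

theorem completeBell_congr {κ κ' : ℕ → ℝ} (h : ∀ r, κ (r + 1) = κ' (r + 1)) :
    completeBell κ = completeBell κ' := by
  refine eq_of_succ_eq_binomConv (by simp) (completeBell_succ κ) fun n => ?_
  rw [completeBell_succ, funext h]

theorem completeBell_zero_cumulants : completeBell 0 = Pi.single 0 1 := by
  ext n
  cases n with
  | zero => simp
  | succ n => simp [completeBell_succ, binomConv]

theorem completeBell_single_one (x : ℝ) (n : ℕ) : completeBell (Pi.single 1 x) n = x ^ n := by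
  have hx : (fun r => (Pi.single 1 x : ℕ → ℝ) (r + 1)) = Pi.single 0 x := by
    ext r
    simp [Pi.single_apply]
  refine congrFun (eq_of_succ_eq_binomConv (by simp) (completeBell_succ _) fun n => ?_) n
  rw [hx]
  simpa [pow_succ'] using (binomConv_single_left 0 x (fun n => x ^ n) n).symm

theorem completeBell_pow_mul (a : ℝ) (κ : ℕ → ℝ) (n : ℕ) :
    completeBell (fun r => a ^ r * κ r) n = a ^ n * completeBell κ n := by
  refine congrFun (eq_of_succ_eq_binomConv (v := fun n => a ^ n * completeBell κ n) (by simp)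
    (completeBell_succ _) fun n => ?_) n
  simp only [completeBell_succ, binomConv, Finset.mul_sum]
  refine Finset.sum_congr rfl fun p hp => ?_
  rw [← Finset.HasAntidiagonal.mem_antidiagonal.1 hp]
  ring

theorem derivative_expGenFun_completeBell (κ : ℕ → ℝ) :
    PowerSeries.derivative ℝ (expGenFun (completeBell κ)) =
      expGenFun (fun r => κ (r + 1)) * expGenFun (completeBell κ) := by
  rw [derivative_expGenFun, expGenFun_mul]
  simp only [completeBell_succ]

/-- The exponential generating function `E` of the complete Bell polynomials of `κ` is determined
by `E' = K E`, where `K` is additive in `κ`. -/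
theorem completeBell_add (κ κ' : ℕ → ℝ) :
    completeBell (κ + κ') = binomConv (completeBell κ) (completeBell κ') := by
  refine eq_of_succ_eq_binomConv (by simp [binomConv]) (completeBell_succ _) (congrFun ?_)
  have hK : expGenFun (fun r => (κ + κ') (r + 1)) =
      expGenFun (fun r => κ (r + 1)) + expGenFun fun r => κ' (r + 1) := by
    ext n
    simp [expGenFun, add_div]
  refine expGenFun_injective ?_
  rw [← derivative_expGenFun, ← expGenFun_mul _ (binomConv _ _),
    ← expGenFun_mul (completeBell κ), Derivation.leibniz,
    derivative_expGenFun_completeBell, derivative_expGenFun_completeBell, hK]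
  simp only [smul_eq_mul]
  ring

theorem tendsto_completeBell {ι : Type*} {l : Filter ι} {κ : ι → ℕ → ℝ} {κ' : ℕ → ℝ}
    (h : ∀ r, Tendsto (fun i => κ i r) l (𝓝 (κ' r))) (n : ℕ) :
    Tendsto (fun i => completeBell (κ i) n) l (𝓝 (completeBell κ' n)) := by
  induction n using Nat.strong_induction_on with
  | _ n ih =>
    cases n with
    | zero => simp only [completeBell_zero, tendsto_const_nhds]
    | succ n =>
      simp only [completeBell_succ]
      exact tendsto_finsetSum _ fun p hp => ((h _).mul (ih p.2
        (Nat.lt_succ_of_le (Finset.HasAntidiagonal.antidiagonal.snd_le hp)))).const_mul _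

theorem continuous_completeBell {X : Type*} [TopologicalSpace X] {κ : X → ℕ → ℝ}
    (h : ∀ r, Continuous fun x => κ x r) (n : ℕ) : Continuous fun x => completeBell (κ x) n :=
  continuous_iff_continuousAt.2 fun _ => tendsto_completeBell (fun r => (h r).continuousAt) n

theorem hasDerivAt_completeBell_of_eq_zero {κ : ℝ → ℕ → ℝ} {κ' : ℕ → ℝ} {t : ℝ}
    (h : ∀ r, HasDerivAt (fun s => κ s r) (κ' r) t) (h0 : κ t = 0) (n : ℕ) :
    HasDerivAt (fun s => completeBell (κ s) n) (Function.update κ' 0 0 n) t := by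
  induction n using Nat.strong_induction_on with
  | _ n ih =>
    cases n with
    | zero => simpa using hasDerivAt_const t (1 : ℝ)
    | succ n =>
      simp only [completeBell_succ]
      refine (HasDerivAt.fun_sum fun p hp => ((h (p.1 + 1)).mul (ih p.2
        (Nat.lt_succ_of_le (Finset.HasAntidiagonal.antidiagonal.snd_le hp)))).const_mul
          (n.choose p.1 : ℝ)).congr_deriv ?_
      rw [h0, completeBell_zero_cumulants, Finset.sum_eq_single (n, 0)]
      · simp
      · rintro ⟨i, j⟩ hp hne
        have hj : j ≠ 0 := fun h => hne (by
          have := Finset.HasAntidiagonal.mem_antidiagonal.1 hp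
          ext <;> grind)
        simp [hj]
      · simp

theorem hasDerivAt_completeBell {κ : ℝ → ℕ → ℝ} {κ' : ℕ → ℝ} {t : ℝ}
    (h : ∀ r, HasDerivAt (fun s => κ s r) (κ' r) t) (n : ℕ) :
    HasDerivAt (fun s => completeBell (κ s) n)
      (binomConv (Function.update κ' 0 0) (completeBell (κ t)) n) t := by
  have hsplit : ∀ s, completeBell (κ s) n =
      binomConv (completeBell (κ s - κ t)) (completeBell (κ t)) n := fun s => by
    rw [← completeBell_add, sub_add_cancel]
  simp only [hsplit]
  exact HasDerivAt.fun_sum fun p _ => ((hasDerivAt_completeBell_of_eq_zero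
    (fun r => (h r).sub_const (κ t r)) (sub_self _) p.1).mul_const _).const_mul _

/-- The `k`-th power of a sequence under binomial convolution: the moments of a sum of `k`
independent random variables with moments `m`. -/
def binomConvPow (m : ℕ → ℝ) : ℕ → ℕ → ℝ
  | 0 => Pi.single 0 1
  | k + 1 => binomConv m (binomConvPow m k)

theorem binomConvPow_apply_zero {m : ℕ → ℝ} (hm : m 0 = 1) (k : ℕ) : binomConvPow m k 0 = 1 := by
  induction k with
  | zero => simp [binomConvPow]
  | succ k ih => simp [binomConvPow, binomConv, hm, ih]

theorem expGenFun_binomConvPow (m : ℕ → ℝ) (k : ℕ) :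
    expGenFun (binomConvPow m k) = expGenFun m ^ k := by
  induction k with
  | zero =>
    ext n
    simp only [expGenFun, binomConvPow, PowerSeries.coeff_mk, pow_zero, PowerSeries.coeff_one]
    by_cases hn : n = 0 <;> simp [hn]
  | succ k ih => rw [binomConvPow, ← expGenFun_mul, ih, pow_succ']

theorem binomConvPow_succ_succ (m : ℕ → ℝ) (k n : ℕ) : binomConvPow m (k + 1) (n + 1) =
    (k + 1) * binomConv (fun r => m (r + 1)) (binomConvPow m k) n := by
  suffices h : (fun n => binomConvPow m (k + 1) (n + 1)) =
      ((k + 1 : ℕ) : ℝ) • binomConv (fun r => m (r + 1)) (binomConvPow m k) by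
    simpa using congrFun h n
  have hsmul : ∀ (c : ℝ) (u : ℕ → ℝ), expGenFun (c • u) = c • expGenFun u := fun c u => by
    ext n
    simp [expGenFun, mul_div_assoc]
  refine expGenFun_injective ?_
  rw [← derivative_expGenFun, expGenFun_binomConvPow, Derivation.leibniz_pow, hsmul,
    ← expGenFun_mul, expGenFun_binomConvPow, derivative_expGenFun, Nat.cast_smul_eq_nsmul]
  simp only [Nat.add_sub_cancel, smul_eq_mul, mul_comm]

/-- Since `k` times the Poisson weight of `k` is `ν` times that of `k - 1`, the moments of a
Poisson sum satisfy the recursion of the complete Bell polynomials. -/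
theorem hasSum_poisson_binomConvPow (ν : ℝ≥0) {m : ℕ → ℝ} (hm : m 0 = 1) (n : ℕ) :
    HasSum (fun k : ℕ => Real.exp (-ν) * (ν : ℝ) ^ k / k.factorial * binomConvPow m k n)
      (completeBell (fun r => ν * m r) n) := by
  induction n using Nat.strong_induction_on with
  | _ n ih =>
    cases n with
    | zero => simpa [binomConvPow_apply_zero hm] using hasSum_one_poissonMeasure ν
    | succ n =>
      rw [← hasSum_nat_add_iff' 1, completeBell_succ]
      simp only [Finset.range_one, Finset.sum_singleton, binomConvPow,
        Pi.single_eq_of_ne n.succ_ne_zero, mul_zero, sub_zero]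
      have hterm : ∀ k : ℕ, Real.exp (-ν) * (ν : ℝ) ^ (k + 1) / (k + 1).factorial *
          binomConvPow m (k + 1) (n + 1) = ∑ q ∈ Finset.HasAntidiagonal.antidiagonal n,
            (n.choose q.1 : ℝ) * (ν * m (q.1 + 1) *
              (Real.exp (-ν) * (ν : ℝ) ^ k / k.factorial * binomConvPow m k q.2)) := fun k => by
        have := Nat.factorial_ne_zero k
        rw [binomConvPow_succ_succ, binomConv, Nat.factorial_succ, Finset.mul_sum, Finset.mul_sum]
        refine Finset.sum_congr rfl fun q _ => ?_
        push_cast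
        field_simp
        ring
      refine HasSum.congr_fun ?_ hterm
      exact hasSum_sum fun q hq => ((ih q.2 (Nat.lt_succ_of_le
        (Finset.HasAntidiagonal.antidiagonal.snd_le hq))).mul_left _).mul_left _

section Moments

variable {Ω : Type*} [MeasurableSpace Ω] {P : Measure Ω} {p : ℕ}

theorem integrable_pow_of_memLp [IsFiniteMeasure P] {X : Ω → ℝ} (hX : MemLp X p P) {n : ℕ}
    (hn : n ≤ p) : Integrable (fun ω => X ω ^ n) P := by
  have hXn : AEStronglyMeasurable (fun ω => X ω ^ n) P := hX.1.pow n
  rw [← integrable_norm_iff hXn]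
  simpa only [norm_pow] using (hX.mono_exponent (by exact_mod_cast hn)).integrable_norm_pow'

theorem memLp_of_integrable_pow {X : Ω → ℝ} (hX : AEStronglyMeasurable X P) (hp : p ≠ 0)
    (h : Integrable (fun ω => X ω ^ p) P) : MemLp X p P := by
  rw [← integrable_norm_rpow_iff hX (by exact_mod_cast hp) (ENNReal.natCast_ne_top p)]
  simpa only [ENNReal.toReal_natCast, Real.rpow_natCast, norm_pow] using h.norm

theorem integral_add_pow_of_indepFun [IsFiniteMeasure P] {X Y : Ω → ℝ} (hX : MemLp X p P)
    (hY : MemLp Y p P) (hXY : IndepFun X Y P) {n : ℕ} (hn : n ≤ p) :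
    ∫ ω, (X ω + Y ω) ^ n ∂P =
      binomConv (fun j => ∫ ω, X ω ^ j ∂P) (fun j => ∫ ω, Y ω ^ j ∂P) n := by
  have hind : ∀ i j : ℕ, IndepFun (fun ω => X ω ^ i) (fun ω => Y ω ^ j) P := fun i j =>
    hXY.comp (measurable_id.pow_const i) (measurable_id.pow_const j)
  have hint : ∀ q ∈ Finset.HasAntidiagonal.antidiagonal n,
      Integrable (fun ω => X ω ^ q.1) P ∧ Integrable (fun ω => Y ω ^ q.2) P := fun q hq =>
    ⟨integrable_pow_of_memLp hX ((Finset.HasAntidiagonal.antidiagonal.fst_le hq).trans hn),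
      integrable_pow_of_memLp hY ((Finset.HasAntidiagonal.antidiagonal.snd_le hq).trans hn)⟩
  have hmul : ∀ q ∈ Finset.HasAntidiagonal.antidiagonal n,
      Integrable (fun ω => X ω ^ q.1 * Y ω ^ q.2) P := fun q hq =>
    (hind _ _).integrable_mul (hint q hq).1 (hint q hq).2
  simp only [fun ω => (Commute.all (X ω) (Y ω)).add_pow' n, nsmul_eq_mul]
  rw [binomConv, integral_finsetSum _ fun q hq => (hmul q hq).const_mul _]
  refine Finset.sum_congr rfl fun q hq => ?_
  rw [integral_const_mul, (hind _ _).integral_fun_mul_eq_mul_integral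
    (hint q hq).1.aestronglyMeasurable (hint q hq).2.aestronglyMeasurable]

/-- `X` has a finite `p`-th moment and its first `p` cumulants are `κ 1, …, κ p`, expressed through
the moments of order at most `p`. -/
structure HasCumulants (p : ℕ) (X : Ω → ℝ) (P : Measure Ω) (κ : ℕ → ℝ) : Prop where
  memLp : MemLp X p P
  moment : ∀ n ≤ p, ∫ ω, X ω ^ n ∂P = completeBell κ n

namespace HasCumulants

variable {X Y : Ω → ℝ} {κ κ' : ℕ → ℝ}

theorem integrable_pow [IsFiniteMeasure P] (h : HasCumulants p X P κ) {n : ℕ} (hn : n ≤ p) :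
    Integrable (fun ω => X ω ^ n) P :=
  integrable_pow_of_memLp h.memLp hn

theorem congr (h : HasCumulants p X P κ) (e : X =ᵐ[P] Y) : HasCumulants p Y P κ where
  memLp := h.memLp.ae_eq e
  moment n hn := by
    rw [← h.moment n hn]
    exact integral_congr_ae (e.mono fun ω hω => by simp only [hω])

theorem congr_cumulants (h : HasCumulants p X P κ) (e : ∀ r, κ (r + 1) = κ' (r + 1)) :
    HasCumulants p X P κ' :=
  ⟨h.memLp, completeBell_congr e ▸ h.moment⟩

theorem identDistrib (h : HasCumulants p X P κ) (e : IdentDistrib X Y P P) :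
    HasCumulants p Y P κ where
  memLp := e.memLp_snd h.memLp
  moment n hn := by
    rw [← h.moment n hn]
    exact (e.comp (measurable_id.pow_const n)).integral_eq.symm

theorem const_mul (h : HasCumulants p X P κ) (a : ℝ) :
    HasCumulants p (fun ω => a * X ω) P (fun r => a ^ r * κ r) where
  memLp := h.memLp.const_mul a
  moment n hn := by
    simp only [mul_pow, integral_const_mul, h.moment n hn, completeBell_pow_mul]

theorem zero [IsProbabilityMeasure P] : HasCumulants p (0 : Ω → ℝ) P 0 where
  memLp := MemLp.zero
  moment n _ := by
    cases n <;> simp [completeBell_zero_cumulants]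

theorem add [IsFiniteMeasure P] (hX : HasCumulants p X P κ) (hY : HasCumulants p Y P κ')
    (hXY : IndepFun X Y P) : HasCumulants p (X + Y) P (κ + κ') where
  memLp := hX.memLp.add hY.memLp
  moment n hn := by
    rw [completeBell_add]
    exact (integral_add_pow_of_indepFun hX.memLp hY.memLp hXY hn).trans (binomConv_congr
      (fun j hj => hX.moment j (hj.trans hn)) fun j hj => hY.moment j (hj.trans hn))

theorem of_tendsto [IsFiniteMeasure P] {Xn : ℕ → Ω → ℝ} {κn : ℕ → ℕ → ℝ} {V : Ω → ℝ}
    (h : ∀ n, HasCumulants p (Xn n) P (κn n)) (hV : MemLp V p P)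
    (hb : ∀ n, ∀ᵐ ω ∂P, |Xn n ω| ≤ V ω)
    (hlim : ∀ᵐ ω ∂P, Tendsto (fun n => Xn n ω) atTop (𝓝 (X ω)))
    (hκ : ∀ r, Tendsto (fun n => κn n r) atTop (𝓝 (κ r))) :
    HasCumulants p X P κ where
  memLp := by
    refine hV.mono (aestronglyMeasurable_of_tendsto_ae _ (fun n => (h n).memLp.1) hlim) ?_
    filter_upwards [hlim, ae_all_iff.2 hb] with ω h1 h2
    exact (le_of_tendsto h1.abs (Eventually.of_forall h2)).trans (le_abs_self _)
  moment j hj := by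
    refine tendsto_nhds_unique (f := fun n => ∫ ω, Xn n ω ^ j ∂P) (l := atTop) ?_ ?_
    · refine tendsto_integral_of_dominated_convergence (fun ω => V ω ^ j)
        (fun n => (h n).memLp.1.pow j) (integrable_pow_of_memLp hV hj) (fun n => ?_) ?_
      · filter_upwards [hb n] with ω h2
        rw [norm_pow, Real.norm_eq_abs]
        exact pow_le_pow_left₀ (abs_nonneg _) h2 j
      · filter_upwards [hlim] with ω h2 using h2.pow j
    · simp only [(h _).moment j hj]
      exact tendsto_completeBell hκ j

theorem integrable_completeBell [IsFiniteMeasure P] (h : HasCumulants p X P κ) {n : ℕ}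
    (hn : n ≤ p) (κ' : ℕ → ℝ) :
    Integrable (fun ω => completeBell (Pi.single 1 (X ω) + κ') n) P := by
  simp only [completeBell_add, binomConv, completeBell_single_one]
  exact integrable_finsetSum _ fun q hq => ((h.integrable_pow
    ((Finset.HasAntidiagonal.antidiagonal.fst_le hq).trans hn)).mul_const _).const_mul _

theorem integral_completeBell [IsFiniteMeasure P] (h : HasCumulants p X P κ) {n : ℕ}
    (hn : n ≤ p) (κ' : ℕ → ℝ) :
    ∫ ω, completeBell (Pi.single 1 (X ω) + κ') n ∂P = completeBell (κ + κ') n := by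
  have hle : ∀ q ∈ Finset.HasAntidiagonal.antidiagonal n, q.1 ≤ p := fun q hq =>
    (Finset.HasAntidiagonal.antidiagonal.fst_le hq).trans hn
  simp only [completeBell_add, binomConv, completeBell_single_one]
  rw [integral_finsetSum _ fun q hq =>
    ((h.integrable_pow (hle q hq)).mul_const _).const_mul _]
  refine Finset.sum_congr rfl fun q hq => ?_
  rw [integral_const_mul, integral_mul_const, h.moment _ (hle q hq)]

end HasCumulants

end Moments

/-! ### Compound Poisson processes -/

theorem iUnion_preimage_singleton {α β : Type*} (f : α → β) : ⋃ b, f ⁻¹' {b} = univ := by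
  rw [← preimage_iUnion, iUnion_of_singleton, preimage_univ]

section Independence

variable {Ω : Type*} {mΩ : MeasurableSpace Ω} {P : Measure Ω}

theorem iIndep_sumElim {ι κ : Type*} {m₁ : ι → MeasurableSpace Ω} {m₂ : κ → MeasurableSpace Ω}
    (h₁ : iIndep m₁ P) (h₂ : iIndep m₂ P) (h : Indep (⨆ i, m₁ i) (⨆ j, m₂ j) P) :
    iIndep (Sum.elim m₁ m₂) P := by
  rw [iIndep_iff]
  intro s f hf
  have hl : ∀ i ∈ s.toLeft, MeasurableSet[m₁ i] (f (.inl i)) := fun i hi =>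
    hf _ (Finset.mem_toLeft.1 hi)
  have hr : ∀ j ∈ s.toRight, MeasurableSet[m₂ j] (f (.inr j)) := fun j hj =>
    hf _ (Finset.mem_toRight.1 hj)
  have hsplit : ⋂ i ∈ s, f i = (⋂ i ∈ s.toLeft, f (.inl i)) ∩ ⋂ j ∈ s.toRight, f (.inr j) := by
    ext ω
    simp only [mem_iInter, mem_inter_iff, Sum.forall, Finset.mem_toLeft, Finset.mem_toRight]
  rw [hsplit, Finset.prod_sum_eq_prod_toLeft_mul_prod_toRight,
    ← (iIndep_iff _ _).1 h₁ _ hl, ← (iIndep_iff _ _).1 h₂ _ hr]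
  exact (Indep_iff _ _ _).1 h _ _
    (Finset.measurableSet_biInter _ fun i hi => le_iSup m₁ i _ (hl i hi))
    (Finset.measurableSet_biInter _ fun j hj => le_iSup m₂ j _ (hr j hj))

theorem indepFun_of_levels [IsProbabilityMeasure P] {ι α β : Type*} [Countable ι]
    [MeasurableSpace ι] [MeasurableSingletonClass ι] [MeasurableSpace α] [MeasurableSpace β]
    {K : Ω → ι} {X : Ω → α} {Y : Ω → β} {μ : Measure β} {X' : ι → Ω → α} {Y' : ι → Ω → β}
    (hK : Measurable K) (hX : Measurable X) (hY : Measurable Y)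
    (hXX' : ∀ ω, X ω = X' (K ω) ω) (hYY' : ∀ ω, Y ω = Y' (K ω) ω)
    (hind : ∀ l, IndepFun (fun ω => (X' l ω, K ω)) (Y' l) P) (hlaw : ∀ l, HasLaw (Y' l) μ P) :
    IndepFun X Y P ∧ HasLaw Y μ P := by
  have hlevel : ∀ l, ∀ A : Set α, MeasurableSet A → ∀ B : Set β, MeasurableSet B →
      P (X ⁻¹' A ∩ Y ⁻¹' B ∩ K ⁻¹' {l}) = P (X ⁻¹' A ∩ K ⁻¹' {l}) * μ B := by
    intro l A hA B hB
    have e : X ⁻¹' A ∩ Y ⁻¹' B ∩ K ⁻¹' {l} =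
        (fun ω => (X' l ω, K ω)) ⁻¹' (A ×ˢ {l}) ∩ Y' l ⁻¹' B := by
      ext ω
      simp only [mem_inter_iff, mem_preimage, mem_prod, mem_singleton_iff, hXX', hYY']
      grind
    have e' : X ⁻¹' A ∩ K ⁻¹' {l} = (fun ω => (X' l ω, K ω)) ⁻¹' (A ×ˢ {l}) := by
      ext ω
      simp only [mem_inter_iff, mem_preimage, mem_prod, mem_singleton_iff, hXX']
      grind
    rw [e, e', (hind l).measure_inter_preimage_eq_mul _ _
      (hA.prod (measurableSet_singleton l)) hB, ← (hlaw l).map_eq,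
      Measure.map_apply_of_aemeasurable (hlaw l).aemeasurable hB]
  have hsum : ∀ E : Set Ω, MeasurableSet E → P E = ∑' l, P (E ∩ K ⁻¹' {l}) := fun E hE => by
    have hdisj : Pairwise (Function.onFun Disjoint fun l => E ∩ K ⁻¹' {l}) := fun l l' hll' =>
      ((disjoint_singleton.2 hll').preimage K).mono inter_subset_right inter_subset_right
    rw [← measure_iUnion hdisj fun l => hE.inter (hK (measurableSet_singleton l)),
      ← inter_iUnion, iUnion_preimage_singleton, inter_univ]
  have hmul : ∀ A : Set α, MeasurableSet A → ∀ B : Set β, MeasurableSet B →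
      P (X ⁻¹' A ∩ Y ⁻¹' B) = P (X ⁻¹' A) * μ B := fun A hA B hB => by
    rw [hsum _ ((hX hA).inter (hY hB)), hsum _ (hX hA), ← ENNReal.tsum_mul_right]
    exact tsum_congr fun l => hlevel l A hA B hB
  have hYμ : ∀ B : Set β, MeasurableSet B → P (Y ⁻¹' B) = μ B := fun B hB => by
    simpa using hmul univ MeasurableSet.univ B hB
  refine ⟨indepFun_iff_measure_inter_preimage_eq_mul.2 fun A B hA hB => ?_, hY.aemeasurable, ?_⟩
  · rw [hmul A hA B hB, hYμ B hB]
  · ext B hB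
    rw [Measure.map_apply hY hB, hYμ B hB]

end Independence

section RandomSum

variable {Ω : Type*} [MeasurableSpace Ω] {P : Measure Ω} {p : ℕ} {K : Ω → ℕ} {ξ : ℕ → Ω → ℝ}

theorem measurable_sum_range (hK : Measurable K) (hξ : ∀ n, Measurable (ξ n)) :
    Measurable fun ω => ∑ n ∈ Finset.range (K ω), ξ n ω :=
  (measurable_from_prod_countable_right (f := fun q : ℕ × Ω => ∑ n ∈ Finset.range q.1, ξ n q.2)
    fun k => Finset.measurable_fun_sum (Finset.range k) fun n _ => hξ n).comp
    (hK.prodMk measurable_id)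

theorem measurable_sum_range_add {J : Ω → ℕ} (hJ : Measurable J) (hK : Measurable K)
    (hξ : ∀ n, Measurable (ξ n)) :
    Measurable fun ω => ∑ n ∈ Finset.range (K ω), ξ (J ω + n) ω := by
  have hsplit : (fun ω => ∑ n ∈ Finset.range (K ω), ξ (J ω + n) ω) = fun ω =>
      (∑ n ∈ Finset.range (J ω + K ω), ξ n ω) - ∑ n ∈ Finset.range (J ω), ξ n ω :=
    funext fun ω => (Finset.sum_range_add_sub_sum_range (fun n => ξ n ω) _ _).symm
  rw [hsplit]
  exact (measurable_sum_range (hJ.add hK) hξ).sub (measurable_sum_range hJ hξ)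

variable {m : ℕ → ℝ}

theorem integral_sum_range_pow (hind : iIndepFun ξ P) (hξ : ∀ n, Measurable (ξ n))
    (hLp : ∀ n, MemLp (ξ n) p P) (hm : ∀ n, ∀ r ≤ p, ∫ ω, ξ n ω ^ r ∂P = m r) (k : ℕ) {j : ℕ}
    (hj : j ≤ p) : ∫ ω, (∑ n ∈ Finset.range k, ξ n ω) ^ j ∂P = binomConvPow m k j := by
  have := hind.isProbabilityMeasure
  induction k generalizing j with
  | zero => cases j <;> simp [binomConvPow]
  | succ k ih =>
    have hk : IndepFun (ξ k) (fun ω => ∑ n ∈ Finset.range k, ξ n ω) P := by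
      simpa only [Finset.sum_fn] using
        (hind.indepFun_finsetSum_of_notMem hξ Finset.notMem_range_self).symm
    simp only [Finset.sum_range_succ_comm]
    rw [integral_add_pow_of_indepFun (hLp k) (memLp_finsetSum _ fun n _ => hLp n) hk hj]
    exact binomConv_congr (fun i hi => hm k i (hi.trans hj)) fun i hi => ih (hi.trans hj)

theorem setIntegral_count_eq {ν : ℝ≥0} (hK : Measurable K) (hlaw : HasLaw K (poissonMeasure ν) P)
    (hξ : ∀ n, Measurable (ξ n)) (hKξ : IndepFun K (fun ω n => ξ n ω) P) {f : (ℕ → ℝ) → ℝ}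
    (hf : Measurable f) (k : ℕ) :
    ∫ ω in K ⁻¹' {k}, f (fun n => ξ n ω) ∂P =
      Real.exp (-ν) * (ν : ℝ) ^ k / k.factorial * ∫ ω, f (fun n => ξ n ω) ∂P := by
  rw [Indep.setIntegral_eq_mul hK.comap_le hKξ (measurable_pi_lambda _ hξ).aemeasurable
    ⟨{k}, measurableSet_singleton k, rfl⟩ hf.aestronglyMeasurable,
    ← poissonMeasure_real_singleton ν k]
  congr 1
  exact hlaw.measureReal_eq (p := (· = k)) (measurableSet_singleton k)

variable {F : Measure ℝ} {ν : ℝ≥0}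

theorem integrable_poissonSum_pow (hK : Measurable K) (hlaw : HasLaw K (poissonMeasure ν) P)
    (hξ : ∀ n, Measurable (ξ n)) (hξF : ∀ n, HasLaw (ξ n) F P) (hind : iIndepFun ξ P)
    (hKξ : IndepFun K (fun ω n => ξ n ω) P) (hLp : ∀ n, MemLp (ξ n) p P) {j : ℕ} (hj : j ≤ p) :
    Integrable (fun ω => (∑ n ∈ Finset.range (K ω), ξ n ω) ^ j) P := by
  have := hind.isProbabilityMeasure
  have hLp_abs : ∀ n, MemLp (fun ω => |ξ n ω|) p P := fun n => (hLp n).abs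
  have habs : ∀ k, ∫ ω, (∑ n ∈ Finset.range k, |ξ n ω|) ^ j ∂P =
      binomConvPow (fun r => ∫ x, |x| ^ r ∂F) k j := fun k =>
    integral_sum_range_pow (hind.comp (fun _ x => |x|) fun _ => measurable_norm)
      (fun n => (hξ n).norm) hLp_abs
      (fun n r _ => (hξF n).integral_comp (f := fun x => |x| ^ r) (by fun_prop)) k hj
  have hone : ∫ x, |x| ^ 0 ∂F = 1 := by
    have := (hξF 0).isProbabilityMeasure_iff.1 ‹_›
    simp
  have hS : ∀ k, Integrable (fun ω => (∑ n ∈ Finset.range k, ξ n ω) ^ j) P := fun k =>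
    integrable_pow_of_memLp (memLp_finsetSum _ fun n _ => hLp n) hj
  have hlevel : ∀ k : ℕ, MeasurableSet (K ⁻¹' {k}) := fun k => hK (measurableSet_singleton k)
  rw [← integrableOn_univ, ← iUnion_preimage_singleton K]
  refine integrableOn_iUnion_of_summable_integral_norm (fun k => ?_) <|
    .of_nonneg_of_le (fun k => integral_nonneg fun ω => norm_nonneg _) (fun k => ?_)
      (hasSum_poisson_binomConvPow ν (m := fun r => ∫ x, |x| ^ r ∂F) hone j).summable
  · exact (integrableOn_congr_fun (fun ω hω => by rw [show K ω = k from hω]) (hlevel k)).2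
      (hS k).integrableOn
  · rw [← habs k, ← setIntegral_count_eq hK hlaw hξ hKξ
      (f := fun x => (∑ n ∈ Finset.range k, |x n|) ^ j) (by fun_prop)]
    refine integral_mono_ae ?_ (integrable_pow_of_memLp
      (memLp_finsetSum _ fun n _ => hLp_abs n) hj).integrableOn ?_
    · exact ((integrableOn_congr_fun (fun ω hω => by rw [show K ω = k from hω]) (hlevel k)).2
        (hS k).integrableOn).norm
    · filter_upwards [ae_restrict_mem (hlevel k)] with ω hω
      rw [show K ω = k from hω, norm_pow]
      exact pow_le_pow_left₀ (norm_nonneg _) (Finset.abs_sum_le_sum_abs _ _) j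

theorem hasCumulants_poissonSum (hK : Measurable K) (hlaw : HasLaw K (poissonMeasure ν) P)
    (hξ : ∀ n, Measurable (ξ n)) (hξF : ∀ n, HasLaw (ξ n) F P) (hind : iIndepFun ξ P)
    (hKξ : IndepFun K (fun ω n => ξ n ω) P) (hF : MemLp id p F) :
    HasCumulants p (fun ω => ∑ n ∈ Finset.range (K ω), ξ n ω) P
      (fun r => ν * ∫ x, x ^ r ∂F) := by
  have := hind.isProbabilityMeasure
  have hLp : ∀ n, MemLp (ξ n) p P := fun n =>
    MemLp.comp_of_map (g := id) ((hξF n).map_eq ▸ hF) (hξ n).aemeasurable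
  have hint := fun {j} => integrable_poissonSum_pow hK hlaw hξ hξF hind hKξ hLp (j := j)
  constructor
  · rcases eq_or_ne p 0 with rfl | hp
    · rw [Nat.cast_zero, memLp_zero_iff_aestronglyMeasurable]
      exact (measurable_sum_range hK hξ).aestronglyMeasurable
    · exact memLp_of_integrable_pow (measurable_sum_range hK hξ).aestronglyMeasurable hp
        (hint le_rfl)
  · intro j hj
    have hone : ∫ x, x ^ 0 ∂F = 1 := by
      have := (hξF 0).isProbabilityMeasure_iff.1 ‹_›
      simp
    have hlevel : ∀ k : ℕ, MeasurableSet (K ⁻¹' {k}) := fun k => hK (measurableSet_singleton k)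
    have hsum := hasSum_integral_iUnion hlevel
      (fun k k' hkk' => (disjoint_singleton.2 hkk').preimage K)
      (hint hj).integrableOn
    rw [iUnion_preimage_singleton, setIntegral_univ] at hsum
    refine hsum.unique ((hasSum_poisson_binomConvPow ν
      (m := fun r => ∫ x, x ^ r ∂F) hone j).congr_fun fun k => ?_)
    rw [← integral_sum_range_pow hind hξ hLp
      (fun n r _ => (hξF n).integral_comp (f := fun x => x ^ r) (by fun_prop)) k hj,
      ← setIntegral_count_eq hK hlaw hξ hKξ
      (f := fun x => (∑ n ∈ Finset.range k, x n) ^ j) (by fun_prop)]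
    exact setIntegral_congr_fun (hlevel k) fun ω hω => by rw [show K ω = k from hω]

end RandomSum

section Blocks

variable {Ω : Type*} {mΩ : MeasurableSpace Ω} {P : Measure Ω} {F : Measure ℝ} {D : ℕ → Ω → ℕ}
  {ξ : ℕ → Ω → ℝ} {p : ℕ}

/-- When the sequence `ξ` is cut into consecutive blocks of lengths `D 0`, `D 1`, …, the index of
the first term of the block `i`. -/
def blockStart (D : ℕ → Ω → ℕ) (i : ℕ) (ω : Ω) : ℕ := ∑ j ∈ Finset.range i, D j ω

/-- The sum of the block `i` when the sequence `ξ` is cut into consecutive blocks of lengths `D 0`,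
`D 1`, …. -/
def blockSum (D : ℕ → Ω → ℕ) (ξ : ℕ → Ω → ℝ) (i : ℕ) (ω : Ω) : ℝ :=
  ∑ n ∈ Finset.range (D i ω), ξ (blockStart D i ω + n) ω

/-- The σ-algebras of the block lengths `D` and of the summands `ξ`. -/
@[reducible]
def blockSigma (D : ℕ → Ω → ℕ) (ξ : ℕ → Ω → ℝ) : ℕ ⊕ ℕ → MeasurableSpace Ω :=
  Sum.elim (fun i => .comap (D i) inferInstance) (fun n => .comap (ξ n) inferInstance)

/-- Independent block lengths `D` and summands `ξ`, the latter with common law `F`. -/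
structure IsBlockSequence (P : Measure Ω) (F : Measure ℝ) (D : ℕ → Ω → ℕ) (ξ : ℕ → Ω → ℝ) :
    Prop where
  measurable_length : ∀ i, Measurable (D i)
  measurable_summand : ∀ n, Measurable (ξ n)
  law : ∀ n, HasLaw (ξ n) F P
  indep : iIndep (blockSigma D ξ) P

theorem measurable_blockStart (m : ℕ) (hD : ∀ i < m, Measurable (D i)) :
    Measurable (blockStart D m) :=
  Finset.measurable_fun_sum _ fun i hi => hD i (Finset.mem_range.1 hi)

theorem measurable_sum_mul_blockSum (m : ℕ) (hD : ∀ i < m, Measurable (D i))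
    (hξ : ∀ n, Measurable (ξ n)) (a : ℕ → ℝ) :
    Measurable fun ω => ∑ i ∈ Finset.range m, a i * blockSum D ξ i ω :=
  Finset.measurable_fun_sum _ fun i hi => by
    have him := Finset.mem_range.1 hi
    exact (measurable_sum_range_add (measurable_blockStart i fun j hj => hD j (hj.trans him))
      (hD i him) hξ).const_mul _

theorem blockStart_add_lt {i m n : ℕ} (him : i < m) {ω : Ω} (hn : n < D i ω) :
    blockStart D i ω + n < blockStart D m ω :=
  calc blockStart D i ω + n < blockStart D (i + 1) ω := by
        rw [blockStart, blockStart, Finset.sum_range_succ]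
        omega
    _ ≤ blockStart D m ω := Finset.sum_le_sum_of_subset (Finset.range_subset_range.2 him)

namespace IsBlockSequence

variable (h : IsBlockSequence P F D ξ)
include h

theorem iIndepFun_summand : iIndepFun ξ P :=
  h.indep.precomp (g := Sum.inr) Sum.inr_injective

theorem indep_disjoint {S T : Set (ℕ ⊕ ℕ)} (hST : Disjoint S T) :
    Indep (⨆ i ∈ S, blockSigma D ξ i) (⨆ i ∈ T, blockSigma D ξ i) P := by
  refine indep_iSup_of_disjoint ?_ h.indep hST
  rintro (i | n)
  · exact (h.measurable_length i).comap_le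
  · exact (h.measurable_summand n).comap_le

omit h in
theorem measurable_length_iSup {S : Set (ℕ ⊕ ℕ)} {i : ℕ} (hi : Sum.inl i ∈ S) :
    Measurable[⨆ i ∈ S, blockSigma D ξ i] (D i) :=
  (comap_measurable (D i)).mono (le_iSup₂_of_le (Sum.inl i) hi le_rfl) le_rfl

omit h in
theorem measurable_summand_iSup {S : Set (ℕ ⊕ ℕ)} {n : ℕ} (hn : Sum.inr n ∈ S) :
    Measurable[⨆ i ∈ S, blockSigma D ξ i] (ξ n) :=
  (comap_measurable (ξ n)).mono (le_iSup₂_of_le (Sum.inr n) hn le_rfl) le_rfl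

theorem indepFun_length_summand (m l : ℕ) : IndepFun (D m) (fun ω n => ξ (l + n) ω) P := by
  refine indep_of_indep_of_le (h.indep_disjoint (S := {Sum.inl m}) disjoint_compl_right)
    (measurable_length_iSup (mem_singleton (Sum.inl m))).comap_le (Measurable.comap_le ?_)
  have hξ : ∀ n, Measurable[⨆ i ∈ ({Sum.inl m}ᶜ : Set (ℕ ⊕ ℕ)), blockSigma D ξ i] (ξ n) :=
    fun n => measurable_summand_iSup (by simp)
  let _ : MeasurableSpace Ω := ⨆ i ∈ ({Sum.inl m}ᶜ : Set (ℕ ⊕ ℕ)), blockSigma D ξ i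
  exact measurable_pi_lambda _ fun n => hξ (l + n)

theorem hasLaw_shifted (m l : ℕ) :
    HasLaw (fun ω => ∑ n ∈ Finset.range (D m ω), ξ (l + n) ω)
      (P.map fun ω => ∑ n ∈ Finset.range (D m ω), ξ n ω) P := by
  have := h.indep.isProbabilityMeasure
  have hshift : IdentDistrib (fun ω n => ξ (l + n) ω) (fun ω n => ξ n ω) P P :=
    .pi (fun n => (h.law (l + n)).identDistrib (h.law n))
      (h.iIndepFun_summand.precomp (add_right_injective l)) h.iIndepFun_summand
  have hpair := (IdentDistrib.refl (h.measurable_length m).aemeasurable).prodMk hshift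
    (h.indepFun_length_summand m l) (by simpa using h.indepFun_length_summand m 0)
  have hsum : IdentDistrib (fun ω => ∑ n ∈ Finset.range (D m ω), ξ (l + n) ω)
      (fun ω => ∑ n ∈ Finset.range (D m ω), ξ n ω) P P :=
    hpair.comp (u := fun x : ℕ × (ℕ → ℝ) => ∑ n ∈ Finset.range x.1, x.2 n)
      (measurable_sum_range measurable_fst fun n => (measurable_pi_apply n).comp measurable_snd)
  exact ⟨hsum.aemeasurable_fst, hsum.map_eq⟩

theorem indepFun_truncated_shifted (a : ℕ → ℝ) (m l : ℕ) :
    IndepFun (fun ω => (∑ i ∈ Finset.range m,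
        a i * blockSum D (fun n ω => if n < l then ξ n ω else 0) i ω, blockStart D m ω))
      (fun ω => ∑ n ∈ Finset.range (D m ω), ξ (l + n) ω) P := by
  let S : Set (ℕ ⊕ ℕ) := {j | Sum.elim (· < m) (· < l) j}
  have hDS : ∀ i < m, Measurable[⨆ j ∈ S, blockSigma D ξ j] (D i) := fun i hi =>
    measurable_length_iSup hi
  have hξS : ∀ n < l, Measurable[⨆ j ∈ S, blockSigma D ξ j] (ξ n) := fun n hn =>
    measurable_summand_iSup hn
  have hDT : Measurable[⨆ j ∈ Sᶜ, blockSigma D ξ j] (D m) :=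
    measurable_length_iSup (lt_irrefl m)
  have hξT : ∀ n, Measurable[⨆ j ∈ Sᶜ, blockSigma D ξ j] (ξ (l + n)) := fun n =>
    measurable_summand_iSup (Nat.le_add_right l n).not_gt
  refine indep_of_indep_of_le (h.indep_disjoint (disjoint_compl_right (a := S)))
    (Measurable.comap_le ?_) (Measurable.comap_le ?_)
  · let _ : MeasurableSpace Ω := ⨆ j ∈ S, blockSigma D ξ j
    refine (measurable_sum_mul_blockSum m hDS (fun n => ?_) a).prodMk (measurable_blockStart m hDS)
    split_ifs with hn
    exacts [hξS n hn, measurable_const]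
  · let _ : MeasurableSpace Ω := ⨆ j ∈ Sᶜ, blockSigma D ξ j
    exact measurable_sum_range hDT hξT

/-- The block `m` starts at a random index; on the event that this index is `l`, the blocks before
it only involve the summands before `l`. -/
theorem indepFun_sum_blockSum (a : ℕ → ℝ) (m : ℕ) :
    IndepFun (fun ω => ∑ i ∈ Finset.range m, a i * blockSum D ξ i ω) (blockSum D ξ m) P ∧
      HasLaw (blockSum D ξ m) (P.map fun ω => ∑ n ∈ Finset.range (D m ω), ξ n ω) P := by
  have := h.indep.isProbabilityMeasure
  have hD := h.measurable_length
  have hξ := h.measurable_summand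
  refine indepFun_of_levels (measurable_blockStart m fun i _ => hD i)
    (measurable_sum_mul_blockSum m (fun i _ => hD i) hξ a)
    (measurable_sum_range_add (measurable_blockStart m fun i _ => hD i) (hD m) hξ)
    (fun ω => ?_) (fun ω => rfl) (h.indepFun_truncated_shifted a m) (h.hasLaw_shifted m)
  refine Finset.sum_congr rfl fun i hi => congrArg _ (Finset.sum_congr rfl fun n hn => ?_)
  exact (if_pos (blockStart_add_lt (Finset.mem_range.1 hi) (Finset.mem_range.1 hn))).symm

theorem hasCumulants_sum_blockSum (hF : MemLp id p F) (a : ℕ → ℝ) {ν : ℕ → ℝ≥0}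
    (hν : ∀ i, HasLaw (D i) (poissonMeasure (ν i)) P) (m : ℕ) :
    HasCumulants p (fun ω => ∑ i ∈ Finset.range m, a i * blockSum D ξ i ω) P
      (fun r => ∑ i ∈ Finset.range m, a i ^ r * (ν i * ∫ x, x ^ r ∂F)) := by
  have := h.indep.isProbabilityMeasure
  induction m with
  | zero =>
    simp only [Finset.range_zero, Finset.sum_empty]
    exact .zero
  | succ m ih =>
    obtain ⟨hind, hlaw⟩ := h.indepFun_sum_blockSum a m
    have hrand : HasCumulants p (fun ω => ∑ n ∈ Finset.range (D m ω), ξ n ω) P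
        (fun r => ν m * ∫ x, x ^ r ∂F) :=
      hasCumulants_poissonSum (h.measurable_length m) (hν m) h.measurable_summand h.law
        h.iIndepFun_summand (by simpa using h.indepFun_length_summand m 0) hF
    have hlast : HasCumulants p (blockSum D ξ m) P (fun r => ν m * ∫ x, x ^ r ∂F) :=
      hrand.identDistrib ⟨hrand.memLp.aemeasurable, hlaw.aemeasurable, hlaw.map_eq.symm⟩
    simp only [Finset.sum_range_succ]
    exact ih.add (hlast.const_mul (a m)) (hind.comp measurable_id (measurable_const_mul _))

end IsBlockSequence

end Blocks

section StieltjesSums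

variable {w w' O : ℝ → ℝ} {t u a b C : ℝ}

/-- The points of the uniform partition of `[t, u]` into `n + 1` intervals. -/
def node (t u : ℝ) (n i : ℕ) : ℝ := t + (u - t) * (i / (n + 1))

/-- The left Riemann-Stieltjes sum of `∫ w dO` over `[t, u]` for the uniform partition into `n + 1`
intervals. -/
def stieltjesSum (w O : ℝ → ℝ) (t u : ℝ) (n : ℕ) : ℝ :=
  ∑ i ∈ Finset.range (n + 1), w (node t u n i) * (O (node t u n (i + 1)) - O (node t u n i))

theorem node_zero (t u : ℝ) (n : ℕ) : node t u n 0 = t := by simp [node]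

theorem node_last (t u : ℝ) (n : ℕ) : node t u n (n + 1) = u := by
  have hn : (n : ℝ) + 1 ≠ 0 := by positivity
  simp [node, div_self hn]

theorem monotone_node (h : t ≤ u) (n : ℕ) : Monotone (node t u n) := fun i j hij => by
  have : 0 ≤ u - t := sub_nonneg.2 h
  unfold node
  gcongr

theorem node_succ_sub (t u : ℝ) (n i : ℕ) :
    node t u n (i + 1) - node t u n i = (u - t) / (n + 1) := by
  have hn : (n : ℝ) + 1 ≠ 0 := by positivity
  simp only [node, Nat.cast_add, Nat.cast_one]
  field_simp
  ring

theorem le_node (h : t ≤ u) (n i : ℕ) : t ≤ node t u n i :=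
  (node_zero t u n).ge.trans (monotone_node h n i.zero_le)

theorem node_mem_Icc (h : t ≤ u) {n i : ℕ} (hi : i ≤ n + 1) : node t u n i ∈ Icc t u :=
  ⟨le_node h n i, (monotone_node h n hi).trans (node_last t u n).le⟩

theorem sum_node_sub (O : ℝ → ℝ) (t u : ℝ) (n : ℕ) :
    ∑ i ∈ Finset.range (n + 1), (O (node t u n (i + 1)) - O (node t u n i)) = O u - O t := by
  rw [Finset.sum_range_sub (fun i => O (node t u n i)), node_zero, node_last]

theorem stieltjesSum_const (C : ℝ) (O : ℝ → ℝ) (t u : ℝ) (n : ℕ) :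
    stieltjesSum (fun _ => C) O t u n = C * (O u - O t) := by
  rw [stieltjesSum, ← Finset.mul_sum, sum_node_sub]

theorem abs_stieltjesSum_le (htu : t ≤ u) (hO : MonotoneOn O (Icc t u))
    (hw : ∀ s ∈ Icc t u, |w s| ≤ C) (n : ℕ) : |stieltjesSum w O t u n| ≤ C * (O u - O t) := by
  rw [← sum_node_sub O t u n, Finset.mul_sum]
  refine (Finset.abs_sum_le_sum_abs _ _).trans (Finset.sum_le_sum fun i hi => ?_)
  have hi' := Finset.mem_range.1 hi
  have ha : node t u n i ∈ Icc t u := node_mem_Icc htu hi'.le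
  have hb : node t u n (i + 1) ∈ Icc t u := node_mem_Icc htu hi'
  have hab := sub_nonneg.2 (hO ha hb (monotone_node htu n i.le_succ))
  rw [abs_mul, abs_of_nonneg hab]
  exact mul_le_mul_of_nonneg_right (hw _ ha) hab

/-- The integral of `w` against `dO` over `[t, u]` in the form given by integration by parts. -/
def stieltjesIntegral (w w' O : ℝ → ℝ) (t u : ℝ) : ℝ :=
  w u * (O u - O t) - ∫ s in t..u, w' s * (O s - O t)

theorem stieltjesIntegral_sub_left_term (hw : ∀ s, HasDerivAt w (w' s) s) (hw' : Continuous w')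
    (hO : IntervalIntegrable O volume a b) :
    stieltjesIntegral w w' O a b - w a * (O b - O a) = ∫ s in a..b, w' s * (O b - O s) := by
  have hw'i : IntervalIntegrable w' volume a b := hw'.intervalIntegrable a b
  have hlin : ∫ s in a..b, w' s * (O b - O s) =
      (∫ s in a..b, w' s * (O b - O a)) - ∫ s in a..b, w' s * (O s - O a) := by
    rw [← intervalIntegral.integral_sub (hw'i.mul_const _)
      ((hO.sub intervalIntegrable_const).continuousOn_mul hw'.continuousOn)]
    exact intervalIntegral.integral_congr fun s _ => by ring
  rw [hlin, intervalIntegral.integral_mul_const,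
    intervalIntegral.integral_eq_sub_of_hasDerivAt (fun s _ => hw s) hw'i, stieltjesIntegral]
  ring

theorem abs_stieltjesIntegral_sub_left_term_le (hw : ∀ s, HasDerivAt w (w' s) s)
    (hw' : Continuous w') (hab : a ≤ b) (hO : MonotoneOn O (Icc a b))
    (hC : ∀ s ∈ Icc a b, |w' s| ≤ C) :
    |stieltjesIntegral w w' O a b - w a * (O b - O a)| ≤ C * (O b - O a) * (b - a) := by
  have hOi : IntervalIntegrable O volume a b := by
    rw [← uIcc_of_le hab] at hO
    exact hO.intervalIntegrable
  have hbound : ∀ s ∈ uIoc a b, ‖w' s * (O b - O s)‖ ≤ C * (O b - O a) := fun s hs => by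
    rw [uIoc_of_le hab] at hs
    have hs' : s ∈ Icc a b := Ioc_subset_Icc_self hs
    have has := hO (left_mem_Icc.2 hab) hs' hs'.1
    have hsb := hO hs' (right_mem_Icc.2 hab) hs'.2
    rw [norm_mul, Real.norm_eq_abs (O b - O s), abs_of_nonneg (sub_nonneg.2 hsb)]
    exact mul_le_mul (hC s hs') (by linarith) (sub_nonneg.2 hsb)
      ((abs_nonneg _).trans (hC s hs'))
  rw [stieltjesIntegral_sub_left_term hw hw' hOi]
  simpa only [Real.norm_eq_abs, abs_of_nonneg (sub_nonneg.2 hab)] using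
    intervalIntegral.norm_integral_le_of_norm_le_const hbound

theorem stieltjesIntegral_add_adjacent (hw : ∀ s, HasDerivAt w (w' s) s) (hw' : Continuous w')
    {c : ℝ} (hab : IntervalIntegrable O volume a b) (hbc : IntervalIntegrable O volume b c) :
    stieltjesIntegral w w' O a b + stieltjesIntegral w w' O b c = stieltjesIntegral w w' O a c := by
  have hint : ∀ {x y : ℝ}, IntervalIntegrable O volume x y → ∀ z : ℝ,
      IntervalIntegrable (fun s => w' s * (O s - z)) volume x y := fun h z =>
    (h.sub intervalIntegrable_const).continuousOn_mul hw'.continuousOn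
  have hbase : ∫ s in b..c, w' s * (O s - O b) =
      (∫ s in b..c, w' s * (O s - O a)) - (w c - w b) * (O b - O a) := by
    rw [← intervalIntegral.integral_eq_sub_of_hasDerivAt (fun s _ => hw s)
      (hw'.intervalIntegrable b c), ← intervalIntegral.integral_mul_const,
      ← intervalIntegral.integral_sub (hint hbc _) ((hw'.intervalIntegrable b c).mul_const _)]
    exact intervalIntegral.integral_congr fun s _ => by ring
  rw [stieltjesIntegral, stieltjesIntegral, stieltjesIntegral, hbase,
    ← intervalIntegral.integral_add_adjacent_intervals (hint hab (O a)) (hint hbc (O a))]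
  ring

theorem sum_stieltjesIntegral_node (hw : ∀ s, HasDerivAt w (w' s) s) (hw' : Continuous w')
    (htu : t ≤ u) (hO : MonotoneOn O (Icc t u)) (n : ℕ) :
    ∑ i ∈ Finset.range (n + 1), stieltjesIntegral w w' O (node t u n i) (node t u n (i + 1)) =
      stieltjesIntegral w w' O t u := by
  have hOi : ∀ {i j : ℕ}, i ≤ j → j ≤ n + 1 →
      IntervalIntegrable O volume (node t u n i) (node t u n j) := fun hij hj => by
    refine (hO.mono ?_).intervalIntegrable
    rw [uIcc_of_le (monotone_node htu n hij)]
    exact Icc_subset_Icc (le_node htu n _) (node_mem_Icc htu hj).2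
  suffices h : ∀ m ≤ n + 1, ∑ i ∈ Finset.range m,
      stieltjesIntegral w w' O (node t u n i) (node t u n (i + 1)) =
        stieltjesIntegral w w' O t (node t u n m) by
    rw [h (n + 1) le_rfl, node_last]
  intro m hm
  induction m with
  | zero => simp [stieltjesIntegral, node_zero]
  | succ m ih =>
    have h0m := hOi m.zero_le (m.le_succ.trans hm)
    rw [node_zero] at h0m
    rw [Finset.sum_range_succ, ih (m.le_succ.trans hm),
      stieltjesIntegral_add_adjacent hw hw' h0m (hOi m.le_succ hm)]

theorem abs_stieltjesIntegral_sub_stieltjesSum_le (hw : ∀ s, HasDerivAt w (w' s) s)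
    (hw' : Continuous w') (htu : t ≤ u) (hO : MonotoneOn O (Icc t u))
    (hC : ∀ s ∈ Icc t u, |w' s| ≤ C) (n : ℕ) :
    |stieltjesIntegral w w' O t u - stieltjesSum w O t u n| ≤
      C * (O u - O t) * (u - t) / (n + 1) := by
  rw [← sum_stieltjesIntegral_node hw hw' htu hO n, stieltjesSum, ← Finset.sum_sub_distrib]
  calc _ ≤ ∑ i ∈ Finset.range (n + 1), C * (O (node t u n (i + 1)) - O (node t u n i)) *
          (node t u n (i + 1) - node t u n i) := by
        refine (Finset.abs_sum_le_sum_abs _ _).trans (Finset.sum_le_sum fun i hi => ?_)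
        have hsub : Icc (node t u n i) (node t u n (i + 1)) ⊆ Icc t u :=
          Icc_subset_Icc (le_node htu n i) (node_mem_Icc htu (Finset.mem_range.1 hi)).2
        exact abs_stieltjesIntegral_sub_left_term_le hw hw' (monotone_node htu n i.le_succ)
          (hO.mono hsub) fun s hs => hC s (hsub hs)
    _ = C * (O u - O t) * (u - t) / (n + 1) := by
        simp only [node_succ_sub]
        rw [← Finset.sum_mul, ← Finset.mul_sum, sum_node_sub]
        ring

theorem tendsto_stieltjesSum (hw : ∀ s, HasDerivAt w (w' s) s) (hw' : Continuous w')
    (htu : t ≤ u) (hO : MonotoneOn O (Icc t u)) :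
    Tendsto (stieltjesSum w O t u) atTop (𝓝 (stieltjesIntegral w w' O t u)) := by
  obtain ⟨C, hC⟩ := (isCompact_Icc (a := t) (b := u)).exists_bound_of_continuousOn
    hw'.continuousOn
  rw [tendsto_iff_dist_tendsto_zero]
  refine squeeze_zero (fun n => dist_nonneg) (fun n => ?_)
    ((tendsto_const_div_atTop_nhds_zero_nat (C * (O u - O t) * (u - t))).comp
      (tendsto_add_atTop_nat 1))
  rw [dist_comm, Real.dist_eq]
  simpa using abs_stieltjesIntegral_sub_stieltjesSum_le hw hw' htu hO hC n

theorem stieltjesIntegral_id (hw : ∀ s, HasDerivAt w (w' s) s) (hw' : Continuous w') :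
    stieltjesIntegral w w' id t u = ∫ s in t..u, w s := by
  have hwc : Continuous w := continuous_iff_continuousAt.2 fun s => (hw s).continuousAt
  have hparts := intervalIntegral.integral_deriv_mul_eq_sub (a := t) (b := u) (v := fun s => s - t)
    (v' := fun _ => 1) (fun s _ => hw s) (fun s _ => (hasDerivAt_id s).sub_const t)
    (hw'.intervalIntegrable _ _) intervalIntegrable_const
  rw [intervalIntegral.integral_add
    ((by fun_prop : Continuous fun s => w' s * (s - t)).intervalIntegrable _ _)
    ((by fun_prop : Continuous fun s => w s * 1).intervalIntegrable _ _)] at hparts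
  simp only [mul_one, sub_self, mul_zero, sub_zero] at hparts
  simp only [stieltjesIntegral, id]
  linarith

end StieltjesSums

section CompoundPoisson

variable {Ω : Type*} {mΩ : MeasurableSpace Ω} {P : Measure Ω} {l : ℝ≥0} {F : Measure ℝ}
  {N : ℝ≥0 → Ω → ℕ} {ξ : ℕ → Ω → ℝ} {p : ℕ}

/-- A compound Poisson process with nonnegative jumps: a Poisson process `N` of intensity `l` and
independent jump sizes `ξ n` with law `F`. -/
structure IsCompoundPoisson (P : Measure Ω) (l : ℝ≥0) (F : Measure ℝ) (N : ℝ≥0 → Ω → ℕ)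
    (ξ : ℕ → Ω → ℝ) : Prop where
  poisson : IsPoissonProcess P l N
  measurable_jump : ∀ n, Measurable (ξ n)
  iIndepFun_jump : iIndepFun ξ P
  law : ∀ n, HasLaw (ξ n) F P
  indep : Indep (⨆ t, .comap (N t) inferInstance) (⨆ n, .comap (ξ n) inferInstance) P
  supp : F (Iio 0) = 0

/-- The σ-algebra generated by the counting process `N` and the jump sizes `ξ`. -/
@[reducible]
def compoundSigma (N : ℝ≥0 → Ω → ℕ) (ξ : ℕ → Ω → ℝ) : MeasurableSpace Ω :=
  (⨆ t, .comap (N t) inferInstance) ⊔ ⨆ n, .comap (ξ n) inferInstance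

/-- The integral of `w` over `(t, u]` with respect to the paths of the cumulative volume. As a
pointwise limit of Riemann-Stieltjes sums it is measurable for the σ-algebra of the process. -/
def stochInt (w : ℝ → ℝ) (N : ℝ≥0 → Ω → ℕ) (ξ : ℕ → Ω → ℝ) (t u : ℝ) (ω : Ω) : ℝ :=
  limUnder atTop fun n => stieltjesSum w (fun s => cumVolume N ξ s ω) t u n

omit mΩ in
theorem measurable_count_iSup (t : ℝ≥0) :
    Measurable[⨆ t, .comap (N t) inferInstance] (N t) :=
  (comap_measurable (N t)).mono
    (le_iSup (fun t => MeasurableSpace.comap (N t) inferInstance) t) le_rfl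

omit mΩ in
theorem measurable_cumVolume (N : ℝ≥0 → Ω → ℕ) (ξ : ℕ → Ω → ℝ) (t : ℝ) :
    Measurable[compoundSigma N ξ] (cumVolume N ξ t) := by
  have hN : Measurable[compoundSigma N ξ] (N t.toNNReal) :=
    (measurable_count_iSup _).mono le_sup_left le_rfl
  have hξ : ∀ n, Measurable[compoundSigma N ξ] (ξ n) := fun n => (comap_measurable (ξ n)).mono
    ((le_iSup (fun n => MeasurableSpace.comap (ξ n) inferInstance) n).trans le_sup_right) le_rfl
  let _ : MeasurableSpace Ω := compoundSigma N ξ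
  exact measurable_sum_range hN hξ

omit mΩ in
theorem measurable_stochInt (w : ℝ → ℝ) (N : ℝ≥0 → Ω → ℕ) (ξ : ℕ → Ω → ℝ) (t u : ℝ) :
    Measurable[compoundSigma N ξ] (stochInt w N ξ t u) := by
  have hO := measurable_cumVolume N ξ
  let _ : MeasurableSpace Ω := compoundSigma N ξ
  refine (StronglyMeasurable.limUnder fun n => Measurable.stronglyMeasurable ?_).measurable
  exact Finset.measurable_fun_sum _ fun i _ => ((hO _).sub (hO _)).const_mul _

namespace IsCompoundPoisson

theorem isBlockSequence (h : IsCompoundPoisson P l F N ξ) {τ : ℕ → ℝ≥0} (hτ : Monotone τ) :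
    IsBlockSequence P F (fun i ω => N (τ (i + 1)) ω - N (τ i) ω) ξ where
  measurable_length _ := (h.poisson.measurable _).sub (h.poisson.measurable _)
  measurable_summand := h.measurable_jump
  law := h.law
  indep := iIndep_sumElim (h.poisson.indep.nat hτ) h.iIndepFun_jump <|
    indep_of_indep_of_le_left h.indep <| iSup_le fun _ =>
      ((measurable_count_iSup _).sub (measurable_count_iSup _)).comap_le

theorem ae_nonneg (h : IsCompoundPoisson P l F N ξ) : ∀ᵐ ω ∂P, ∀ n, 0 ≤ ξ n ω := by
  refine ae_all_iff.2 fun n => ?_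
  have hF : ∀ᵐ x ∂(P.map (ξ n)), 0 ≤ x := by
    rw [(h.law n).map_eq, ae_iff]
    simp only [not_le]
    exact h.supp
  exact ae_of_ae_map (h.measurable_jump n).aemeasurable hF

theorem ae_monotone_cumVolume (h : IsCompoundPoisson P l F N ξ) :
    ∀ᵐ ω ∂P, Monotone fun s => cumVolume N ξ s ω := by
  filter_upwards [h.ae_nonneg, h.poisson.mono] with ω hξ hN s t hst
  exact Finset.sum_le_sum_of_subset_of_nonneg
    (Finset.range_subset_range.2 (hN (Real.toNNReal_le_toNNReal hst))) fun n _ _ => hξ n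

theorem ae_blockSum_eq (h : IsCompoundPoisson P l F N ξ) {τ : ℕ → ℝ≥0} (hτ : Monotone τ)
    (h0 : τ 0 = 0) :
    ∀ᵐ ω ∂P, ∀ i, blockSum (fun j ω => N (τ (j + 1)) ω - N (τ j) ω) ξ i ω =
      cumVolume N ξ (τ (i + 1)) ω - cumVolume N ξ (τ i) ω := by
  filter_upwards [h.poisson.zero, h.poisson.mono] with ω hzero hmono i
  have hstart : blockStart (fun j ω => N (τ (j + 1)) ω - N (τ j) ω) i ω = N (τ i) ω := by
    simpa only [h0, hzero, Nat.sub_zero] using!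
      Finset.sum_range_tsub (f := fun j => N (τ j) ω) (hmono.comp hτ) i
  obtain ⟨d, hd⟩ : ∃ d, N (τ (i + 1)) ω = N (τ i) ω + d :=
    Nat.exists_eq_add_of_le (hmono (hτ i.le_succ))
  rw [blockSum, hstart, cumVolume, cumVolume, Real.toNNReal_coe, Real.toNNReal_coe, hd,
    Finset.sum_range_add, Nat.add_sub_cancel_left, add_sub_cancel_left]

/-- The partition is preceded by the interval `[0, t]`, with weight `0`, because the indices of the
jumps are counted from time `0`. -/
theorem hasCumulants_stieltjesSum (h : IsCompoundPoisson P l F N ξ) (hF : MemLp id p F)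
    (w : ℝ → ℝ) {t u : ℝ} (ht : 0 ≤ t) (htu : t ≤ u) (n : ℕ) :
    HasCumulants p (fun ω => stieltjesSum w (fun s => cumVolume N ξ s ω) t u n) P
      (fun r => l * (∫ x, x ^ r ∂F) * stieltjesSum (fun s => w s ^ r) id t u n) := by
  let τ : ℕ → ℝ≥0 := fun i => i.casesOn 0 fun j => (node t u n j).toNNReal
  let a : ℕ → ℝ := fun i => i.casesOn 0 fun j => w (node t u n j)
  have hτ : Monotone τ := monotone_nat_of_le_succ fun i => by
    cases i with
    | zero => exact zero_le
    | succ j => exact Real.toNNReal_le_toNNReal (monotone_node htu n j.le_succ)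
  have hτ_coe : ∀ i, (τ (i + 1) : ℝ) = node t u n i := fun i =>
    Real.coe_toNNReal _ (ht.trans (le_node htu n i))
  have hsum := (h.isBlockSequence hτ).hasCumulants_sum_blockSum hF a
    (fun i => h.poisson.law _ _ (hτ i.le_succ)) (n + 2)
  refine (hsum.congr ?_).congr_cumulants fun r => ?_
  · filter_upwards [h.ae_blockSum_eq hτ rfl] with ω hω
    simp only [hω]
    rw [Finset.sum_range_succ', show a 0 = 0 from rfl, zero_mul, add_zero]
    simp only [hτ_coe]
    rfl
  · rw [Finset.sum_range_succ', show a 0 = 0 from rfl, zero_pow r.succ_ne_zero, zero_mul, add_zero,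
      stieltjesSum, Finset.mul_sum]
    refine Finset.sum_congr rfl fun i _ => ?_
    simp only [NNReal.coe_mul, NNReal.coe_sub (hτ (i + 1).le_succ), hτ_coe, a, id]
    ring

theorem ae_tendsto_stochInt (h : IsCompoundPoisson P l F N ξ) {w w' : ℝ → ℝ}
    (hw : ∀ s, HasDerivAt w (w' s) s) (hw' : Continuous w') {t u : ℝ} (htu : t ≤ u) :
    ∀ᵐ ω ∂P, Tendsto (stieltjesSum w (fun s => cumVolume N ξ s ω) t u) atTop
        (𝓝 (stochInt w N ξ t u ω)) ∧
      stochInt w N ξ t u ω = stieltjesIntegral w w' (fun s => cumVolume N ξ s ω) t u := by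
  filter_upwards [h.ae_monotone_cumVolume] with ω hω
  have hlim := tendsto_stieltjesSum hw hw' htu (hω.monotoneOn (Icc t u))
  exact ⟨tendsto_nhds_limUnder ⟨_, hlim⟩, hlim.limUnder_eq⟩

theorem hasCumulants_stochInt (h : IsCompoundPoisson P l F N ξ) (hF : MemLp id p F)
    {w w' : ℝ → ℝ} (hw : ∀ s, HasDerivAt w (w' s) s) (hw' : Continuous w') {t u : ℝ}
    (ht : 0 ≤ t) (htu : t ≤ u) :
    HasCumulants p (stochInt w N ξ t u) P
      (fun r => l * (∫ x, x ^ r ∂F) * ∫ s in t..u, w s ^ r) := by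
  have := h.iIndepFun_jump.isProbabilityMeasure
  have hwc : Continuous w := continuous_iff_continuousAt.2 fun s => (hw s).continuousAt
  obtain ⟨C, hC⟩ := (isCompact_Icc (a := t) (b := u)).exists_bound_of_continuousOn
    hwc.continuousOn
  have hbound := (h.hasCumulants_stieltjesSum hF (fun _ => C) ht htu 0).memLp
  simp only [stieltjesSum_const] at hbound
  refine .of_tendsto (fun n => h.hasCumulants_stieltjesSum hF w ht htu n) hbound
    (fun n => ?_) ?_ fun r => ?_
  · filter_upwards [h.ae_monotone_cumVolume] with ω hω
    exact abs_stieltjesSum_le htu (hω.monotoneOn _) hC n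
  · filter_upwards [h.ae_tendsto_stochInt hw hw' htu] with ω hω using hω.1
  · have hpow : ∀ s, HasDerivAt (fun s => w s ^ r) (r * w s ^ (r - 1) * w' s) s := fun s =>
      (hw s).pow r
    have hpow' : Continuous fun s => r * w s ^ (r - 1) * w' s := by fun_prop
    rw [← stieltjesIntegral_id hpow hpow']
    exact (tendsto_stieltjesSum hpow hpow' htu (monotone_id.monotoneOn _)).const_mul _

end IsCompoundPoisson

end CompoundPoisson

namespace IsOrderFlow

variable {Ω : Type*} [MeasurableSpace Ω] {P : Measure Ω} {m : Model}
  {N : Pair → Side → ℝ≥0 → Ω → ℕ} {ξ : Pair → Side → ℕ → Ω → ℝ}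

/-- The σ-algebras of the counting processes and of the jump sizes of an order flow. -/
@[reducible]
def flowSigma (N : Pair → Side → ℝ≥0 → Ω → ℕ) (ξ : Pair → Side → ℕ → Ω → ℝ) :
    (Pair × Side) ⊕ (Pair × Side × ℕ) → MeasurableSpace Ω :=
  Sum.elim (fun j => ⨆ t : ℝ≥0, .comap (N j.1 j.2 t) inferInstance)
    (fun j => .comap (ξ j.1 j.2.1 j.2.2) inferInstance)

theorem indep_disjoint (h : IsOrderFlow m P N ξ) {S T : Set ((Pair × Side) ⊕ (Pair × Side × ℕ))}
    (hST : Disjoint S T) :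
    Indep (⨆ i ∈ S, flowSigma N ξ i) (⨆ i ∈ T, flowSigma N ξ i) P := by
  refine indep_iSup_of_disjoint ?_ h.indep hST
  rintro (j | j)
  · exact iSup_le fun t => ((h.poisson _ _).measurable t).comap_le
  · exact (h.measurable _ _ _).comap_le

theorem isCompoundPoisson (h : IsOrderFlow m P N ξ) (k : Pair) (s : Side) :
    IsCompoundPoisson P (m.lam k s) (m.F k s) (N k s) (ξ k s) where
  poisson := h.poisson k s
  measurable_jump := h.measurable k s
  iIndepFun_jump := h.indep.precomp (g := fun n => Sum.inr (k, s, n)) fun a b hab => by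
    simpa using hab
  law := h.law k s
  indep := by
    refine indep_of_indep_of_le (h.indep_disjoint (S := {Sum.inl (k, s)})
      (T := range fun n => Sum.inr (k, s, n)) (by simp)) ?_ (iSup_le fun n => ?_)
    · exact le_iSup₂_of_le (f := fun i (_ : i ∈ ({Sum.inl (k, s)} : Set _)) => flowSigma N ξ i)
        (Sum.inl (k, s)) rfl le_rfl
    · exact le_iSup₂_of_le (f := fun i (_ : i ∈ range fun n => Sum.inr (k, s, n)) =>
        flowSigma N ξ i) (Sum.inr (k, s, n)) ⟨n, rfl⟩ le_rfl
  supp := m.F_supp k s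

omit [MeasurableSpace Ω] in
theorem iSup_compoundSigma_le (S : Set (Pair × Side)) :
    ⨆ j ∈ S, compoundSigma (N j.1 j.2) (ξ j.1 j.2) ≤
      ⨆ i ∈ Sum.elim id (fun j => (j.1, j.2.1)) ⁻¹' S, flowSigma N ξ i :=
  iSup₂_le fun j hj => sup_le (le_iSup₂_of_le (f := fun i _ => flowSigma N ξ i) (Sum.inl j) hj
    le_rfl) <| iSup_le fun n =>
      le_iSup₂_of_le (f := fun i _ => flowSigma N ξ i) (Sum.inr (j.1, j.2, n)) hj le_rfl

theorem indep_compoundSigma (h : IsOrderFlow m P N ξ) {S T : Set (Pair × Side)}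
    (hST : Disjoint S T) :
    Indep (⨆ j ∈ S, compoundSigma (N j.1 j.2) (ξ j.1 j.2))
      (⨆ j ∈ T, compoundSigma (N j.1 j.2) (ξ j.1 j.2)) P :=
  indep_of_indep_of_le (h.indep_disjoint (hST.preimage _)) (iSup_compoundSigma_le S)
    (iSup_compoundSigma_le T)

end IsOrderFlow

/-! ### The auxiliary inventories -/

section VariationOfConstants

variable {W A b f J Q : ℝ → ℝ} {t T u q : ℝ}

theorem hasDerivWithinAt_Ioi_integral (hf : IntervalIntegrable f volume t T) {s : ℝ}
    (hs : s ∈ Ico t T) (hcont : ContinuousWithinAt f (Ioi s) s) :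
    HasDerivWithinAt (fun u => ∫ v in t..u, f v) (f s) (Ioi s) s := by
  have hts : IntervalIntegrable f volume t s :=
    hf.mono_set (uIcc_subset_uIcc left_mem_uIcc (mem_uIcc_of_le hs.1 hs.2.le))
  have hsT : IntervalIntegrable f volume s T :=
    hf.mono_set (uIcc_subset_uIcc (mem_uIcc_of_le hs.1 hs.2.le) right_mem_uIcc)
  have hmeas : StronglyMeasurableAtFilter f (𝓝[>] s) :=
    ⟨Ioc s T, Ioc_mem_nhdsGT hs.2, hsT.1.aestronglyMeasurable⟩
  exact (intervalIntegral.integral_hasDerivWithinAt_right hts (s := Ici s) hmeas hcont).mono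
    Ioi_subset_Ici_self

/-- The continuous part `R = Q - (J - J t)` satisfies `(W R)' = W b - W A (J - J t)`, from the
right, so that the jumps of `J` enter only through `stieltjesIntegral`. -/
theorem variation_of_constants (hW : ∀ s, HasDerivAt W (W s * A s) s) (hA : Continuous A)
    (hb : Continuous b) (hJ : ∀ s, ContinuousWithinAt J (Ici s) s)
    (hJi : ∀ u, IntervalIntegrable J volume t u)
    (hQi : IntervalIntegrable (fun s => b s - A s * Q s) volume t T)
    (hQ : ∀ u ∈ Icc t T, Q u = q + (∫ s in t..u, (b s - A s * Q s)) + (J u - J t))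
    (hu : u ∈ Icc t T) :
    W u * Q u = W t * q + (∫ s in t..u, W s * b s) +
      stieltjesIntegral W (fun s => W s * A s) J t u := by
  have htT : t ≤ T := hu.1.trans hu.2
  have hWc : Continuous W := continuous_iff_continuousAt.2 fun s => (hW s).continuousAt
  set R : ℝ → ℝ := fun u => q + ∫ s in t..u, (b s - A s * Q s) with hR
  have hRc : ContinuousOn R (Icc t T) := by
    rw [← uIcc_of_le htT]
    exact continuousOn_const.add (intervalIntegral.continuousOn_primitive_interval <| by
      rwa [uIcc_of_le htT, ← intervalIntegrable_iff_integrableOn_Icc_of_le htT])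
  have hRd : ∀ s ∈ Ico t T, HasDerivWithinAt R (b s - A s * Q s) (Ioi s) s := fun s hs => by
    have hQc : ContinuousWithinAt Q (Icc s T) s :=
      (((hRc s ⟨hs.1, hs.2.le⟩).mono (Icc_subset_Icc_left hs.1)).add
        (((hJ s).mono Icc_subset_Ici_self).sub continuousWithinAt_const)).congr
        (fun v hv => hQ v (Icc_subset_Icc_left hs.1 hv)) (hQ s ⟨hs.1, hs.2.le⟩)
    exact (hasDerivWithinAt_Ioi_integral hQi hs <|
      (hb.continuousWithinAt.sub (hA.continuousWithinAt.mul hQc)).mono_of_mem_nhdsWithin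
        (mem_of_superset (Ioc_mem_nhdsGT hs.2) Ioc_subset_Icc_self)).const_add q
  have hWb : IntervalIntegrable (fun s => W s * b s) volume t u :=
    (hWc.mul hb).intervalIntegrable _ _
  have hWJ : IntervalIntegrable (fun s => W s * A s * (J s - J t)) volume t u :=
    ((hJi u).sub intervalIntegrable_const).continuousOn_mul (hWc.mul hA).continuousOn
  have hfund : ∫ s in t..u, (W s * b s - W s * A s * (J s - J t)) = W u * R u - W t * R t := by
    refine intervalIntegral.integral_eq_sub_of_hasDeriv_right (f := fun s => W s * R s)
      ?_ (fun s hs => ?_) (hWb.sub hWJ)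
    · rw [uIcc_of_le hu.1]
      exact hWc.continuousOn.mul (hRc.mono (Icc_subset_Icc_right hu.2))
    · rw [min_eq_left hu.1, max_eq_right hu.1] at hs
      have hs' : s ∈ Ico t T := ⟨hs.1.le, hs.2.trans_le hu.2⟩
      refine ((hW s).hasDerivWithinAt.mul (hRd s hs')).congr_deriv ?_
      rw [hQ s ⟨hs'.1, hs'.2.le⟩]
      ring
  have hRt : R t = q := by simp [hR]
  rw [intervalIntegral.integral_sub hWb hWJ, hRt] at hfund
  rw [hQ u hu, stieltjesIntegral]
  linarith

theorem stieltjesIntegral_sub {w w' O O' : ℝ → ℝ} (hw' : Continuous w')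
    (hO : IntervalIntegrable O volume t u) (hO' : IntervalIntegrable O' volume t u) :
    stieltjesIntegral w w' (fun s => O s - O' s) t u =
      stieltjesIntegral w w' O t u - stieltjesIntegral w w' O' t u := by
  have hsub : ∫ s in t..u, w' s * (O s - O' s - (O t - O' t)) =
      (∫ s in t..u, w' s * (O s - O t)) - ∫ s in t..u, w' s * (O' s - O' t) := by
    rw [← intervalIntegral.integral_sub
      ((hO.sub intervalIntegrable_const).continuousOn_mul hw'.continuousOn)
      ((hO'.sub intervalIntegrable_const).continuousOn_mul hw'.continuousOn)]
    exact intervalIntegral.integral_congr fun s _ => by ring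
  rw [stieltjesIntegral, stieltjesIntegral, stieltjesIntegral, hsub]
  ring

end VariationOfConstants

theorem continuousWithinAt_cumVolume {Ω : Type*} {N : ℝ≥0 → Ω → ℕ} (ξ : ℕ → Ω → ℝ) {ω : Ω}
    (h : ∀ t, ContinuousWithinAt (fun s => N s ω) (Ici t) t) (s : ℝ) :
    ContinuousWithinAt (fun s => cumVolume N ξ s ω) (Ici s) s := by
  have hN : ContinuousWithinAt (fun v : ℝ => N v.toNNReal ω) (Ici s) s :=
    (h s.toNNReal).comp (t := Ici s.toNNReal) continuous_real_toNNReal.continuousWithinAt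
      fun v hv => Real.toNNReal_le_toNNReal hv
  exact (continuous_of_discreteTopology (f := fun k : ℕ => ∑ n ∈ Finset.range k, ξ n ω)
    ).continuousAt.comp_continuousWithinAt hN

namespace Model

variable (m : Model)

theorem h2_denom_ne_zero (k : Pair) (hk : m.muHat k ≠ 0) {t : ℝ} (ht : t ≤ m.T) :
    m.α k - (m.α k - m.a k * m.muHat k) * Real.exp (-m.muHat k * (m.T - t)) ≠ 0 := by
  have ha := m.a_pos k
  have hα := m.α_nonneg k
  set E := Real.exp (-m.muHat k * (m.T - t))
  have hE0 : 0 < E := Real.exp_pos _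
  suffices h : m.α k * (1 - E) + m.a k * m.muHat k * E ≠ 0 by
    convert h using 1
    ring
  rcases lt_or_gt_of_ne hk with hneg | hpos
  · have hE1 : 1 ≤ E := Real.one_le_exp (mul_nonneg (by linarith) (by linarith))
    exact (add_neg_of_nonpos_of_neg (mul_nonpos_of_nonneg_of_nonpos hα (by linarith))
      (mul_neg_of_neg_of_pos (mul_neg_of_pos_of_neg ha hneg) hE0)).ne
  · have hE1 : E ≤ 1 :=
      Real.exp_le_one_iff.2 (mul_nonpos_of_nonpos_of_nonneg (by linarith) (by linarith))
    exact (add_pos_of_nonneg_of_pos (mul_nonneg hα (by linarith)) (by positivity)).ne'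

theorem h2_denom_pos_of_muHat_eq_zero (k : Pair) {t : ℝ} (ht : t ≤ m.T) :
    0 < m.a k + m.α k * (m.T - t) :=
  add_pos_of_pos_of_nonneg (m.a_pos k) (mul_nonneg (m.α_nonneg k) (sub_nonneg.2 ht))

theorem continuousOn_h2 (k : Pair) : ContinuousOn (m.h2 k) (Iic m.T) := by
  unfold h2
  split_ifs with hk
  · exact .div (by fun_prop) (by fun_prop) fun u hu =>
      (m.h2_denom_pos_of_muHat_eq_zero k hu).ne'
  · exact .div (by fun_prop) (by fun_prop) fun u hu => m.h2_denom_ne_zero k hk hu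

theorem continuousOn_h1 (k : Pair) : ContinuousOn (m.h1 k) (Iic m.T) := by
  unfold h1
  split_ifs with hk
  · exact .mul (by fun_prop) (.div (by fun_prop) (by fun_prop) fun u hu =>
      (m.h2_denom_pos_of_muHat_eq_zero k hu).ne')
  · exact .div (by fun_prop) (by fun_prop) fun u hu => m.h2_denom_ne_zero k hk hu

/-- A function of time, kept constant after the horizon: the functions `h₁`, `h₂` may have a
singularity there. -/
def stopped (f : ℝ → ℝ) (u : ℝ) : ℝ := f (min u m.T)

theorem stopped_eq (f : ℝ → ℝ) {u : ℝ} (hu : u ≤ m.T) : m.stopped f u = f u := by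
  rw [stopped, min_eq_left hu]

variable {m} in
theorem continuous_stopped {f : ℝ → ℝ} (hf : ContinuousOn f (Iic m.T)) :
    Continuous (m.stopped f) :=
  hf.comp_continuous (by fun_prop) fun u => min_le_right u m.T

/-- The rate of mean reversion of the auxiliary inventory, that is, `h₂ / a`. -/
def reversion (k : Pair) (u : ℝ) : ℝ := m.stopped (m.h2 k) u / m.a k

/-- The part of the drift of the auxiliary inventory that does not depend on its level. -/
def constDrift (k : Pair) (u : ℝ) : ℝ := -(m.stopped (m.h1 k) u / (2 * m.a k))

@[fun_prop]
theorem continuous_reversion (k : Pair) : Continuous (m.reversion k) :=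
  (continuous_stopped (m.continuousOn_h2 k)).div_const _

@[fun_prop]
theorem continuous_constDrift (k : Pair) : Continuous (m.constDrift k) :=
  ((continuous_stopped (m.continuousOn_h1 k)).div_const _).neg

theorem beta_eq (k : Pair) {u : ℝ} (hu : u ≤ m.T) (q : ℝ) :
    m.beta k u q = m.constDrift k u - m.reversion k u * q := by
  have := (m.a_pos k).ne'
  rw [beta, constDrift, reversion, m.stopped_eq _ hu, m.stopped_eq _ hu]
  field_simp
  ring

/-- The integrating factor of the linear equation for the auxiliary inventory. -/
def weight (k : Pair) (u : ℝ) : ℝ := Real.exp (∫ s in (0 : ℝ)..u, m.reversion k s)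

theorem weight_pos (k : Pair) (u : ℝ) : 0 < m.weight k u := Real.exp_pos _

theorem hasDerivAt_weight (k : Pair) (u : ℝ) :
    HasDerivAt (m.weight k) (m.weight k u * m.reversion k u) u :=
  ((m.continuous_reversion k).integral_hasStrictDerivAt 0 u).hasDerivAt.exp

@[fun_prop]
theorem continuous_weight (k : Pair) : Continuous (m.weight k) :=
  continuous_iff_continuousAt.2 fun u => (m.hasDerivAt_weight k u).continuousAt

/-- The integral of the constant part of the drift against the integrating factor. -/
def shift (k : Pair) (u : ℝ) : ℝ := ∫ s in (0 : ℝ)..u, m.weight k s * m.constDrift k s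

theorem hasDerivAt_shift (k : Pair) (u : ℝ) :
    HasDerivAt (m.shift k) (m.weight k u * m.constDrift k u) u :=
  (((m.continuous_weight k).mul (m.continuous_constDrift k)).integral_hasStrictDerivAt
    0 u).hasDerivAt

@[fun_prop]
theorem continuous_shift (k : Pair) : Continuous (m.shift k) :=
  continuous_iff_continuousAt.2 fun u => (m.hasDerivAt_shift k u).continuousAt

theorem integral_weight_mul_constDrift (k : Pair) (t u : ℝ) :
    ∫ s in t..u, m.weight k s * m.constDrift k s = m.shift k u - m.shift k t :=
  intervalIntegral.integral_eq_sub_of_hasDerivAt (fun s _ => m.hasDerivAt_shift k s)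
    (((m.continuous_weight k).mul (m.continuous_constDrift k)).intervalIntegrable _ _)

end Model

section Noise

variable {Ω : Type*}

/-- The part of the auxiliary inventory that is driven by the order flow, multiplied by the
integrating factor. -/
def noise (m : Model) (N : Pair → Side → ℝ≥0 → Ω → ℕ) (ξ : Pair → Side → ℕ → Ω → ℝ)
    (k : Pair) (t u : ℝ) (ω : Ω) : ℝ :=
  stochInt (m.weight k) (N k .sell) (ξ k .sell) t u ω
    + -1 * stochInt (m.weight k) (N k .buy) (ξ k .buy) t u ω

variable [MeasurableSpace Ω] {P : Measure Ω} {m : Model} {N : Pair → Side → ℝ≥0 → Ω → ℕ}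
  {ξ : Pair → Side → ℕ → Ω → ℝ}

theorem IsAuxInventory.ae_eq (hflow : IsOrderFlow m P N ξ) {k : Pair} {t q : ℝ} {Q : ℝ → Ω → ℝ}
    (hQ : IsAuxInventory m P N ξ k t q Q) {u : ℝ} (hu : u ∈ Icc t m.T) :
    ∀ᵐ ω ∂P, m.weight k u * Q u ω - m.shift k u =
      m.weight k t * q - m.shift k t + noise m N ξ k t u ω := by
  have hflow' := hflow.isCompoundPoisson k
  have hw' : Continuous fun s => m.weight k s * m.reversion k s := by fun_prop
  filter_upwards [hQ.integrable, hQ.sde, (hflow' .sell).ae_monotone_cumVolume,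
    (hflow' .buy).ae_monotone_cumVolume, (hflow' .sell).poisson.rightCont,
    (hflow' .buy).poisson.rightCont,
    (hflow' .sell).ae_tendsto_stochInt (m.hasDerivAt_weight k) hw' hu.1,
    (hflow' .buy).ae_tendsto_stochInt (m.hasDerivAt_weight k) hw' hu.1]
    with ω hint hsde hmonoS hmonoB hrightS hrightB hS hB
  have htT : t ≤ m.T := hu.1.trans hu.2
  have hvar := variation_of_constants (A := m.reversion k) (b := m.constDrift k)
    (J := fun s => cumVolume (N k .sell) (ξ k .sell) s ω - cumVolume (N k .buy) (ξ k .buy) s ω)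
    (Q := fun s => Q s ω) (m.hasDerivAt_weight k) (m.continuous_reversion k)
    (m.continuous_constDrift k)
    (fun s => (continuousWithinAt_cumVolume _ hrightS s).sub
      (continuousWithinAt_cumVolume _ hrightB s))
    (fun u => hmonoS.intervalIntegrable.sub hmonoB.intervalIntegrable)
    (hint.congr fun s hs => m.beta_eq k (uIoc_of_le htT ▸ hs).2 _)
    (fun v hv => by
      rw [hsde v hv, intervalIntegral.integral_congr fun s hs =>
        m.beta_eq k ((uIcc_of_le hv.1 ▸ hs).2.trans hv.2) _]
      ring) hu
  rw [stieltjesIntegral_sub hw' hmonoS.intervalIntegrable hmonoB.intervalIntegrable, ← hS.2,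
    ← hB.2, m.integral_weight_mul_constDrift] at hvar
  rw [noise]
  linarith

end Noise

/-! ### The backward equation for the coefficients -/

section IsC1

variable {ι : Type*} [DecidableEq ι]

/-- `G` is continuous on `[0, T]`, and has the continuous partial derivatives `Gt` and `Gq` on
`[0, T)`: the regularity of the coefficients of a classical solution, as functions of time and of
the inventories. -/
structure IsC1 (T : ℝ) (G Gt : ℝ → (ι → ℝ) → ℝ) (Gq : ι → ℝ → (ι → ℝ) → ℝ) : Prop where
  cont : ContinuousOn (fun z : ℝ × (ι → ℝ) => G z.1 z.2) (Icc 0 T ×ˢ univ)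
  cont_t : ContinuousOn (fun z : ℝ × (ι → ℝ) => Gt z.1 z.2) (Ico 0 T ×ˢ univ)
  cont_q : ∀ k, ContinuousOn (fun z : ℝ × (ι → ℝ) => Gq k z.1 z.2) (Ico 0 T ×ˢ univ)
  deriv_t : ∀ t ∈ Ico 0 T, ∀ q, HasDerivWithinAt (fun s => G s q) (Gt t q) (Icc 0 T) t
  deriv_q : ∀ k, ∀ t ∈ Ico 0 T, ∀ q : ι → ℝ,
    HasDerivAt (fun v => G t (Function.update q k v)) (Gq k t q) (q k)

namespace IsC1

variable {T : ℝ} {G Gt H Ht : ℝ → (ι → ℝ) → ℝ} {Gq Hq : ι → ℝ → (ι → ℝ) → ℝ}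

theorem cont_Ico (hG : IsC1 T G Gt Gq) :
    ContinuousOn (fun z : ℝ × (ι → ℝ) => G z.1 z.2) (Ico 0 T ×ˢ univ) :=
  hG.cont.mono (prod_mono Ico_subset_Icc_self le_rfl)

theorem continuous_q (hG : IsC1 T G Gt Gq) {t : ℝ} (ht : t ∈ Icc 0 T) : Continuous (G t) :=
  hG.cont.comp_continuous (f := fun q => (t, q)) (by fun_prop) fun _ => ⟨ht, mem_univ _⟩

theorem add (hG : IsC1 T G Gt Gq) (hH : IsC1 T H Ht Hq) :
    IsC1 T (fun t q => G t q + H t q) (fun t q => Gt t q + Ht t q)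
      (fun k t q => Gq k t q + Hq k t q) where
  cont := hG.cont.add hH.cont
  cont_t := hG.cont_t.add hH.cont_t
  cont_q k := (hG.cont_q k).add (hH.cont_q k)
  deriv_t t ht q := (hG.deriv_t t ht q).add (hH.deriv_t t ht q)
  deriv_q k t ht q := (hG.deriv_q k t ht q).add (hH.deriv_q k t ht q)

theorem mul (hG : IsC1 T G Gt Gq) (hH : IsC1 T H Ht Hq) :
    IsC1 T (fun t q => G t q * H t q) (fun t q => Gt t q * H t q + G t q * Ht t q)
      (fun k t q => Gq k t q * H t q + G t q * Hq k t q) where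
  cont := hG.cont.mul hH.cont
  cont_t := (hG.cont_t.mul hH.cont_Ico).add (hG.cont_Ico.mul hH.cont_t)
  cont_q k := ((hG.cont_q k).mul hH.cont_Ico).add (hG.cont_Ico.mul (hH.cont_q k))
  deriv_t t ht q := (hG.deriv_t t ht q).mul (hH.deriv_t t ht q)
  deriv_q k t ht q := by
    simpa only [Function.update_eq_self] using (hG.deriv_q k t ht q).fun_mul (hH.deriv_q k t ht q)

theorem const_mul (hG : IsC1 T G Gt Gq) (b : ℝ) :
    IsC1 T (fun t q => b * G t q) (fun t q => b * Gt t q) (fun k t q => b * Gq k t q) where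
  cont := hG.cont.const_mul b
  cont_t := hG.cont_t.const_mul b
  cont_q k := (hG.cont_q k).const_mul b
  deriv_t t ht q := (hG.deriv_t t ht q).const_mul b
  deriv_q k t ht q := (hG.deriv_q k t ht q).const_mul b

theorem of_time {τ τ' : ℝ → ℝ} (hτ : ∀ t, HasDerivAt τ (τ' t) t) (hτ' : Continuous τ') :
    IsC1 T (fun t (_ : ι → ℝ) => τ t) (fun t _ => τ' t) (fun _ _ _ => 0) where
  cont := ((continuous_iff_continuousAt.2 fun s => (hτ s).continuousAt).comp
    continuous_fst).continuousOn
  cont_t := (hτ'.comp continuous_fst).continuousOn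
  cont_q _ := continuousOn_const
  deriv_t t _ _ := (hτ t).hasDerivWithinAt
  deriv_q _ _ _ _ := hasDerivAt_const _ _

theorem congr (hG : IsC1 T G Gt Gq) (e : ∀ t ∈ Icc 0 T, ∀ q, H t q = G t q) :
    IsC1 T H Gt Gq where
  cont := hG.cont.congr fun z hz => e z.1 hz.1 z.2
  cont_t := hG.cont_t
  cont_q := hG.cont_q
  deriv_t t ht q := (hG.deriv_t t ht q).congr (fun s hs => e s hs q)
    (e t (Ico_subset_Icc_self ht) q)
  deriv_q k t ht q := by
    simpa only [e t (Ico_subset_Icc_self ht)] using hG.deriv_q k t ht q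

end IsC1

end IsC1

section PolynomialGrowth

variable {ι : Type*} [Fintype ι]

/-- The size of a vector of inventories, shifted by `1` so that its powers are increasing. -/
def inventorySize (q : ι → ℝ) : ℝ := 1 + ∑ k, |q k|

theorem one_le_inventorySize (q : ι → ℝ) : 1 ≤ inventorySize q :=
  le_add_of_nonneg_right (Finset.sum_nonneg fun _ _ => abs_nonneg _)

theorem inventorySize_pos (q : ι → ℝ) : 0 < inventorySize q :=
  one_pos.trans_le (one_le_inventorySize q)

theorem abs_le_inventorySize (q : ι → ℝ) (k : ι) : |q k| ≤ inventorySize q :=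
  (Finset.single_le_sum (f := fun k => |q k|) (fun _ _ => abs_nonneg _)
    (Finset.mem_univ k)).trans (le_add_of_nonneg_left zero_le_one)

theorem inventorySize_update_le [DecidableEq ι] (q : ι → ℝ) (k : ι) (v : ℝ) :
    inventorySize (Function.update q k v) ≤ inventorySize q + (|v| - |q k|) := by
  have hupdate := Finset.sum_update_of_mem (Finset.mem_univ k) (fun j => |q j|) |v|
  have hself := Finset.add_sum_erase Finset.univ (fun j => |q j|) (Finset.mem_univ k)
  simp only [Finset.sdiff_singleton_eq_erase] at hupdate
  simp only [inventorySize, Function.apply_update (fun _ => abs) q k v, hupdate]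
  linarith

/-- Polynomial growth of degree `n` in the inventories, uniformly on `[0, T]`. -/
def HasPolyGrowth (T : ℝ) (n : ℕ) (G : ℝ → (ι → ℝ) → ℝ) : Prop :=
  ∃ C, 0 ≤ C ∧ ∀ t ∈ Icc 0 T, ∀ q, |G t q| ≤ C * inventorySize q ^ n

namespace HasPolyGrowth

variable {T : ℝ} {n n' : ℕ} {G H : ℝ → (ι → ℝ) → ℝ}

theorem add (hG : HasPolyGrowth T n G) (hH : HasPolyGrowth T n H) :
    HasPolyGrowth T n (fun t q => G t q + H t q) := by
  obtain ⟨C, hC, hG⟩ := hG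
  obtain ⟨D, hD, hH⟩ := hH
  refine ⟨C + D, add_nonneg hC hD, fun t ht q => (abs_add_le _ _).trans ?_⟩
  rw [add_mul]
  exact add_le_add (hG t ht q) (hH t ht q)

theorem mul (hG : HasPolyGrowth T n G) (hH : HasPolyGrowth T n' H) :
    HasPolyGrowth T (n + n') (fun t q => G t q * H t q) := by
  obtain ⟨C, hC, hG⟩ := hG
  obtain ⟨D, hD, hH⟩ := hH
  refine ⟨C * D, mul_nonneg hC hD, fun t ht q => ?_⟩
  rw [abs_mul, pow_add, mul_mul_mul_comm]
  have := inventorySize_pos q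
  exact mul_le_mul (hG t ht q) (hH t ht q) (abs_nonneg _) (by positivity)

theorem mono (hG : HasPolyGrowth T n G) (hn : n ≤ n') : HasPolyGrowth T n' G := by
  obtain ⟨C, hC, hG⟩ := hG
  exact ⟨C, hC, fun t ht q => (hG t ht q).trans
    (mul_le_mul_of_nonneg_left (pow_le_pow_right₀ (one_le_inventorySize q) hn) hC)⟩

theorem congr (hG : HasPolyGrowth T n G) (e : ∀ t ∈ Icc 0 T, ∀ q, H t q = G t q) :
    HasPolyGrowth T n H := by
  obtain ⟨C, hC, hG⟩ := hG
  exact ⟨C, hC, fun t ht q => e t ht q ▸ hG t ht q⟩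

theorem of_time {τ : ℝ → ℝ} (hτ : Continuous τ) :
    HasPolyGrowth T 0 (fun t (_ : ι → ℝ) => τ t) := by
  obtain ⟨C, hC⟩ := (isCompact_Icc (a := (0 : ℝ)) (b := T)).exists_bound_of_continuousOn
    hτ.continuousOn
  exact ⟨|C|, abs_nonneg _, fun t ht q => by simpa using (hC t ht).trans (le_abs_self C)⟩

theorem coord (k : ι) : HasPolyGrowth T 1 (fun _ q => q k) :=
  ⟨1, zero_le_one, fun _ _ q => by simpa using abs_le_inventorySize q k⟩

theorem pow (hG : HasPolyGrowth T n G) (j : ℕ) :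
    HasPolyGrowth T (n * j) (fun t q => G t q ^ j) := by
  induction j with
  | zero => simpa using of_time (T := T) (ι := ι) (continuous_const (y := (1 : ℝ)))
  | succ j ih => simpa only [pow_succ, Nat.mul_succ] using ih.mul hG

theorem sum {α : Type*} (s : Finset α) {G : α → ℝ → (ι → ℝ) → ℝ}
    (h : ∀ i ∈ s, HasPolyGrowth T n (G i)) : HasPolyGrowth T n (fun t q => ∑ i ∈ s, G i t q) := by
  classical
  induction s using Finset.induction_on with
  | empty => exact ⟨0, le_rfl, fun t _ q => by simp⟩
  | insert i s hi ih =>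
    simp only [Finset.sum_insert hi]
    exact (h i (Finset.mem_insert_self i s)).add
      (ih fun j hj => h j (Finset.mem_insert_of_mem hj))

end HasPolyGrowth

end PolynomialGrowth

theorem sum_pair (f : Pair → ℝ) : ∑ k, f k = f .x + f .y + f .z := by
  change ∑ k ∈ ({.x, .y, .z} : Finset Pair), f k = _
  rw [Finset.sum_insert (by decide), Finset.sum_insert (by decide), Finset.sum_singleton]
  ring

theorem sum_side (f : Side → ℝ) : ∑ s, f s = f .sell + f .buy := by
  change ∑ k ∈ ({.sell, .buy} : Finset Side), f k = _
  rw [Finset.sum_insert (by decide), Finset.sum_singleton]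

theorem abs_sgn (s : Side) : |s.sgn| = 1 := by cases s <;> simp [Side.sgn]

theorem integrable_one_add_abs_pow {P : Measure ℝ} [IsFiniteMeasure P] {p : ℕ}
    (hP : MemLp id p P) : Integrable (fun r : ℝ => (1 + |r|) ^ p) P := by
  have hone : MemLp (fun _ : ℝ => (1 : ℝ)) p P := memLp_const 1
  have habs : MemLp (fun r : ℝ => |r|) p P := hP.norm
  exact integrable_pow_of_memLp (hone.add habs) le_rfl

namespace Model

theorem inventorySize_afterOrder_le (q : Pair → ℝ) (k : Pair) (s : Side) (r : ℝ) :
    inventorySize (afterOrder q k s r) ≤ inventorySize q * (1 + |r|) := by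
  have habs : |q k + s.sgn * r| ≤ |q k| + |r| :=
    (abs_add_le _ _).trans_eq (by rw [abs_mul, abs_sgn, one_mul])
  calc inventorySize (afterOrder q k s r) ≤ inventorySize q + (|q k + s.sgn * r| - |q k|) :=
        inventorySize_update_le q k _
    _ ≤ inventorySize q + 1 * |r| := by linarith
    _ ≤ inventorySize q + inventorySize q * |r| := by
        gcongr
        exact one_le_inventorySize q
    _ = inventorySize q * (1 + |r|) := by ring

theorem continuous_afterOrder (q : Pair → ℝ) (k : Pair) (s : Side) :
    Continuous (afterOrder q k s) :=
  continuous_const.update k (by fun_prop)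

/-- The change of a function of time and inventories when a client order of volume `r` arrives. -/
def inventoryJump (G : ℝ → (Pair → ℝ) → ℝ) (k : Pair) (s : Side) (t : ℝ) (q : Pair → ℝ)
    (r : ℝ) : ℝ :=
  G t (afterOrder q k s r) - G t q

theorem abs_inventoryJump_le {p : ℕ} {C : ℝ} (hC : 0 ≤ C) {G : ℝ → (Pair → ℝ) → ℝ} {t : ℝ}
    (hG : ∀ q, |G t q| ≤ C * inventorySize q ^ p) (k : Pair) (s : Side) (q : Pair → ℝ) (r : ℝ) :
    |inventoryJump G k s t q r| ≤ 2 * C * inventorySize q ^ p * (1 + |r|) ^ p := by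
  have hq := inventorySize_pos q
  have hafter : |G t (afterOrder q k s r)| ≤ C * (inventorySize q ^ p * (1 + |r|) ^ p) := by
    refine (hG _).trans ?_
    have := (inventorySize_pos (afterOrder q k s r)).le
    rw [← mul_pow]
    gcongr
    exact inventorySize_afterOrder_le q k s r
  have hbefore : |G t q| ≤ C * (inventorySize q ^ p * (1 + |r|) ^ p) := by
    refine (hG q).trans ?_
    gcongr
    exact le_mul_of_one_le_right (by positivity) (one_le_pow₀ (by linarith [abs_nonneg r]))
  calc |inventoryJump G k s t q r| ≤ |G t (afterOrder q k s r)| + |G t q| := abs_sub _ _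
    _ ≤ _ := by linarith

variable (m : Model)

/-- The part of the generator of the auxiliary inventories that comes from the clients' orders. -/
def jumpGen (G : ℝ → (Pair → ℝ) → ℝ) (t : ℝ) (q : Pair → ℝ) : ℝ :=
  ∑ k : Pair, ∑ s : Side, m.lam k s * ∫ r in Ioi 0, inventoryJump G k s t q r ∂(m.F k s)

variable {m}

theorem integrableOn_inventoryJump {p : ℕ} (hF : ∀ k s, MemLp id p (m.F k s))
    {G : ℝ → (Pair → ℝ) → ℝ} (hG : HasPolyGrowth m.T p G) {t : ℝ} (ht : t ∈ Icc 0 m.T)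
    (hcont : Continuous (G t)) (k : Pair) (s : Side) (q : Pair → ℝ) :
    IntegrableOn (inventoryJump G k s t q) (Ioi 0) (m.F k s) := by
  have := m.F_prob k s
  obtain ⟨C, hC, hG⟩ := hG
  refine (((integrable_one_add_abs_pow (hF k s)).const_mul
    (2 * C * inventorySize q ^ p)).mono' ?_ (.of_forall fun r => ?_)).integrableOn
  · exact ((hcont.comp (continuous_afterOrder q k s)).sub continuous_const).aestronglyMeasurable
  · exact abs_inventoryJump_le hC (hG t ht) k s q r

theorem jumpGen_add {G H : ℝ → (Pair → ℝ) → ℝ} {t : ℝ} {q : Pair → ℝ}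
    (hG : ∀ k s, IntegrableOn (inventoryJump G k s t q) (Ioi 0) (m.F k s))
    (hH : ∀ k s, IntegrableOn (inventoryJump H k s t q) (Ioi 0) (m.F k s)) :
    m.jumpGen (fun t q => G t q + H t q) t q = m.jumpGen G t q + m.jumpGen H t q := by
  have hintegral : ∀ k s, ∫ r in Ioi 0, inventoryJump (fun t q => G t q + H t q) k s t q r
      ∂(m.F k s) = (∫ r in Ioi 0, inventoryJump G k s t q r ∂(m.F k s)) +
        ∫ r in Ioi 0, inventoryJump H k s t q r ∂(m.F k s) := fun k s => by
    rw [← integral_add (hG k s) (hH k s)]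
    exact integral_congr_ae (.of_forall fun r => add_sub_add_comm _ _ _ _)
  simp only [jumpGen, hintegral, mul_add, Finset.sum_add_distrib]

theorem jumpGen_time_mul (τ : ℝ → ℝ) (G : ℝ → (Pair → ℝ) → ℝ) (t : ℝ) (q : Pair → ℝ) :
    m.jumpGen (fun t q => τ t * G t q) t q = τ t * m.jumpGen G t q := by
  have hjump : ∀ k s r, inventoryJump (fun t q => τ t * G t q) k s t q r =
      τ t * inventoryJump G k s t q r := fun k s r => (mul_sub _ _ _).symm
  simp only [jumpGen, hjump, integral_const_mul, Finset.mul_sum, mul_left_comm]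

end Model

/-! ### Martingale polynomials of the auxiliary inventories -/

theorem hasDerivAt_single_one {f : ℝ → ℝ} {f' t : ℝ} (h : HasDerivAt f f' t) (r : ℕ) :
    HasDerivAt (fun s => (Pi.single 1 (f s) : ℕ → ℝ) r) ((Pi.single 1 f' : ℕ → ℝ) r) t := by
  rcases eq_or_ne r 1 with rfl | hr
  · simpa using h
  · simpa [hr] using hasDerivAt_const t (0 : ℝ)

theorem continuous_single_one {X : Type*} [TopologicalSpace X] {f : X → ℝ} (h : Continuous f)
    (r : ℕ) : Continuous fun x => (Pi.single 1 (f x) : ℕ → ℝ) r := by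
  rcases eq_or_ne r 1 with rfl | hr
  · simpa using h
  · simpa [hr] using continuous_const

namespace Model

variable (m : Model)

/-- The rates of growth of the cumulants of the net order flow in the pair `k`. -/
def cumRate (k : Pair) (r : ℕ) : ℝ :=
  m.lam k .sell * (∫ x, x ^ r ∂(m.F k .sell)) + (-1) ^ r * (m.lam k .buy * ∫ x, x ^ r ∂(m.F k .buy))

/-- The cumulants of the noise between the times `0` and `t`. -/
def noiseCumulant (k : Pair) (t : ℝ) (r : ℕ) : ℝ :=
  m.cumRate k r * ∫ s in (0 : ℝ)..t, m.weight k s ^ r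

theorem hasDerivAt_noiseCumulant (k : Pair) (r : ℕ) (t : ℝ) :
    HasDerivAt (fun t => m.noiseCumulant k t r) (m.cumRate k r * m.weight k t ^ r) t :=
  ((((m.continuous_weight k).pow r).integral_hasStrictDerivAt 0 t).hasDerivAt).const_mul _

@[fun_prop]
theorem continuous_noiseCumulant (k : Pair) (r : ℕ) : Continuous fun t => m.noiseCumulant k t r :=
  continuous_iff_continuousAt.2 fun t => (m.hasDerivAt_noiseCumulant k r t).continuousAt

/-- The inventory `v` at time `t` in the coordinate in which the drift vanishes. -/
def coord (k : Pair) (t v : ℝ) : ℝ := m.weight k t * v - m.shift k t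

@[fun_prop]
theorem continuous_coord (k : Pair) : Continuous fun z : ℝ × ℝ => m.coord k z.1 z.2 := by
  unfold coord
  fun_prop

theorem hasDerivAt_coord_time (k : Pair) (t v : ℝ) : HasDerivAt (fun t => m.coord k t v)
    (-(m.weight k t * (m.constDrift k t - m.reversion k t * v))) t :=
  (((m.hasDerivAt_weight k t).mul_const v).sub (m.hasDerivAt_shift k t)).congr_deriv (by ring)

theorem hasDerivAt_coord (k : Pair) (t v : ℝ) : HasDerivAt (m.coord k t) (m.weight k t) v :=
  (((hasDerivAt_id v).const_mul (m.weight k t)).sub_const (m.shift k t)).congr_deriv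
    (mul_one _)

theorem coord_add (k : Pair) (t v y : ℝ) :
    m.coord k t (v + y) = m.weight k t * y + m.coord k t v := by
  rw [coord, coord]
  ring

/-- The `n`-th Appell polynomial of the noise, in the drift-free coordinate: the noise has
independent increments, so these polynomials are martingales along the auxiliary inventory. -/
def martPoly (k : Pair) (n : ℕ) (t v : ℝ) : ℝ :=
  completeBell (Pi.single 1 (m.coord k t v) - m.noiseCumulant k t) n

/-- The time derivative of `martPoly`. -/
def martPolyDt (k : Pair) (n : ℕ) (t v : ℝ) : ℝ :=
  binomConv (Function.update
    (Pi.single 1 (-(m.weight k t * (m.constDrift k t - m.reversion k t * v))) -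
      fun r => m.cumRate k r * m.weight k t ^ r) 0 0) (fun j => m.martPoly k j t v) n

/-- The derivative of `martPoly` with respect to the inventory. -/
def martPolyDv (k : Pair) (n : ℕ) (t v : ℝ) : ℝ :=
  binomConv (Pi.single 1 (m.weight k t)) (fun j => m.martPoly k j t v) n

theorem hasDerivAt_martPoly_time (k : Pair) (n : ℕ) (t v : ℝ) :
    HasDerivAt (fun t => m.martPoly k n t v) (m.martPolyDt k n t v) t :=
  hasDerivAt_completeBell (fun r => (hasDerivAt_single_one (m.hasDerivAt_coord_time k t v) r).sub
    (m.hasDerivAt_noiseCumulant k r t)) n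

theorem hasDerivAt_martPoly (k : Pair) (n : ℕ) (t v : ℝ) :
    HasDerivAt (m.martPoly k n t) (m.martPolyDv k n t v) v := by
  refine (hasDerivAt_completeBell (fun r => (hasDerivAt_single_one (m.hasDerivAt_coord k t v)
    r).sub_const (m.noiseCumulant k t r)) n).congr_deriv ?_
  have hupdate : Function.update (Pi.single 1 (m.weight k t) : ℕ → ℝ) 0 0 =
      Pi.single 1 (m.weight k t) := by simp
  exact congrArg (fun u => binomConv u (fun j => m.martPoly k j t v) n) hupdate

theorem continuous_martPoly (k : Pair) (n : ℕ) :
    Continuous fun z : ℝ × ℝ => m.martPoly k n z.1 z.2 :=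
  continuous_completeBell (fun r => (continuous_single_one (m.continuous_coord k) r).sub
    ((m.continuous_noiseCumulant k r).comp continuous_fst)) n

theorem continuous_binomConv_martPoly {u : ℝ × ℝ → ℕ → ℝ} (hu : ∀ r, Continuous fun z => u z r)
    (k : Pair) (n : ℕ) :
    Continuous fun z : ℝ × ℝ => binomConv (u z) (fun j => m.martPoly k j z.1 z.2) n :=
  continuous_finsetSum _ fun p _ =>
    continuous_const.mul ((hu p.1).mul (m.continuous_martPoly k p.2))

theorem continuous_martPolyDt (k : Pair) (n : ℕ) :
    Continuous fun z : ℝ × ℝ => m.martPolyDt k n z.1 z.2 := by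
  refine m.continuous_binomConv_martPoly (fun r => ?_) k n
  rcases eq_or_ne r 0 with rfl | hr
  · simpa using continuous_const
  · simp only [Function.update_of_ne hr, Pi.sub_apply]
    exact (continuous_single_one (by fun_prop) r).sub (by fun_prop)

theorem continuous_martPolyDv (k : Pair) (n : ℕ) :
    Continuous fun z : ℝ × ℝ => m.martPolyDv k n z.1 z.2 :=
  m.continuous_binomConv_martPoly (fun r => continuous_single_one (by fun_prop) r) k n

theorem isC1_martPoly (T : ℝ) (k : Pair) (n : ℕ) :
    IsC1 T (fun t q => m.martPoly k n t (q k)) (fun t q => m.martPolyDt k n t (q k))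
      (fun c t q => if c = k then m.martPolyDv k n t (q k) else 0) where
  cont := by
    have := m.continuous_martPoly k n
    exact (this.comp (by fun_prop : Continuous fun z : ℝ × (Pair → ℝ) =>
      (z.1, z.2 k))).continuousOn
  cont_t := by
    have := m.continuous_martPolyDt k n
    exact (this.comp (by fun_prop : Continuous fun z : ℝ × (Pair → ℝ) =>
      (z.1, z.2 k))).continuousOn
  cont_q c := by
    have := m.continuous_martPolyDv k n
    split_ifs
    · exact (this.comp (by fun_prop : Continuous fun z : ℝ × (Pair → ℝ) =>
        (z.1, z.2 k))).continuousOn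
    · exact continuousOn_const
  deriv_t t _ q := (m.hasDerivAt_martPoly_time k n t (q k)).hasDerivWithinAt
  deriv_q c t _ q := by
    rcases eq_or_ne c k with rfl | hc
    · simpa using m.hasDerivAt_martPoly c n t (q c)
    · simpa [hc, hc.symm] using hasDerivAt_const (q c) (m.martPoly k n t (q k))

theorem hasPolyGrowth_martPoly (T : ℝ) (k : Pair) (n : ℕ) :
    HasPolyGrowth T n (fun t q => m.martPoly k n t (q k)) := by
  have hcoord : HasPolyGrowth T 1 (fun t q => m.coord k t (q k)) := by
    simpa only [coord, zero_add, sub_eq_add_neg] using!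
      ((HasPolyGrowth.of_time (m.continuous_weight k)).mul (.coord k)).add
        ((HasPolyGrowth.of_time (m.continuous_shift k).neg).mono zero_le_one)
  have hbell : ∀ j, Continuous fun t => completeBell (-m.noiseCumulant k t) j := fun j =>
    continuous_completeBell (fun r => (m.continuous_noiseCumulant k r).neg) j
  simp only [martPoly, sub_eq_add_neg, completeBell_add, binomConv, completeBell_single_one]
  refine .sum _ fun p hp => ?_
  have hterm := (HasPolyGrowth.of_time (T := T) (continuous_const (y := (n.choose p.1 : ℝ)))).mul
    ((hcoord.pow p.1).mul (.of_time (hbell p.2)))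
  refine hterm.mono ?_
  have := Finset.HasAntidiagonal.antidiagonal.fst_le hp
  omega

theorem martPoly_add (k : Pair) (n : ℕ) (t v y : ℝ) : m.martPoly k n t (v + y) =
    binomConv (fun r => (m.weight k t * y) ^ r) (fun j => m.martPoly k j t v) n := by
  rw [martPoly, coord_add, Pi.single_add, add_sub_assoc, completeBell_add]
  simp only [← completeBell_single_one]
  rfl

theorem martPoly_add_sub (k : Pair) (n : ℕ) (t v y : ℝ) :
    m.martPoly k n t (v + y) - m.martPoly k n t v =
      binomConv (Function.update (fun r => (m.weight k t * y) ^ r) 0 0)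
        (fun j => m.martPoly k j t v) n := by
  have hpow : (fun r => (m.weight k t * y) ^ r) =
      Function.update (fun r => (m.weight k t * y) ^ r) 0 0 + Pi.single 0 1 := by
    ext r
    rcases eq_or_ne r 0 with rfl | hr <;> simp [*]
  have hself := binomConv_single_left 0 1 (fun j => m.martPoly k j t v) n
  rw [zero_add, Nat.choose_zero_right, Nat.cast_one, one_mul, one_mul] at hself
  have hsplit := binomConv_add_left (Function.update (fun r => (m.weight k t * y) ^ r) 0 0)
    (Pi.single 0 1) (fun j => m.martPoly k j t v) n
  rw [← hpow, hself] at hsplit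
  rw [martPoly_add, hsplit]
  exact add_sub_cancel_right _ _

variable {m} in
theorem setIntegral_pow (k : Pair) (s : Side) {r : ℕ} (hr : r ≠ 0) :
    ∫ x in Ioi 0, x ^ r ∂(m.F k s) = ∫ x, x ^ r ∂(m.F k s) := by
  refine setIntegral_eq_integral_of_ae_compl_eq_zero ?_
  have hnonneg : ∀ᵐ x ∂(m.F k s), x ∉ Iio 0 := measure_eq_zero_iff_ae_notMem.1 (m.F_supp k s)
  filter_upwards [hnonneg] with x hx hx'
  have hzero : x = 0 := le_antisymm (not_lt.1 hx') (not_lt.1 hx)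
  rw [hzero, zero_pow hr]

/-- The generator of the order flow in the pair `k`, on functions of time and of the inventory in
that pair only. -/
def coordJumpGen (k : Pair) (f : ℝ → ℝ → ℝ) (t v : ℝ) : ℝ :=
  ∑ s : Side, m.lam k s * ∫ r in Ioi 0, (f t (v + s.sgn * r) - f t v) ∂(m.F k s)

theorem setIntegral_martPoly_add_sub {k : Pair} {s : Side} {p : ℕ} (hF : MemLp id p (m.F k s))
    {n : ℕ} (hn : n ≤ p) (t v : ℝ) :
    ∫ r in Ioi 0, (m.martPoly k n t (v + s.sgn * r) - m.martPoly k n t v) ∂(m.F k s) =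
      binomConv (Function.update
        (fun j => (m.weight k t * s.sgn) ^ j * ∫ x, x ^ j ∂(m.F k s)) 0 0)
        (fun j => m.martPoly k j t v) n := by
  have := m.F_prob k s
  simp only [martPoly_add_sub]
  unfold binomConv
  rw [integral_finsetSum]
  · refine Finset.sum_congr rfl fun i _ => ?_
    rw [integral_const_mul, integral_mul_const]
    congr 2
    rcases eq_or_ne i.1 0 with hi | hi
    · simp [hi]
    · simp only [Function.update_of_ne hi, ← mul_assoc, mul_pow _ _ i.1, integral_const_mul,
        setIntegral_pow k s hi]
  · intro i hi
    refine ((Integrable.integrableOn ?_).mul_const _).const_mul _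
    rcases eq_or_ne i.1 0 with hi0 | hi0
    · simp [hi0]
    · simp only [Function.update_of_ne hi0, ← mul_assoc, mul_pow _ _ i.1]
      exact (integrable_pow_of_memLp hF
        ((Finset.HasAntidiagonal.antidiagonal.fst_le hi).trans hn)).const_mul _

theorem coordJumpGen_martPoly {k : Pair} {p : ℕ} (hF : ∀ s, MemLp id p (m.F k s)) {n : ℕ}
    (hn : n ≤ p) (t v : ℝ) : m.coordJumpGen k (m.martPoly k n) t v =
      binomConv (Function.update (fun r => m.cumRate k r * m.weight k t ^ r) 0 0)
        (fun j => m.martPoly k j t v) n := by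
  rw [coordJumpGen, sum_side, m.setIntegral_martPoly_add_sub (hF _) hn,
    m.setIntegral_martPoly_add_sub (hF _) hn, ← binomConv_smul_left, ← binomConv_smul_left,
    ← binomConv_add_left]
  refine binomConv_congr (fun r _ => ?_) fun _ _ => rfl
  rcases eq_or_ne r 0 with rfl | hr
  · simp
  · simp only [Pi.add_apply, Pi.smul_apply, Function.update_of_ne hr, smul_eq_mul, cumRate,
      Side.sgn, mul_pow, one_pow]
    ring

theorem martPoly_backward {k : Pair} {p : ℕ} (hF : ∀ s, MemLp id p (m.F k s)) {n : ℕ}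
    (hn : n ≤ p) {t : ℝ} (ht : t ≤ m.T) (v : ℝ) :
    m.martPolyDt k n t v + m.beta k t v * m.martPolyDv k n t v +
      m.coordJumpGen k (m.martPoly k n) t v = 0 := by
  rw [m.coordJumpGen_martPoly hF hn, martPolyDt, martPolyDv, ← binomConv_smul_left,
    ← binomConv_add_left, ← binomConv_add_left, m.beta_eq k ht]
  refine (binomConv_congr (u' := 0) (fun r _ => ?_) fun _ _ => rfl).trans
    (binomConv_zero_left _ n)
  rcases eq_or_ne r 0 with rfl | hr
  · simp
  · rcases eq_or_ne r 1 with rfl | hr'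
    · simp only [Pi.add_apply, Pi.sub_apply, Pi.smul_apply, Pi.zero_apply, smul_eq_mul, ne_eq,
        one_ne_zero, not_false_eq_true, Function.update_of_ne, Pi.single_eq_same, pow_one]
      ring
    · simp [hr', hr]

/-- The backward operator `∂ₜ + ℒ`, where `ℒ` is the generator of the auxiliary inventories, on a
function `G` of time and inventories with the partial derivatives `Gt` and `Gq`. -/
def backwardOp (G Gt : ℝ → (Pair → ℝ) → ℝ) (Gq : Pair → ℝ → (Pair → ℝ) → ℝ) (t : ℝ)
    (q : Pair → ℝ) : ℝ :=
  Gt t q + (∑ k, m.beta k t (q k) * Gq k t q) + m.jumpGen G t q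

/-- `B` solves the homogeneous backward equation of the auxiliary inventories. -/
def IsHarmonic (B : ℝ → (Pair → ℝ) → ℝ) : Prop :=
  ∃ Bt Bq, IsC1 m.T B Bt Bq ∧ ∀ t ∈ Ico 0 m.T, ∀ q, m.backwardOp B Bt Bq t q = 0

theorem jumpGen_coord_mul_coord {k l : Pair} (hkl : k ≠ l) (f g : ℝ → ℝ → ℝ) (t : ℝ)
    (q : Pair → ℝ) : m.jumpGen (fun t q => f t (q k) * g t (q l)) t q =
      m.coordJumpGen k f t (q k) * g t (q l) + f t (q k) * m.coordJumpGen l g t (q l) := by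
  have hpair : ∀ c : Pair, (∑ s : Side, m.lam c s * ∫ r in Ioi 0,
        inventoryJump (fun t q => f t (q k) * g t (q l)) c s t q r ∂(m.F c s)) =
      (if c = k then m.coordJumpGen k f t (q k) * g t (q l) else 0) +
        (if c = l then f t (q k) * m.coordJumpGen l g t (q l) else 0) := by
    intro c
    rcases eq_or_ne c k with rfl | hck
    · simp only [inventoryJump, afterOrder, Function.update_self, Function.update_of_ne hkl.symm,
        ← sub_mul, integral_mul_const, coordJumpGen, Finset.sum_mul, mul_assoc, if_true, hkl,
        if_false, add_zero]
    rcases eq_or_ne c l with rfl | hcl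
    · simp only [inventoryJump, afterOrder, Function.update_self, Function.update_of_ne hkl,
        ← mul_sub, integral_const_mul, coordJumpGen, Finset.mul_sum, mul_left_comm (m.lam c _ : ℝ),
        if_true, hck, if_false, zero_add]
    · simp [inventoryJump, afterOrder, hck, hcl, hck.symm, hcl.symm]
  simp only [jumpGen, hpair, Finset.sum_add_distrib, Finset.sum_ite_eq', Finset.mem_univ, if_true]

theorem isHarmonic_martPoly_mul {p : ℕ} (hF : ∀ k s, MemLp id p (m.F k s)) {k l : Pair}
    (hkl : k ≠ l) {i j : ℕ} (hi : i ≤ p) (hj : j ≤ p) :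
    m.IsHarmonic (fun t q => m.martPoly k i t (q k) * m.martPoly l j t (q l)) := by
  refine ⟨_, _, (m.isC1_martPoly m.T k i).mul (m.isC1_martPoly m.T l j), fun t ht q => ?_⟩
  rw [backwardOp, m.jumpGen_coord_mul_coord hkl]
  simp only [mul_add, Finset.sum_add_distrib, ite_mul, mul_ite, zero_mul, mul_zero,
    Finset.sum_ite_eq', Finset.mem_univ, if_true]
  linear_combination m.martPoly l j t (q l) * m.martPoly_backward (hF k) hi ht.2.le (q k) +
    m.martPoly k i t (q k) * m.martPoly_backward (hF l) hj ht.2.le (q l)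

end Model

section Noise

variable {Ω : Type*} {m : Model} {N : Pair → Side → ℝ≥0 → Ω → ℕ} {ξ : Pair → Side → ℕ → Ω → ℝ}

theorem measurable_noise (k : Pair) (t u : ℝ) :
    Measurable[⨆ j ∈ {j : Pair × Side | j.1 = k}, compoundSigma (N j.1 j.2) (ξ j.1 j.2)]
      (noise m N ξ k t u) := by
  have hside : ∀ s, Measurable[⨆ j ∈ {j : Pair × Side | j.1 = k},
      compoundSigma (N j.1 j.2) (ξ j.1 j.2)] (stochInt (m.weight k) (N k s) (ξ k s) t u) :=
    fun s => (measurable_stochInt (m.weight k) (N k s) (ξ k s) t u).mono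
      (le_iSup₂_of_le (f := fun (j : Pair × Side) (_ : j ∈ {j : Pair × Side | j.1 = k}) =>
        compoundSigma (N j.1 j.2) (ξ j.1 j.2)) (k, s) rfl le_rfl) le_rfl
  exact (hside .sell).add ((hside .buy).const_mul _)

variable [MeasurableSpace Ω] {P : Measure Ω} {p : ℕ} {k l : Pair} {t u q q' : ℝ}
  {Q Q' : ℝ → Ω → ℝ}

theorem indepFun_noise (hflow : IsOrderFlow m P N ξ) (hkl : k ≠ l) (t u : ℝ) :
    IndepFun (noise m N ξ k t u) (noise m N ξ l t u) P := by
  refine indep_of_indep_of_le (hflow.indep_compoundSigma (S := {j | j.1 = k})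
    (T := {j | j.1 = l}) ?_) (measurable_noise k t u).comap_le (measurable_noise l t u).comap_le
  exact Set.disjoint_left.2 fun j (hk : j.1 = k) (hl : j.1 = l) => hkl (hk.symm.trans hl)

theorem indepFun_stochInt_sides (hflow : IsOrderFlow m P N ξ) (k : Pair) (w : ℝ → ℝ) (t u : ℝ) :
    IndepFun (stochInt w (N k .sell) (ξ k .sell) t u) (stochInt w (N k .buy) (ξ k .buy) t u)
      P := by
  have hindep := hflow.indep_compoundSigma (S := {(k, .sell)}) (T := {(k, .buy)}) (by simp)
  simp only [mem_singleton_iff, iSup_iSup_eq_left] at hindep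
  exact indep_of_indep_of_le hindep (measurable_stochInt _ _ _ _ _).comap_le
    (measurable_stochInt _ _ _ _ _).comap_le

theorem hasCumulants_noise [IsProbabilityMeasure P] (hflow : IsOrderFlow m P N ξ)
    (hF : ∀ s, MemLp id p (m.F k s)) (ht : 0 ≤ t) (htu : t ≤ u) :
    HasCumulants p (noise m N ξ k t u) P (m.noiseCumulant k u - m.noiseCumulant k t) := by
  have hw' : Continuous fun s => m.weight k s * m.reversion k s := by fun_prop
  have hside := fun s => (hflow.isCompoundPoisson k s).hasCumulants_stochInt (hF s)
    (m.hasDerivAt_weight k) hw' ht htu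
  have hindep := (indepFun_stochInt_sides hflow k (m.weight k) t u).comp measurable_id
    (measurable_const_mul (-1))
  refine ((hside .sell).add ((hside .buy).const_mul (-1)) hindep).congr_cumulants fun r => ?_
  have hint : ∀ a b : ℝ, IntervalIntegrable (fun s => m.weight k s ^ (r + 1)) volume a b :=
    ((m.continuous_weight k).pow (r + 1)).intervalIntegrable
  have hsub := intervalIntegral.integral_interval_sub_left (hint 0 u) (hint 0 t)
  simp only [Pi.add_apply, Pi.sub_apply, Model.noiseCumulant, Model.cumRate, ← mul_sub, hsub]
  ring

namespace IsAuxInventory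

theorem ae_martPoly_eq (hflow : IsOrderFlow m P N ξ) (hQ : IsAuxInventory m P N ξ k t q Q)
    (hu : u ∈ Icc t m.T) (n : ℕ) :
    ∀ᵐ ω ∂P, m.martPoly k n u (Q u ω) = completeBell (Pi.single 1 (noise m N ξ k t u ω) +
      (Pi.single 1 (m.coord k t q) - m.noiseCumulant k u)) n := by
  filter_upwards [hQ.ae_eq hflow hu] with ω hω
  have hcoord : m.coord k u (Q u ω) = noise m N ξ k t u ω + m.coord k t q :=
    hω.trans (add_comm _ _)
  rw [Model.martPoly, hcoord, Pi.single_add, add_sub_assoc]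

theorem integrable_martPoly [IsProbabilityMeasure P] (hflow : IsOrderFlow m P N ξ)
    (hF : ∀ s, MemLp id p (m.F k s)) (hQ : IsAuxInventory m P N ξ k t q Q) (ht : 0 ≤ t)
    (hu : u ∈ Icc t m.T) {n : ℕ} (hn : n ≤ p) :
    Integrable (fun ω => m.martPoly k n u (Q u ω)) P :=
  ((hasCumulants_noise hflow hF ht hu.1).integrable_completeBell hn _).congr
    ((hQ.ae_martPoly_eq hflow hu n).mono fun _ => Eq.symm)

theorem integral_martPoly [IsProbabilityMeasure P] (hflow : IsOrderFlow m P N ξ)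
    (hF : ∀ s, MemLp id p (m.F k s)) (hQ : IsAuxInventory m P N ξ k t q Q) (ht : 0 ≤ t)
    (hu : u ∈ Icc t m.T) {n : ℕ} (hn : n ≤ p) :
    ∫ ω, m.martPoly k n u (Q u ω) ∂P = m.martPoly k n t q := by
  rw [integral_congr_ae (hQ.ae_martPoly_eq hflow hu n),
    (hasCumulants_noise hflow hF ht hu.1).integral_completeBell hn, Model.martPoly]
  congr 1
  abel

theorem indepFun (hflow : IsOrderFlow m P N ξ) (hkl : k ≠ l)
    (hQ : IsAuxInventory m P N ξ k t q Q) (hQ' : IsAuxInventory m P N ξ l t q' Q')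
    (hu : u ∈ Icc t m.T) : IndepFun (Q u) (Q' u) P := by
  have hsolve : ∀ {c : Pair} {v : ℝ} {R : ℝ → Ω → ℝ}, IsAuxInventory m P N ξ c t v R →
      (fun ω => (m.weight c u)⁻¹ * (m.shift c u + m.coord c t v + noise m N ξ c t u ω)) =ᵐ[P]
        R u := by
    intro c v R hR
    filter_upwards [hR.ae_eq hflow hu] with ω hω
    have hω : m.weight c u * R u ω - m.shift c u = m.coord c t v + noise m N ξ c t u ω := hω
    rw [inv_mul_eq_iff_eq_mul₀ (m.weight_pos c u).ne']
    linarith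
  exact (((indepFun_noise hflow hkl t u).comp
    (φ := fun x => (m.weight k u)⁻¹ * (m.shift k u + m.coord k t q + x))
    (ψ := fun x => (m.weight l u)⁻¹ * (m.shift l u + m.coord l t q' + x))
    (by fun_prop) (by fun_prop)).congr (hsolve hQ) (hsolve hQ'))

end IsAuxInventory

end Noise

section PolynomialMartingale

variable {Ω : Type*} [MeasurableSpace Ω]

/-- `B` solves the homogeneous backward equation with polynomial growth of degree `p`, and is a
martingale along the auxiliary inventories, in that its expectation is constant in time. -/
structure IsPolynomialMartingale (m : Model) (P : Measure Ω) (Q : Pair → ℝ → ℝ → ℝ → Ω → ℝ)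
    (p : ℕ) (B : ℝ → (Pair → ℝ) → ℝ) : Prop where
  harmonic : m.IsHarmonic B
  growth : HasPolyGrowth m.T p B
  integrable : ∀ t ∈ Icc 0 m.T, ∀ u ∈ Icc t m.T, ∀ q : Pair → ℝ,
    Integrable (fun ω => B u (fun k => Q k t (q k) u ω)) P
  integral_eq : ∀ t ∈ Icc 0 m.T, ∀ u ∈ Icc t m.T, ∀ q : Pair → ℝ,
    ∫ ω, B u (fun k => Q k t (q k) u ω) ∂P = B t q

variable {P : Measure Ω} {m : Model} {N : Pair → Side → ℝ≥0 → Ω → ℕ}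
  {ξ : Pair → Side → ℕ → Ω → ℝ} {Q : Pair → ℝ → ℝ → ℝ → Ω → ℝ} {p : ℕ}

theorem isPolynomialMartingale_martPoly_mul [IsProbabilityMeasure P]
    (hflow : IsOrderFlow m P N ξ) (hF : ∀ k s, MemLp id p (m.F k s))
    (hQ : ∀ k, ∀ t ∈ Icc 0 m.T, ∀ q, IsAuxInventory m P N ξ k t q (Q k t q)) {k l : Pair}
    (hkl : k ≠ l) {i j : ℕ} (hij : i + j ≤ p) :
    IsPolynomialMartingale m P Q p
      (fun t q => m.martPoly k i t (q k) * m.martPoly l j t (q l)) := by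
  have hi : i ≤ p := by omega
  have hj : j ≤ p := by omega
  have hmeas : ∀ c n u, Measurable (m.martPoly c n u) := fun c n u =>
    ((m.continuous_martPoly c n).comp (by fun_prop : Continuous fun v : ℝ => (u, v))).measurable
  have hindep : ∀ t ∈ Icc 0 m.T, ∀ u ∈ Icc t m.T, ∀ q : Pair → ℝ,
      IndepFun (fun ω => m.martPoly k i u (Q k t (q k) u ω))
        (fun ω => m.martPoly l j u (Q l t (q l) u ω)) P := fun t ht u hu q =>
    ((hQ k t ht (q k)).indepFun hflow hkl (hQ l t ht (q l)) hu).comp (hmeas k i u) (hmeas l j u)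
  have hintegrable : ∀ c, ∀ n ≤ p, ∀ t ∈ Icc 0 m.T, ∀ u ∈ Icc t m.T, ∀ q : Pair → ℝ,
      Integrable (fun ω => m.martPoly c n u (Q c t (q c) u ω)) P := fun c n hn t ht u hu q =>
    (hQ c t ht (q c)).integrable_martPoly hflow (hF c) ht.1 hu hn
  refine ⟨m.isHarmonic_martPoly_mul hF hkl hi hj, ?_, fun t ht u hu q => ?_, fun t ht u hu q => ?_⟩
  · exact ((m.hasPolyGrowth_martPoly m.T k i).mul (m.hasPolyGrowth_martPoly m.T l j)).mono hij
  · exact (hindep t ht u hu q).integrable_mul (hintegrable k i hi t ht u hu q)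
      (hintegrable l j hj t ht u hu q)
  · rw [(hindep t ht u hu q).integral_fun_mul_eq_mul_integral
      (hintegrable k i hi t ht u hu q).aestronglyMeasurable
      (hintegrable l j hj t ht u hu q).aestronglyMeasurable,
      (hQ k t ht (q k)).integral_martPoly hflow (hF k) ht.1 hu hi,
      (hQ l t ht (q l)).integral_martPoly hflow (hF l) ht.1 hu hj]

end PolynomialMartingale

/-! ### The Feynman-Kac formula -/

section Discounting

variable {c T t : ℝ} {f : ℝ → ℝ}

/-- The integral of `f` from `t` to the horizon, discounted at the rate `-c`. -/
def discounted (c T : ℝ) (f : ℝ → ℝ) (t : ℝ) : ℝ := ∫ u in t..T, Real.exp (c * (u - t)) * f u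

theorem discounted_eq (c T : ℝ) (f : ℝ → ℝ) (t : ℝ) :
    discounted c T f t = Real.exp (-c * t) * ∫ u in t..T, Real.exp (c * u) * f u := by
  rw [discounted, ← intervalIntegral.integral_const_mul]
  refine intervalIntegral.integral_congr fun u _ => ?_
  rw [← mul_assoc, ← Real.exp_add]
  ring_nf

theorem discounted_congr {g : ℝ → ℝ} (ht : t ≤ T) (h : EqOn f g (Icc t T)) :
    discounted c T f t = discounted c T g t :=
  intervalIntegral.integral_congr fun u hu => by
    simp only [h (uIcc_of_le ht ▸ hu)]

theorem discounted_add {g : ℝ → ℝ} (hf : IntervalIntegrable f volume t T)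
    (hg : IntervalIntegrable g volume t T) :
    discounted c T (fun u => f u + g u) t = discounted c T f t + discounted c T g t := by
  have hexp : Continuous fun u => Real.exp (c * (u - t)) := by fun_prop
  simp only [discounted, mul_add]
  exact intervalIntegral.integral_add (hf.continuousOn_mul hexp.continuousOn)
    (hg.continuousOn_mul hexp.continuousOn)

theorem discounted_mul_const (c T : ℝ) (f : ℝ → ℝ) (b t : ℝ) :
    discounted c T (fun u => f u * b) t = discounted c T f t * b := by
  simp only [discounted, ← mul_assoc, intervalIntegral.integral_mul_const]

theorem hasDerivAt_discounted (hf : Continuous f) (c T t : ℝ) :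
    HasDerivAt (discounted c T f) (-c * discounted c T f t - f t) t := by
  have hint : Continuous fun u => Real.exp (c * u) * f u := by fun_prop
  have hintegral : HasDerivAt (fun t => ∫ u in t..T, Real.exp (c * u) * f u)
      (-(Real.exp (c * t) * f t)) t := by
    simp only [intervalIntegral.integral_symm T]
    exact (hint.integral_hasStrictDerivAt T t).hasDerivAt.neg
  have hexp : HasDerivAt (fun t => Real.exp (-c * t)) (Real.exp (-c * t) * -c) t :=
    ((hasDerivAt_id t).const_mul (-c)).exp.congr_deriv (by simp)
  rw [funext (discounted_eq c T f)]
  refine (hexp.mul hintegral).congr_deriv ?_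
  have hcancel : Real.exp (-c * t) * Real.exp (c * t) = 1 := by
    rw [← Real.exp_add]
    simp
  linear_combination -f t * hcancel

theorem continuous_discounted (hf : Continuous f) (c T : ℝ) : Continuous (discounted c T f) :=
  continuous_iff_continuousAt.2 fun t => (hasDerivAt_discounted hf c T t).continuousAt

end Discounting

namespace Model

variable (m : Model)

theorem continuousOn_h0part (k : Pair) : ContinuousOn (m.h0part k) (Iic m.T) := by
  have hdiscounted : ∀ {f : ℝ → ℝ}, ContinuousOn f (Iic m.T) →
      ContinuousOn (discounted (m.muHat k) m.T f) (Iic m.T) := fun {f} hf =>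
    (continuous_discounted (continuous_stopped hf) _ _).continuousOn.congr fun t ht =>
      discounted_congr ht fun u hu => (m.stopped_eq f hu.2).symm
  have h1 := m.continuousOn_h1 k
  have h2 := m.continuousOn_h2 k
  exact (((hdiscounted continuousOn_const).neg.add (hdiscounted (continuousOn_const.mul h1))).add
    (hdiscounted (continuousOn_const.mul h2))).sub
    (hdiscounted (continuousOn_const.mul (h1.pow 2)))

/-- The backward equation `∂ₜG + ℒG + cG = K S` for the auxiliary inventories, with terminal value
zero. -/
def IsBackwardSolution (c K : ℝ) (S G : ℝ → (Pair → ℝ) → ℝ) : Prop :=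
  (∃ Gt Gq, IsC1 m.T G Gt Gq ∧ ∀ t ∈ Ico 0 m.T, ∀ q,
    m.backwardOp G Gt Gq t q + c * G t q - K * S t q = 0) ∧ ∀ q, G m.T q = 0

variable {m} {c K : ℝ} {S S' G G' : ℝ → (Pair → ℝ) → ℝ}

theorem jumpGen_congr {t : ℝ} (h : G' t = G t) (q : Pair → ℝ) :
    m.jumpGen G' t q = m.jumpGen G t q := by
  simp only [jumpGen, inventoryJump, h]

theorem IsBackwardSolution.congr (h : m.IsBackwardSolution c K S G)
    (hS : ∀ t ∈ Icc 0 m.T, S' t = S t) (hG : ∀ t ∈ Icc 0 m.T, G' t = G t) :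
    m.IsBackwardSolution c K S' G' := by
  obtain ⟨⟨Gt, Gq, hC1, heq⟩, hterminal⟩ := h
  refine ⟨⟨Gt, Gq, hC1.congr fun t ht q => congrFun (hG t ht) q, fun t ht q => ?_⟩, fun q => ?_⟩
  · have ht' := Ico_subset_Icc_self ht
    rw [backwardOp, jumpGen_congr (hG t ht'), hG t ht', hS t ht']
    exact heq t ht q
  · rw [hG m.T (right_mem_Icc.2 m.T_pos.le), hterminal]

theorem IsBackwardSolution.add {p : ℕ} (hF : ∀ k s, MemLp id p (m.F k s))
    (h : m.IsBackwardSolution c K S G) (h' : m.IsBackwardSolution c K S' G')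
    (hG : HasPolyGrowth m.T p G) (hG' : HasPolyGrowth m.T p G') :
    m.IsBackwardSolution c K (fun t q => S t q + S' t q) (fun t q => G t q + G' t q) := by
  obtain ⟨⟨Gt, Gq, hC1, heq⟩, hterminal⟩ := h
  obtain ⟨⟨Gt', Gq', hC1', heq'⟩, hterminal'⟩ := h'
  refine ⟨⟨_, _, hC1.add hC1', fun t ht q => ?_⟩, fun q => by simp [hterminal, hterminal']⟩
  have ht' := Ico_subset_Icc_self ht
  rw [backwardOp, jumpGen_add
    (fun k s => integrableOn_inventoryJump hF hG ht' (hC1.continuous_q ht') k s q)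
    fun k s => integrableOn_inventoryJump hF hG' ht' (hC1'.continuous_q ht') k s q]
  simp only [mul_add, Finset.sum_add_distrib]
  have hsum := congrArg₂ (· + ·) (heq t ht q) (heq' t ht q)
  simp only [backwardOp] at hsum
  linear_combination hsum

theorem IsBackwardSolution.const_mul (h : m.IsBackwardSolution c K S G) (b : ℝ) :
    m.IsBackwardSolution c K (fun t q => b * S t q) (fun t q => b * G t q) := by
  obtain ⟨⟨Gt, Gq, hC1, heq⟩, hterminal⟩ := h
  refine ⟨⟨_, _, hC1.const_mul b, fun t ht q => ?_⟩, fun q => by simp [hterminal]⟩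
  have hG := heq t ht q
  rw [backwardOp] at hG
  simp only [backwardOp, jumpGen_time_mul (fun _ => b), mul_left_comm _ b, ← Finset.mul_sum]
  linear_combination b * hG

theorem IsHarmonic.isBackwardSolution {B : ℝ → (Pair → ℝ) → ℝ} (hB : m.IsHarmonic B) {τ d : ℝ → ℝ}
    (hd : Continuous d) (hτ : ∀ t, HasDerivAt τ (-c * τ t + K * d t) t) (hT : τ m.T = 0) :
    m.IsBackwardSolution c K (fun t q => d t * B t q) (fun t q => τ t * B t q) := by
  obtain ⟨Bt, Bq, hC1, heq⟩ := hB
  have hτc : Continuous τ := continuous_iff_continuousAt.2 fun t => (hτ t).continuousAt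
  refine ⟨⟨_, _, (IsC1.of_time hτ (by fun_prop)).mul hC1, fun t ht q => ?_⟩, fun q => by simp [hT]⟩
  have hdrift : ∑ k, m.beta k t (q k) * (0 * B t q + τ t * Bq k t q) =
      τ t * ∑ k, m.beta k t (q k) * Bq k t q := by
    simp only [zero_mul, zero_add, Finset.mul_sum, mul_left_comm]
  have hB := heq t ht q
  rw [backwardOp] at hB
  rw [backwardOp, jumpGen_time_mul, hdrift]
  linear_combination τ t * hB

end Model

section Representation

variable {Ω : Type*} [MeasurableSpace Ω]

/-- Expectation, at time `u`, of a function `S` of time and inventories along the auxiliary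
inventories that start from `q` at time `t`. -/
def expAlong (P : Measure Ω) (Q : Pair → ℝ → ℝ → ℝ → Ω → ℝ) (S : ℝ → (Pair → ℝ) → ℝ)
    (t : ℝ) (q : Pair → ℝ) (u : ℝ) : ℝ :=
  ∫ ω, S u (fun k => Q k t (q k) u ω) ∂P

/-- The Feynman-Kac formula for the backward equation `Model.IsBackwardSolution`. -/
def feynmanKac (m : Model) (P : Measure Ω) (Q : Pair → ℝ → ℝ → ℝ → Ω → ℝ) (c K : ℝ)
    (S : ℝ → (Pair → ℝ) → ℝ) (t : ℝ) (q : Pair → ℝ) : ℝ :=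
  -(K * discounted c m.T (expAlong P Q S t q) t)

/-- The Feynman-Kac formula with the source `S` is well defined, and gives a solution of the
backward equation with polynomial growth of degree `p`. -/
structure IsRepresentable (m : Model) (P : Measure Ω) (Q : Pair → ℝ → ℝ → ℝ → Ω → ℝ) (p : ℕ)
    (S : ℝ → (Pair → ℝ) → ℝ) : Prop where
  integrable : ∀ t ∈ Icc 0 m.T, ∀ u ∈ Icc t m.T, ∀ q : Pair → ℝ,
    Integrable (fun ω => S u (fun k => Q k t (q k) u ω)) P
  intervalIntegrable : ∀ t ∈ Icc 0 m.T, ∀ q,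
    IntervalIntegrable (expAlong P Q S t q) volume t m.T
  isBackwardSolution : ∀ c K, m.IsBackwardSolution c K S (feynmanKac m P Q c K S)
  growth : ∀ c K, HasPolyGrowth m.T p (feynmanKac m P Q c K S)

variable {m : Model} {P : Measure Ω} {Q : Pair → ℝ → ℝ → ℝ → Ω → ℝ} {p : ℕ}

theorem IsPolynomialMartingale.isRepresentable {B : ℝ → (Pair → ℝ) → ℝ}
    (hB : IsPolynomialMartingale m P Q p B) {d : ℝ → ℝ} (hd : Continuous d) :
    IsRepresentable m P Q p (fun t q => d t * B t q) := by
  have hexp : ∀ t ∈ Icc 0 m.T, ∀ q, EqOn (expAlong P Q (fun t q => d t * B t q) t q)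
      (fun u => d u * B t q) (Icc t m.T) := fun t ht q u hu => by
    rw [expAlong, integral_const_mul, hB.integral_eq t ht u hu q]
  have hformula : ∀ c K, ∀ t ∈ Icc 0 m.T, ∀ q, feynmanKac m P Q c K (fun t q => d t * B t q) t q =
      -(K * discounted c m.T d t) * B t q := fun c K t ht q => by
    rw [feynmanKac, discounted_congr ht.2 (hexp t ht q), discounted_mul_const]
    ring
  have hτ : ∀ c K t, HasDerivAt (fun t => -(K * discounted c m.T d t))
      (-c * -(K * discounted c m.T d t) + K * d t) t := fun c K t =>
    ((hasDerivAt_discounted hd c m.T t).const_mul K).neg.congr_deriv (by ring)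
  refine ⟨fun t ht u hu q => (hB.integrable t ht u hu q).const_mul _, fun t ht q => ?_,
    fun c K => ?_, fun c K => ?_⟩
  · refine ((hd.mul (continuous_const (y := B t q))).intervalIntegrable t m.T).congr fun u hu => ?_
    exact (hexp t ht q (Ioc_subset_Icc_self (uIoc_of_le ht.2 ▸ hu))).symm
  · exact (hB.harmonic.isBackwardSolution hd (hτ c K) (by simp [discounted])).congr
      (fun _ _ => rfl) fun t ht => funext (hformula c K t ht)
  · refine HasPolyGrowth.congr ?_ (hformula c K)
    simpa using (HasPolyGrowth.of_time (T := m.T)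
      ((continuous_discounted hd c m.T).const_mul K).neg).mul hB.growth

namespace IsRepresentable

variable {S S' : ℝ → (Pair → ℝ) → ℝ}

theorem congr (h : IsRepresentable m P Q p S) (e : ∀ t ∈ Icc 0 m.T, S' t = S t) :
    IsRepresentable m P Q p S' := by
  have hmem : ∀ {t u}, t ∈ Icc 0 m.T → u ∈ Icc t m.T → u ∈ Icc 0 m.T := fun ht hu =>
    ⟨ht.1.trans hu.1, hu.2⟩
  have hexp : ∀ t ∈ Icc 0 m.T, ∀ q,
      EqOn (expAlong P Q S' t q) (expAlong P Q S t q) (Icc t m.T) := fun t ht q u hu => by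
    simp only [expAlong, e u (hmem ht hu)]
  have hformula : ∀ c K, ∀ t ∈ Icc 0 m.T, feynmanKac m P Q c K S' t = feynmanKac m P Q c K S t :=
    fun c K t ht => funext fun q => by
      rw [feynmanKac, feynmanKac, discounted_congr ht.2 (hexp t ht q)]
  refine ⟨fun t ht u hu q => ?_, fun t ht q => ?_, fun c K => ?_, fun c K => ?_⟩
  · simpa only [e u (hmem ht hu)] using h.integrable t ht u hu q
  · exact (h.intervalIntegrable t ht q).congr fun u hu =>
      (hexp t ht q (Ioc_subset_Icc_self (uIoc_of_le ht.2 ▸ hu))).symm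
  · exact (h.isBackwardSolution c K).congr e (hformula c K)
  · exact (h.growth c K).congr fun t ht => congrFun (hformula c K t ht)

theorem add (hF : ∀ k s, MemLp id p (m.F k s)) (h : IsRepresentable m P Q p S)
    (h' : IsRepresentable m P Q p S') : IsRepresentable m P Q p (fun t q => S t q + S' t q) := by
  have hexp : ∀ t ∈ Icc 0 m.T, ∀ q, EqOn (expAlong P Q (fun t q => S t q + S' t q) t q)
      (fun u => expAlong P Q S t q u + expAlong P Q S' t q u) (Icc t m.T) := fun t ht q u hu =>
    integral_add (h.integrable t ht u hu q) (h'.integrable t ht u hu q)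
  have hformula : ∀ c K, ∀ t ∈ Icc 0 m.T, feynmanKac m P Q c K (fun t q => S t q + S' t q) t =
      fun q => feynmanKac m P Q c K S t q + feynmanKac m P Q c K S' t q :=
    fun c K t ht => funext fun q => by
      rw [feynmanKac, discounted_congr ht.2 (hexp t ht q),
        discounted_add (h.intervalIntegrable t ht q) (h'.intervalIntegrable t ht q), feynmanKac,
        feynmanKac]
      ring
  refine ⟨fun t ht u hu q => (h.integrable t ht u hu q).add (h'.integrable t ht u hu q),
    fun t ht q => ?_, fun c K => ?_, fun c K => ?_⟩
  · refine ((h.intervalIntegrable t ht q).add (h'.intervalIntegrable t ht q)).congr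
      fun u hu => ?_
    exact (hexp t ht q (Ioc_subset_Icc_self (uIoc_of_le ht.2 ▸ hu))).symm
  · exact ((h.isBackwardSolution c K).add hF (h'.isBackwardSolution c K) (h.growth c K)
      (h'.growth c K)).congr (fun _ _ => rfl) (hformula c K)
  · exact ((h.growth c K).add (h'.growth c K)).congr fun t ht => congrFun (hformula c K t ht)

theorem sum (hF : ∀ k s, MemLp id p (m.F k s)) {α : Type*} {s : Finset α} (hs : s.Nonempty)
    {S : α → ℝ → (Pair → ℝ) → ℝ} (h : ∀ i ∈ s, IsRepresentable m P Q p (S i)) :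
    IsRepresentable m P Q p (fun t q => ∑ i ∈ s, S i t q) := by
  induction hs using Finset.Nonempty.cons_induction with
  | singleton i => simpa using h i
  | cons i s _ _ ih =>
    simp only [Finset.sum_cons]
    exact (h i (Finset.mem_cons_self i s)).add hF
      (ih fun j hj => h j (Finset.mem_cons_of_mem hj))

end IsRepresentable

end Representation

namespace Model

variable (m : Model)

/-- The coefficients of the `n`-th power of the inventory in the basis `martPoly`. -/
def powCoeff (k : Pair) (n : ℕ) (i : ℕ × ℕ) (t : ℝ) : ℝ :=
  (m.weight k t)⁻¹ ^ n * (n.choose i.1 *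
    completeBell (m.noiseCumulant k t + Pi.single 1 (m.shift k t)) i.2)

theorem continuous_powCoeff (k : Pair) (n : ℕ) (i : ℕ × ℕ) : Continuous (m.powCoeff k n i) := by
  have hbell : Continuous fun t =>
      completeBell (m.noiseCumulant k t + Pi.single 1 (m.shift k t)) i.2 :=
    continuous_completeBell (fun r => (m.continuous_noiseCumulant k r).add
      (continuous_single_one (m.continuous_shift k) r)) i.2
  exact (((m.continuous_weight k).inv₀ fun t => (m.weight_pos k t).ne').pow n).mul
    (continuous_const.mul hbell)

theorem pow_eq_sum_martPoly (k : Pair) (n : ℕ) (t v : ℝ) :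
    v ^ n = ∑ i ∈ Finset.HasAntidiagonal.antidiagonal n,
      m.powCoeff k n i t * m.martPoly k i.1 t v := by
  have hcumulants : (Pi.single 1 (m.weight k t * v) : ℕ → ℝ) =
      (Pi.single 1 (m.coord k t v) - m.noiseCumulant k t) +
        (m.noiseCumulant k t + Pi.single 1 (m.shift k t)) := by
    rw [← add_assoc, sub_add_cancel, ← Pi.single_add, coord, sub_add_cancel]
  have hpow := completeBell_single_one (m.weight k t * v) n
  rw [hcumulants, completeBell_add, mul_pow] at hpow
  rw [(eq_inv_mul_iff_mul_eq₀ (pow_ne_zero n (m.weight_pos k t).ne')).2 hpow.symm, ← inv_pow,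
    binomConv, Finset.mul_sum]
  refine Finset.sum_congr rfl fun i _ => ?_
  rw [powCoeff, martPoly]
  ring

/-- The contribution of the pair `k`, with the inventory `v`, to the first derivatives of `H₀`. -/
def part (k : Pair) (t v : ℝ) : ℝ := -m.h0part k t + (1 - m.h1 k t) * v - m.h2 k t * v ^ 2

theorem dxH0_eq (t v w : ℝ) : m.dxH0 t v w = m.part .x t v + m.part .z t w := by
  rw [dxH0, h0x, part, part]
  ring

theorem dyH0_eq (t v : ℝ) : m.dyH0 t v = m.part .y t v := by
  rw [dyH0, h0y, part]
  ring

/-- The coefficients of `Model.part`, as functions of time. -/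
def partCoeff (k : Pair) : Fin 3 → ℝ → ℝ := ![fun t => -m.h0part k t, fun t => 1 - m.h1 k t,
  fun t => -m.h2 k t]

theorem continuousOn_partCoeff (k : Pair) (i : Fin 3) :
    ContinuousOn (m.partCoeff k i) (Iic m.T) := by
  fin_cases i
  · exact (m.continuousOn_h0part k).neg
  · exact continuousOn_const.sub (m.continuousOn_h1 k)
  · exact (m.continuousOn_h2 k).neg

theorem part_eq_sum (k : Pair) (t v : ℝ) :
    m.part k t v = ∑ i : Fin 3, m.partCoeff k i t * v ^ (i : ℕ) := by
  rw [part, Fin.sum_univ_three]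
  change _ = -m.h0part k t * v ^ 0 + (1 - m.h1 k t) * v ^ 1 + -m.h2 k t * v ^ 2
  ring

/-- The squared sensitivity of `H₀` to the exchange rate `x`: the source of the equation for
`H₁₁`. -/
def sourceXX (t : ℝ) (q : Pair → ℝ) : ℝ := m.dxH0 t (q .x) (q .z) ^ 2

/-- The squared sensitivity of `H₀` to the exchange rate `y`: the source of the equation for
`H₁₂`. -/
def sourceYY (t : ℝ) (q : Pair → ℝ) : ℝ := m.dyH0 t (q .y) ^ 2

/-- The product of the two sensitivities of `H₀`: the source of the equation for `H₁₃`. -/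
def sourceXY (t : ℝ) (q : Pair → ℝ) : ℝ := m.dxH0 t (q .x) (q .z) * m.dyH0 t (q .y)

end Model

section Sources

variable {Ω : Type*} [MeasurableSpace Ω] {P : Measure Ω} [IsProbabilityMeasure P] {m : Model}
  {N : Pair → Side → ℝ≥0 → Ω → ℕ} {ξ : Pair → Side → ℕ → Ω → ℝ} {Q : Pair → ℝ → ℝ → ℝ → Ω → ℝ}
  {p : ℕ}

theorem isRepresentable_pow_mul_pow_of_ne (hflow : IsOrderFlow m P N ξ)
    (hF : ∀ k s, MemLp id p (m.F k s))
    (hQ : ∀ k, ∀ t ∈ Icc 0 m.T, ∀ q, IsAuxInventory m P N ξ k t q (Q k t q)) {k l : Pair}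
    (hkl : k ≠ l) {i j : ℕ} (hij : i + j ≤ p) {d : ℝ → ℝ} (hd : Continuous d) :
    IsRepresentable m P Q p (fun t q => d t * (q k ^ i * q l ^ j)) := by
  have hexpand : ∀ t (q : Pair → ℝ), d t * (q k ^ i * q l ^ j) =
      ∑ a ∈ Finset.HasAntidiagonal.antidiagonal i, ∑ b ∈ Finset.HasAntidiagonal.antidiagonal j,
        d t * m.powCoeff k i a t * m.powCoeff l j b t *
          (m.martPoly k a.1 t (q k) * m.martPoly l b.1 t (q l)) := fun t q => by
    rw [m.pow_eq_sum_martPoly k i t, m.pow_eq_sum_martPoly l j t, Finset.sum_mul_sum,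
      Finset.mul_sum]
    refine Finset.sum_congr rfl fun a _ => ?_
    rw [Finset.mul_sum]
    exact Finset.sum_congr rfl fun b _ => by ring
  have hnonempty : ∀ n : ℕ, (Finset.HasAntidiagonal.antidiagonal n).Nonempty := fun n =>
    ⟨(0, n), by simp⟩
  simp only [hexpand]
  refine .sum hF (hnonempty i) fun a ha => .sum hF (hnonempty j) fun b hb => ?_
  have hab : a.1 + b.1 ≤ p := (add_le_add (Finset.HasAntidiagonal.antidiagonal.fst_le ha)
    (Finset.HasAntidiagonal.antidiagonal.fst_le hb)).trans hij
  exact (isPolynomialMartingale_martPoly_mul hflow hF hQ hkl hab).isRepresentable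
    ((hd.mul (m.continuous_powCoeff k i a)).mul (m.continuous_powCoeff l j b))

theorem isRepresentable_pow_mul_pow (hflow : IsOrderFlow m P N ξ)
    (hF : ∀ k s, MemLp id p (m.F k s))
    (hQ : ∀ k, ∀ t ∈ Icc 0 m.T, ∀ q, IsAuxInventory m P N ξ k t q (Q k t q)) (k l : Pair)
    {i j : ℕ} (hij : i + j ≤ p) {d : ℝ → ℝ} (hd : Continuous d) :
    IsRepresentable m P Q p (fun t q => d t * (q k ^ i * q l ^ j)) := by
  rcases ne_or_eq k l with hkl | rfl
  · exact isRepresentable_pow_mul_pow_of_ne hflow hF hQ hkl hij hd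
  · obtain ⟨l, hkl⟩ : ∃ l, k ≠ l := by
      cases k
      exacts [⟨.y, by decide⟩, ⟨.z, by decide⟩, ⟨.x, by decide⟩]
    refine (isRepresentable_pow_mul_pow_of_ne hflow hF hQ hkl (i := i + j) (j := 0) hij hd).congr
      fun t _ => funext fun q => ?_
    rw [pow_zero, mul_one, pow_add]

theorem isRepresentable_part_mul_part (hflow : IsOrderFlow m P N ξ)
    (hF : ∀ k s, MemLp id p (m.F k s))
    (hQ : ∀ k, ∀ t ∈ Icc 0 m.T, ∀ q, IsAuxInventory m P N ξ k t q (Q k t q)) (hp : 4 ≤ p)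
    (k l : Pair) : IsRepresentable m P Q p (fun t q => m.part k t (q k) * m.part l t (q l)) := by
  have hexpand : ∀ t ∈ Icc 0 m.T, (fun q : Pair → ℝ => m.part k t (q k) * m.part l t (q l)) =
      fun q => ∑ i : Fin 3, ∑ j : Fin 3, m.stopped (m.partCoeff k i) t *
        m.stopped (m.partCoeff l j) t * (q k ^ (i : ℕ) * q l ^ (j : ℕ)) := fun t ht => by
    funext q
    simp only [m.part_eq_sum, Finset.sum_mul_sum, m.stopped_eq _ ht.2, mul_mul_mul_comm]
  refine IsRepresentable.congr ?_ hexpand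
  refine .sum hF Finset.univ_nonempty fun i _ => .sum hF Finset.univ_nonempty fun j _ => ?_
  exact isRepresentable_pow_mul_pow hflow hF hQ k l (by omega)
    ((Model.continuous_stopped (m.continuousOn_partCoeff k i)).mul
      (Model.continuous_stopped (m.continuousOn_partCoeff l j)))

theorem isRepresentable_sourceXX (hflow : IsOrderFlow m P N ξ) (hF : ∀ k s, MemLp id p (m.F k s))
    (hQ : ∀ k, ∀ t ∈ Icc 0 m.T, ∀ q, IsAuxInventory m P N ξ k t q (Q k t q)) (hp : 4 ≤ p) :
    IsRepresentable m P Q p m.sourceXX := by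
  have hpart := isRepresentable_part_mul_part hflow hF hQ hp
  refine (((hpart .x .x).add hF (hpart .z .z)).add hF
    ((hpart .x .z).add hF (hpart .x .z))).congr fun t _ => funext fun q => ?_
  rw [Model.sourceXX, Model.dxH0_eq]
  ring

theorem isRepresentable_sourceYY (hflow : IsOrderFlow m P N ξ) (hF : ∀ k s, MemLp id p (m.F k s))
    (hQ : ∀ k, ∀ t ∈ Icc 0 m.T, ∀ q, IsAuxInventory m P N ξ k t q (Q k t q)) (hp : 4 ≤ p) :
    IsRepresentable m P Q p m.sourceYY :=
  (isRepresentable_part_mul_part hflow hF hQ hp .y .y).congr fun t _ => funext fun q => by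
    rw [Model.sourceYY, Model.dyH0_eq, sq]

theorem isRepresentable_sourceXY (hflow : IsOrderFlow m P N ξ) (hF : ∀ k s, MemLp id p (m.F k s))
    (hQ : ∀ k, ∀ t ∈ Icc 0 m.T, ∀ q, IsAuxInventory m P N ξ k t q (Q k t q)) (hp : 4 ≤ p) :
    IsRepresentable m P Q p m.sourceXY := by
  have hpart := isRepresentable_part_mul_part hflow hF hQ hp
  refine ((hpart .x .y).add hF (hpart .z .y)).congr fun t _ => funext fun q => ?_
  rw [Model.sourceXY, Model.dxH0_eq, Model.dyH0_eq]
  ring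

end Sources

/-! ### Quadratic solutions of the equation for `H₁` -/

/-- The quadratic form in the exchange rates with the coefficients `A`, `B` and `C`: the ansatz
`Model.ansatz`, with coefficients that are functions of all inventories. -/
def quad (A B C : ℝ → (Pair → ℝ) → ℝ) (t x y : ℝ) (q : Pair → ℝ) : ℝ :=
  A t q * x ^ 2 + B t q * y ^ 2 + C t q * (x * y)

section RateDerivatives

variable (A B C : ℝ → (Pair → ℝ) → ℝ)

theorem hasDerivAt_quad_x (t x y : ℝ) (q : Pair → ℝ) :
    HasDerivAt (fun x' => quad A B C t x' y q) (2 * A t q * x + C t q * y) x := by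
  have hsq := (((hasDerivAt_id x).pow 2).const_mul (A t q)).add_const (B t q * y ^ 2)
  have hcross := ((hasDerivAt_id x).mul_const y).const_mul (C t q)
  exact (hsq.add hcross).congr_deriv (by
    simp only [Nat.cast_ofNat, id_eq, Nat.add_one_sub_one, pow_one, mul_one, one_mul]
    ring)

theorem hasDerivAt_quad_y (t x y : ℝ) (q : Pair → ℝ) :
    HasDerivAt (fun y' => quad A B C t x y' q) (2 * B t q * y + C t q * x) y := by
  have hsq := (((hasDerivAt_id y).pow 2).const_mul (B t q)).const_add (A t q * x ^ 2)
  have hcross := ((hasDerivAt_id y).const_mul x).const_mul (C t q)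
  exact (hsq.add hcross).congr_deriv (by
    simp only [Nat.cast_ofNat, id_eq, Nat.add_one_sub_one, pow_one, mul_one]
    ring)

theorem dX_quad : dX (quad A B C) = fun t x y q => 2 * A t q * x + C t q * y := by
  funext t x y q
  exact (hasDerivAt_quad_x A B C t x y q).deriv

theorem dY_quad : dY (quad A B C) = fun t x y q => 2 * B t q * y + C t q * x := by
  funext t x y q
  exact (hasDerivAt_quad_y A B C t x y q).deriv

theorem dX_dX_quad : dX (dX (quad A B C)) = fun t _ _ q => 2 * A t q := by
  rw [dX_quad]
  funext t x y q
  exact (((hasDerivAt_id x).const_mul (2 * A t q)).add_const (C t q * y)).deriv.trans (mul_one _)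

theorem dY_dY_quad : dY (dY (quad A B C)) = fun t _ _ q => 2 * B t q := by
  rw [dY_quad]
  funext t x y q
  exact (((hasDerivAt_id y).const_mul (2 * B t q)).add_const (C t q * x)).deriv.trans (mul_one _)

theorem dX_dY_quad : dX (dY (quad A B C)) = fun t _ _ q => C t q := by
  rw [dY_quad]
  funext t x y q
  exact (((hasDerivAt_id x).const_mul (C t q)).const_add (2 * B t q * y)).deriv.trans (mul_one _)

end RateDerivatives

section QuadRegular

variable {T : ℝ} {A B C At Bt Ct : ℝ → (Pair → ℝ) → ℝ} {Aq Bq Cq : Pair → ℝ → (Pair → ℝ) → ℝ}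

theorem hasDerivWithinAt_quad_t (hA : IsC1 T A At Aq) (hB : IsC1 T B Bt Bq) (hC : IsC1 T C Ct Cq)
    {t : ℝ} (ht : t ∈ Ico 0 T) (x y : ℝ) (q : Pair → ℝ) :
    HasDerivWithinAt (fun s => quad A B C s x y q) (quad At Bt Ct t x y q) (Icc 0 T) t :=
  (((hA.deriv_t t ht q).mul_const _).add ((hB.deriv_t t ht q).mul_const _)).add
    ((hC.deriv_t t ht q).mul_const _)

theorem hasDerivAt_quad_q (hA : IsC1 T A At Aq) (hB : IsC1 T B Bt Bq) (hC : IsC1 T C Ct Cq)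
    (k : Pair) {t : ℝ} (ht : t ∈ Ico 0 T) (x y : ℝ) (q : Pair → ℝ) :
    HasDerivAt (fun v => quad A B C t x y (Function.update q k v))
      (quad (Aq k) (Bq k) (Cq k) t x y q) (q k) :=
  (((hA.deriv_q k t ht q).mul_const _).add ((hB.deriv_q k t ht q).mul_const _)).add
    ((hC.deriv_q k t ht q).mul_const _)

theorem dT_quad (hA : IsC1 T A At Aq) (hB : IsC1 T B Bt Bq) (hC : IsC1 T C Ct Cq)
    {t : ℝ} (ht : t ∈ Ico 0 T) (x y : ℝ) (q : Pair → ℝ) :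
    dT T (quad A B C) t x y q = quad At Bt Ct t x y q :=
  (hasDerivWithinAt_quad_t hA hB hC ht x y q).derivWithin
    (uniqueDiffOn_Icc (ht.1.trans_lt ht.2) t (Ico_subset_Icc_self ht))

theorem dQ_quad (hA : IsC1 T A At Aq) (hB : IsC1 T B Bt Bq) (hC : IsC1 T C Ct Cq)
    (k : Pair) {t : ℝ} (ht : t ∈ Ico 0 T) (x y : ℝ) (q : Pair → ℝ) :
    dQ k (quad A B C) t x y q = quad (Aq k) (Bq k) (Cq k) t x y q :=
  (hasDerivAt_quad_q hA hB hC k ht x y q).deriv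

theorem continuousOn_dom {G : ℝ → (Pair → ℝ) → ℝ} {I : Set ℝ}
    (h : ContinuousOn (fun z : ℝ × (Pair → ℝ) => G z.1 z.2) (I ×ˢ univ)) :
    ContinuousOn (fun w : ℝ × ℝ × ℝ × (Pair → ℝ) => G w.1 w.2.2.2) (dom I) :=
  h.comp (f := fun w : ℝ × ℝ × ℝ × (Pair → ℝ) => (w.1, w.2.2.2)) (by fun_prop)
    fun _ hw => ⟨hw.1, mem_univ _⟩

theorem continuousOn_quad {I : Set ℝ}
    (hA : ContinuousOn (fun z : ℝ × (Pair → ℝ) => A z.1 z.2) (I ×ˢ univ))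
    (hB : ContinuousOn (fun z : ℝ × (Pair → ℝ) => B z.1 z.2) (I ×ˢ univ))
    (hC : ContinuousOn (fun z : ℝ × (Pair → ℝ) => C z.1 z.2) (I ×ˢ univ)) :
    ContinuousOn (onProd (quad A B C)) (dom I) :=
  (((continuousOn_dom hA).mul (by fun_prop)).add ((continuousOn_dom hB).mul (by fun_prop))).add
    ((continuousOn_dom hC).mul (by fun_prop))

theorem isRegular_quad (hA : IsC1 T A At Aq) (hB : IsC1 T B Bt Bq) (hC : IsC1 T C Ct Cq) :
    IsRegular T (quad A B C) := by
  have hcA := continuousOn_dom hA.cont_Ico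
  have hcB := continuousOn_dom hB.cont_Ico
  have hcC := continuousOn_dom hC.cont_Ico
  exact
    { cont := continuousOn_quad hA.cont hB.cont hC.cont
      diff_t t ht x _ y _ q := (hasDerivWithinAt_quad_t hA hB hC ht x y q).differentiableWithinAt
      diff_x t _ x _ y _ q := (hasDerivAt_quad_x A B C t x y q).differentiableAt
      diff_y t _ x _ y _ q := (hasDerivAt_quad_y A B C t x y q).differentiableAt
      diff_xx t _ x _ y _ q := by rw [dX_quad]; fun_prop
      diff_yy t _ x _ y _ q := by rw [dY_quad]; fun_prop
      diff_xy t _ x _ y _ q := by rw [dY_quad]; fun_prop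
      diff_q k t ht x _ y _ q := (hasDerivAt_quad_q hA hB hC k ht x y q).differentiableAt
      cont_t := (continuousOn_quad hA.cont_t hB.cont_t hC.cont_t).congr fun w hw =>
        dT_quad hA hB hC hw.1 _ _ _
      cont_x := dX_quad A B C ▸
        ((hcA.const_mul 2).mul (by fun_prop)).add (hcC.mul (by fun_prop))
      cont_y := dY_quad A B C ▸
        ((hcB.const_mul 2).mul (by fun_prop)).add (hcC.mul (by fun_prop))
      cont_xx := dX_dX_quad A B C ▸ hcA.const_mul 2
      cont_yy := dY_dY_quad A B C ▸ hcB.const_mul 2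
      cont_xy := dX_dY_quad A B C ▸ hcC
      cont_q k := (continuousOn_quad (hA.cont_q k) (hB.cont_q k) (hC.cont_q k)).congr
        fun w hw => dQ_quad hA hB hC k hw.1 _ _ _ }

end QuadRegular

namespace Model

section Drift

variable (m : Model)

theorem H0_update (k : Pair) (t x y : ℝ) (q : Pair → ℝ) (v : ℝ) :
    m.H0 t x y (Function.update q k v) =
      rateHat k x y * (v - m.h1 k t * v - m.h2 k t * v ^ 2) +
        m.H0 t x y (Function.update q k 0) := by
  cases k <;>
    simp only [H0, rateHat, Function.update_self, ne_eq, reduceCtorEq, not_false_eq_true,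
      Function.update_of_ne] <;>
    ring

theorem dQ_H0 (k : Pair) (t x y : ℝ) (q : Pair → ℝ) :
    dQ k m.H0 t x y q = rateHat k x y * (1 - m.h1 k t - 2 * m.h2 k t * q k) := by
  have hid := hasDerivAt_id (q k)
  rw [dQ, funext (m.H0_update k t x y q)]
  refine (((((hid.sub (hid.const_mul (m.h1 k t))).sub
    ((hid.pow 2).const_mul (m.h2 k t))).const_mul _).add_const _).congr_deriv ?_).deriv
  simp only [id_eq, Nat.cast_ofNat, Nat.add_one_sub_one, pow_one]
  ring

theorem drift_eq_neg_beta (k : Pair) (t : ℝ) {x y : ℝ} (hx : x ≠ 0) (hy : y ≠ 0) (q : Pair → ℝ) :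
    (rateHat k x y - dQ k m.H0 t x y q) / (2 * m.a k * rateHat k x y) = -m.beta k t (q k) := by
  have ha := (m.a_pos k).ne'
  have hrate : rateHat k x y ≠ 0 := by cases k <;> assumption
  rw [dQ_H0, beta]
  field_simp
  ring

theorem gradP_H0_dotProduct_corr_mulVec (t x y : ℝ) (q : Pair → ℝ) :
    m.gradP m.H0 t x y q ⬝ᵥ (m.corr *ᵥ m.gradP m.H0 t x y q) =
      m.σx ^ 2 * m.sourceXX t q * x ^ 2 + m.σy ^ 2 * m.sourceYY t q * y ^ 2 +
        2 * (m.ρ * m.σx * m.σy) * m.sourceXY t q * (x * y) := by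
  rw [gradP, dX, dY, (m.hasDerivAt_H0_x t x y q).deriv, (m.hasDerivAt_H0_y t x y q).deriv, corr,
    sourceXX, sourceYY, sourceXY]
  simp only [Matrix.mulVec, dotProduct, Fin.sum_univ_two, Matrix.of_apply, Matrix.cons_val_zero,
    Matrix.cons_val_one]
  ring

end Drift

section QuadJump

variable {m : Model} {A B C : ℝ → (Pair → ℝ) → ℝ} {t : ℝ} {q : Pair → ℝ}

theorem jump_quad (k : Pair) (s : Side) (x y : ℝ) :
    jump (quad A B C) k s t x y q = fun r => x ^ 2 * inventoryJump A k s t q r +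
      y ^ 2 * inventoryJump B k s t q r + x * y * inventoryJump C k s t q r := by
  funext r
  simp only [jump, inventoryJump, quad]
  ring

theorem integrableOn_jump_quad {k : Pair} {s : Side}
    (hA : IntegrableOn (inventoryJump A k s t q) (Ioi 0) (m.F k s))
    (hB : IntegrableOn (inventoryJump B k s t q) (Ioi 0) (m.F k s))
    (hC : IntegrableOn (inventoryJump C k s t q) (Ioi 0) (m.F k s)) (x y : ℝ) :
    IntegrableOn (jump (quad A B C) k s t x y q) (Ioi 0) (m.F k s) := by
  rw [jump_quad]
  exact ((hA.const_mul _).fun_add (hB.const_mul _)).fun_add (hC.const_mul _)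

theorem sum_integral_jump_quad
    (hA : ∀ k s, IntegrableOn (inventoryJump A k s t q) (Ioi 0) (m.F k s))
    (hB : ∀ k s, IntegrableOn (inventoryJump B k s t q) (Ioi 0) (m.F k s))
    (hC : ∀ k s, IntegrableOn (inventoryJump C k s t q) (Ioi 0) (m.F k s)) (x y : ℝ) :
    ∑ k : Pair, ∑ s : Side, m.lam k s * ∫ r in Ioi 0, jump (quad A B C) k s t x y q r ∂(m.F k s) =
      x ^ 2 * m.jumpGen A t q + y ^ 2 * m.jumpGen B t q + x * y * m.jumpGen C t q := by
  have hintegral : ∀ k s, ∫ r in Ioi 0, jump (quad A B C) k s t x y q r ∂(m.F k s) =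
      x ^ 2 * (∫ r in Ioi 0, inventoryJump A k s t q r ∂(m.F k s)) +
      y ^ 2 * (∫ r in Ioi 0, inventoryJump B k s t q r ∂(m.F k s)) +
      x * y * (∫ r in Ioi 0, inventoryJump C k s t q r ∂(m.F k s)) := fun k s => by
    have hA' := (hA k s).const_mul (x ^ 2)
    have hB' := (hB k s).const_mul (y ^ 2)
    rw [jump_quad, integral_add (hA'.fun_add hB') ((hC k s).const_mul (x * y)),
      integral_add hA' hB', integral_const_mul, integral_const_mul, integral_const_mul]
  simp only [hintegral, jumpGen, Finset.mul_sum, ← Finset.sum_add_distrib]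
  refine Finset.sum_congr rfl fun k _ => Finset.sum_congr rfl fun s _ => ?_
  ring

variable {At Bt Ct : ℝ → (Pair → ℝ) → ℝ} {Aq Bq Cq : Pair → ℝ → (Pair → ℝ) → ℝ}

theorem pideRHS_quad (hA : IsC1 m.T A At Aq) (hB : IsC1 m.T B Bt Bq) (hC : IsC1 m.T C Ct Cq)
    (ht : t ∈ Ico 0 m.T) {x y : ℝ} (hx : x ≠ 0) (hy : y ≠ 0)
    (hjA : ∀ k s, IntegrableOn (inventoryJump A k s t q) (Ioi 0) (m.F k s))
    (hjB : ∀ k s, IntegrableOn (inventoryJump B k s t q) (Ioi 0) (m.F k s))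
    (hjC : ∀ k s, IntegrableOn (inventoryJump C k s t q) (Ioi 0) (m.F k s)) :
    m.pideRHS (quad A B C) t x y q =
      x ^ 2 * (m.backwardOp A At Aq t q + (2 * m.μx + m.σx ^ 2) * A t q -
        1 / 2 * m.σx ^ 2 * m.sourceXX t q) +
      y ^ 2 * (m.backwardOp B Bt Bq t q + (2 * m.μy + m.σy ^ 2) * B t q -
        1 / 2 * m.σy ^ 2 * m.sourceYY t q) +
      x * y * (m.backwardOp C Ct Cq t q + (m.μx + m.μy + m.ρ * m.σx * m.σy) * C t q -
        m.ρ * m.σx * m.σy * m.sourceXY t q) := by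
  have hdrift : ∑ k : Pair, (rateHat k x y - dQ k m.H0 t x y q) / (2 * m.a k * rateHat k x y) *
        dQ k (quad A B C) t x y q =
      -(x ^ 2 * (∑ k, m.beta k t (q k) * Aq k t q) + y ^ 2 * (∑ k, m.beta k t (q k) * Bq k t q) +
        x * y * (∑ k, m.beta k t (q k) * Cq k t q)) := by
    simp only [Finset.mul_sum, ← Finset.sum_add_distrib, ← Finset.sum_neg_distrib]
    refine Finset.sum_congr rfl fun k _ => ?_
    rw [m.drift_eq_neg_beta k t hx hy, dQ_quad hA hB hC k ht, quad]
    ring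
  rw [pideRHS, hdrift, gradP_H0_dotProduct_corr_mulVec, sum_integral_jump_quad hjA hjB hjC,
    dT_quad hA hB hC ht, genP, dX_dX_quad, dY_dY_quad, dX_dY_quad, dX_quad, dY_quad]
  simp only [backwardOp, quad]
  ring

end QuadJump

end Model

/-! ### Uniqueness for the backward equation -/

section ChainRule

theorem hasDerivAt_sub_of_hasDerivAt_snd {f f' : ℝ → ℝ → ℝ} {v : ℝ → ℝ} {v' t : ℝ}
    (hf : ∀ᶠ z : ℝ × ℝ in 𝓝 (t, v t), HasDerivAt (f z.1) (f' z.1 z.2) z.2)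
    (hf' : ContinuousAt (fun z : ℝ × ℝ => f' z.1 z.2) (t, v t)) (hv : HasDerivAt v v' t) :
    HasDerivAt (fun s => f s (v s) - f s (v t)) (v' * f' t (v t)) t := by
  have hincrement : (fun s => f s (v s) - f s (v t) - f' t (v t) * (v s - v t)) =o[𝓝 t]
      fun s => v s - v t := by
    refine Asymptotics.isLittleO_iff.2 fun ε hε => ?_
    obtain ⟨r, hr, hball⟩ := Metric.eventually_nhds_iff_ball.1
      (hf.and (Metric.continuousAt_iff'.1 hf' ε hε))
    filter_upwards [Metric.ball_mem_nhds t hr,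
      hv.continuousAt.eventually_mem (Metric.ball_mem_nhds (v t) hr)] with s hs hvs
    have hmem : ∀ b ∈ Metric.ball (v t) r, (s, b) ∈ Metric.ball (t, v t) r := fun b hb => by
      rw [← ball_prod_same]
      exact ⟨hs, hb⟩
    have hmvt := Convex.norm_image_sub_le_of_norm_hasDerivWithin_le
      (f := fun b => f s b - b * f' t (v t)) (C := ε)
      (fun b hb => (((hball _ (hmem b hb)).1).sub ((hasDerivAt_id b).mul_const _)).hasDerivWithinAt)
      (fun b hb => by simpa only [one_mul, dist_eq_norm] using (hball _ (hmem b hb)).2.le)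
      (convex_ball (v t) r) (Metric.mem_ball_self hr) hvs
    exact (congrArg norm (by ring)).trans_le hmvt
  rw [hasDerivAt_iff_isLittleO]
  refine ((hincrement.trans_isBigO hv.isBigO_sub).add
    (hv.isLittleO.const_mul_left (f' t (v t)))).congr_left fun s => ?_
  simp only [smul_eq_mul]
  ring

variable {ι : Type*} [DecidableEq ι]

theorem continuousAt_update_piecewise {c : ℝ → ι → ℝ} {t v : ℝ} (hc : ContinuousAt c t)
    (S : Finset ι) (k : ι) :
    ContinuousAt (fun z : ℝ × ℝ => Function.update (S.piecewise (c z.1) (c t)) k z.2) (t, v) := by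
  have hc' : ContinuousAt (fun z : ℝ × ℝ => c z.1) (t, v) :=
    ContinuousAt.comp (g := c) hc continuousAt_fst
  refine ContinuousAt.update (continuousAt_pi.2 fun j => ?_) k continuousAt_snd
  by_cases hj : j ∈ S
  · simpa [hj] using continuousAt_pi.1 hc' j
  · simpa [hj] using continuousAt_const

theorem IsC1.hasDerivAt_comp_piecewise {T : ℝ} {G Gt : ℝ → (ι → ℝ) → ℝ}
    {Gq : ι → ℝ → (ι → ℝ) → ℝ} (hG : IsC1 T G Gt Gq) {t : ℝ} (ht : t ∈ Ioo 0 T)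
    {c : ℝ → ι → ℝ} {c' : ι → ℝ} (hc : ∀ k, HasDerivAt (fun s => c s k) (c' k) t) (S : Finset ι) :
    HasDerivAt (fun s => G s (S.piecewise (c s) (c t)))
      (Gt t (c t) + ∑ k ∈ S, c' k * Gq k t (c t)) t := by
  induction S using Finset.induction_on with
  | empty =>
    simpa using (hG.deriv_t t (Ioo_subset_Ico_self ht) (c t)).hasDerivAt (Icc_mem_nhds ht.1 ht.2)
  | insert k S hk ih =>
    let toPoint : ℝ × ℝ → ℝ × (ι → ℝ) := fun z =>
      (z.1, Function.update (S.piecewise (c z.1) (c t)) k z.2)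
    have hpoint : toPoint (t, c t k) = (t, c t) := by simp [toPoint, Finset.piecewise_same]
    have hcont : ContinuousAt toPoint (t, c t k) := continuousAt_fst.prodMk <|
      continuousAt_update_piecewise (continuousAt_pi.2 fun j => (hc j).continuousAt) S k
    have hGq : ContinuousAt (fun z : ℝ × (ι → ℝ) => Gq k z.1 z.2) (toPoint (t, c t k)) :=
      (hG.cont_q k).continuousAt <| hpoint ▸
        prod_mem_nhds (Ico_mem_nhds ht.1 ht.2) univ_mem
    have hmoved := hasDerivAt_sub_of_hasDerivAt_snd
      (f := fun s b => G s (Function.update (S.piecewise (c s) (c t)) k b))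
      (f' := fun s b => Gq k s (Function.update (S.piecewise (c s) (c t)) k b))
      (v := fun s => c s k)
      (by
        filter_upwards [continuousAt_fst.eventually_mem (Ico_mem_nhds ht.1 ht.2)] with z hz
        simpa using hG.deriv_q k z.1 hz (Function.update (S.piecewise (c z.1) (c t)) k z.2))
      (hGq.comp hcont) (hc k)
    have hfixed : ∀ s, Function.update (S.piecewise (c s) (c t)) k (c t k) =
        S.piecewise (c s) (c t) := fun s => by
      rw [← Finset.piecewise_eq_of_notMem S (c s) (c t) hk, Function.update_eq_self]
    simp only [hfixed, Finset.piecewise_same, Function.update_eq_self] at hmoved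
    refine ((hmoved.add ih).congr_of_eventuallyEq (.of_forall fun s => ?_)).congr_deriv ?_
    · simp only [Finset.piecewise_insert, Pi.add_apply, sub_add_cancel]
    · rw [Finset.sum_insert hk]
      ring

theorem IsC1.hasDerivAt_comp [Fintype ι] {T : ℝ} {G Gt : ℝ → (ι → ℝ) → ℝ}
    {Gq : ι → ℝ → (ι → ℝ) → ℝ} (hG : IsC1 T G Gt Gq) {t : ℝ} (ht : t ∈ Ioo 0 T)
    {c : ℝ → ι → ℝ} {c' : ι → ℝ} (hc : ∀ k, HasDerivAt (fun s => c s k) (c' k) t) :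
    HasDerivAt (fun s => G s (c s)) (Gt t (c t) + ∑ k, c' k * Gq k t (c t)) t := by
  simpa using hG.hasDerivAt_comp_piecewise ht hc Finset.univ

end ChainRule

theorem abs_le_of_abs_deriv_le {g g' B B' : ℝ → ℝ} {t T : ℝ} (htT : t ≤ T)
    (hg : ContinuousOn g (Icc t T)) (hg' : ∀ s ∈ Ioo t T, HasDerivAt g (g' s) s)
    (hB : ∀ s, HasDerivAt B (B' s) s) (hbound : ∀ s ∈ Ioo t T, |g' s| ≤ -B' s)
    (hT : |g T| ≤ B T) : |g t| ≤ B t := by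
  have hBcont : ContinuousOn B (Icc t T) := fun s _ => (hB s).continuousAt.continuousWithinAt
  have hinterior : interior (Icc t T) = Ioo t T := interior_Icc
  have hsub : AntitoneOn (fun s => B s - g s) (Icc t T) :=
    antitoneOn_of_hasDerivWithinAt_nonpos (convex_Icc t T) (hBcont.sub hg)
      (fun s hs => ((hB s).sub (hg' s (hinterior ▸ hs))).hasDerivWithinAt)
      fun s hs => by linarith [abs_le.1 (hbound s (hinterior ▸ hs))]
  have hadd : AntitoneOn (fun s => B s + g s) (Icc t T) :=
    antitoneOn_of_hasDerivWithinAt_nonpos (convex_Icc t T) (hBcont.add hg)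
      (fun s hs => ((hB s).add (hg' s (hinterior ▸ hs))).hasDerivWithinAt)
      fun s hs => by linarith [abs_le.1 (hbound s (hinterior ▸ hs))]
  have hsub' := hsub (left_mem_Icc.2 htT) (right_mem_Icc.2 htT) htT
  have hadd' := hadd (left_mem_Icc.2 htT) (right_mem_Icc.2 htT) htT
  simp only at hsub' hadd'
  obtain ⟨hlower, hupper⟩ := abs_le.1 hT
  exact abs_le.2 ⟨by linarith, by linarith⟩

theorem eq_zero_of_abs_le_half {α : Type*} {s : Set α} {f w : α → ℝ} {M : ℝ} (hM : 0 ≤ M)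
    (hf : ∀ z ∈ s, |f z| ≤ M * w z)
    (hhalf : ∀ M, 0 ≤ M → (∀ z ∈ s, |f z| ≤ M * w z) → ∀ z ∈ s, |f z| ≤ M / 2 * w z)
    {z : α} (hz : z ∈ s) : f z = 0 := by
  have hiterate : ∀ n : ℕ, ∀ z ∈ s, |f z| ≤ M * (1 / 2) ^ n * w z := by
    intro n
    induction n with
    | zero => simpa using hf
    | succ n ih =>
      intro z hz
      convert hhalf _ (by positivity) ih z hz using 2
      ring
  have hlim : Tendsto (fun n : ℕ => M * (1 / 2) ^ n * w z) atTop (𝓝 (M * 0 * w z)) :=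
    ((tendsto_pow_atTop_nhds_zero_of_lt_one (by norm_num) (by norm_num)).const_mul M).mul_const _
  rw [mul_zero, zero_mul] at hlim
  exact abs_nonpos_iff.1 (ge_of_tendsto' hlim fun n => hiterate n z hz)

namespace Model

variable (m : Model)

/-- The auxiliary inventories in the absence of client orders: the solution at time `s` of
`dq = β(s, q) ds` that starts from `q` at time `t`. -/
def characteristic (t : ℝ) (q : Pair → ℝ) (s : ℝ) (k : Pair) : ℝ :=
  (m.weight k s)⁻¹ * (m.weight k t * q k - m.shift k t + m.shift k s)

theorem characteristic_self (t : ℝ) (q : Pair → ℝ) : m.characteristic t q t = q := by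
  funext k
  rw [characteristic, sub_add_cancel, inv_mul_cancel_left₀ (m.weight_pos k t).ne']

theorem hasDerivAt_characteristic (t : ℝ) (q : Pair → ℝ) {s : ℝ} (hs : s ≤ m.T) (k : Pair) :
    HasDerivAt (fun s => m.characteristic t q s k) (m.beta k s (m.characteristic t q s k)) s := by
  have hw := (m.weight_pos k s).ne'
  refine (((m.hasDerivAt_weight k s).inv hw).mul
    ((m.hasDerivAt_shift k s).const_add (m.weight k t * q k - m.shift k t))).congr_deriv ?_
  rw [m.beta_eq k hs, characteristic]
  simp only [Pi.inv_apply]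
  field_simp
  ring

theorem exists_abs_characteristic_le (k : Pair) : ∃ C : ℝ, 0 ≤ C ∧
    ∀ t ∈ Icc 0 m.T, ∀ s ∈ Icc 0 m.T, ∀ q, |m.characteristic t q s k| ≤ C * inventorySize q := by
  have hw := m.continuous_weight k
  have hshift := m.continuous_shift k
  have hinv : Continuous fun s => (m.weight k s)⁻¹ := hw.inv₀ fun s => (m.weight_pos k s).ne'
  have hcompact : IsCompact (Icc 0 m.T ×ˢ Icc 0 m.T) := isCompact_Icc.prod isCompact_Icc
  obtain ⟨A, hA⟩ := hcompact.exists_bound_of_continuousOn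
    (f := fun z : ℝ × ℝ => (m.weight k z.2)⁻¹ * m.weight k z.1)
    ((hinv.comp continuous_snd).mul (hw.comp continuous_fst)).continuousOn
  obtain ⟨B, hB⟩ := hcompact.exists_bound_of_continuousOn
    (f := fun z : ℝ × ℝ => (m.weight k z.2)⁻¹ * (m.shift k z.2 - m.shift k z.1))
    ((hinv.comp continuous_snd).mul
      ((hshift.comp continuous_snd).sub (hshift.comp continuous_fst))).continuousOn
  simp only [Real.norm_eq_abs] at hA hB
  have hzero : ((0 : ℝ), (0 : ℝ)) ∈ Icc 0 m.T ×ˢ Icc 0 m.T :=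
    ⟨left_mem_Icc.2 m.T_pos.le, left_mem_Icc.2 m.T_pos.le⟩
  have hA0 : 0 ≤ A := (abs_nonneg _).trans (hA _ hzero)
  have hB0 : 0 ≤ B := (abs_nonneg _).trans (hB _ hzero)
  refine ⟨A + B, add_nonneg hA0 hB0, fun t ht s hs q => ?_⟩
  calc |m.characteristic t q s k| = |((m.weight k s)⁻¹ * m.weight k t) * q k +
        (m.weight k s)⁻¹ * (m.shift k s - m.shift k t)| := by
          rw [characteristic]
          congr 1
          ring
    _ ≤ |(m.weight k s)⁻¹ * m.weight k t| * |q k| +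
        |(m.weight k s)⁻¹ * (m.shift k s - m.shift k t)| := by
      rw [← abs_mul]
      exact abs_add_le _ _
    _ ≤ A * inventorySize q + B * 1 := by
      rw [mul_one]
      gcongr
      exacts [hA (t, s) ⟨ht, hs⟩, abs_le_inventorySize q k, hB (t, s) ⟨ht, hs⟩]
    _ ≤ A * inventorySize q + B * inventorySize q := by
      gcongr
      exact one_le_inventorySize q
    _ = (A + B) * inventorySize q := by ring

theorem exists_inventorySize_characteristic_le : ∃ C : ℝ, 0 ≤ C ∧ ∀ t ∈ Icc 0 m.T,
    ∀ s ∈ Icc 0 m.T, ∀ q, inventorySize (m.characteristic t q s) ≤ C * inventorySize q := by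
  choose C hC hbound using m.exists_abs_characteristic_le
  refine ⟨1 + ∑ k, C k, add_nonneg zero_le_one (Finset.sum_nonneg fun k _ => hC k),
    fun t ht s hs q => ?_⟩
  rw [add_mul, one_mul, Finset.sum_mul, inventorySize]
  exact add_le_add (one_le_inventorySize q)
    (Finset.sum_le_sum fun k _ => hbound k t ht s hs q)

variable {m} {p : ℕ}

theorem exists_abs_jumpGen_le (hF : ∀ k s, MemLp id p (m.F k s)) :
    ∃ L : ℝ, 0 ≤ L ∧ ∀ (G : ℝ → (Pair → ℝ) → ℝ) (t C : ℝ), 0 ≤ C →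
      (∀ q, |G t q| ≤ C * inventorySize q ^ p) →
        ∀ q, |m.jumpGen G t q| ≤ L * (C * inventorySize q ^ p) := by
  have hmoment : ∀ k s, 0 ≤ ∫ r in Ioi (0 : ℝ), (1 + |r|) ^ p ∂(m.F k s) := fun k s =>
    integral_nonneg fun r => by positivity
  refine ⟨∑ k, ∑ s, m.lam k s * (2 * ∫ r in Ioi 0, (1 + |r|) ^ p ∂(m.F k s)),
    Finset.sum_nonneg fun k _ => Finset.sum_nonneg fun s _ =>
      mul_nonneg (NNReal.coe_nonneg _) (mul_nonneg zero_le_two (hmoment k s)),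
    fun G t C hC hG q => ?_⟩
  have hjump : ∀ k s, |∫ r in Ioi 0, inventoryJump G k s t q r ∂(m.F k s)| ≤
      2 * (∫ r in Ioi 0, (1 + |r|) ^ p ∂(m.F k s)) * (C * inventorySize q ^ p) := fun k s => by
    have := m.F_prob k s
    calc |∫ r in Ioi 0, inventoryJump G k s t q r ∂(m.F k s)|
        ≤ ∫ r in Ioi 0, 2 * C * inventorySize q ^ p * (1 + |r|) ^ p ∂(m.F k s) := by
          rw [← Real.norm_eq_abs]
          exact norm_integral_le_of_norm_le
            ((integrable_one_add_abs_pow (hF k s)).const_mul _).integrableOn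
            (.of_forall fun r => abs_inventoryJump_le hC hG k s q r)
      _ = _ := by
          rw [integral_const_mul]
          ring
  simp only [jumpGen, Finset.sum_mul, mul_assoc]
  refine (Finset.abs_sum_le_sum_abs _ _).trans (Finset.sum_le_sum fun k _ =>
    (Finset.abs_sum_le_sum_abs _ _).trans (Finset.sum_le_sum fun s _ => ?_))
  rw [abs_mul, abs_of_nonneg (NNReal.coe_nonneg _), ← mul_assoc 2]
  exact mul_le_mul_of_nonneg_left (hjump k s) (NNReal.coe_nonneg _)

variable {c K : ℝ} {G : ℝ → (Pair → ℝ) → ℝ}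

/-- Integrates along the characteristic, on which only the jumps and the discounting remain. -/
theorem IsBackwardSolution.abs_le_of_abs_jumpGen_add_le
    (hG : m.IsBackwardSolution c K 0 G) {R D t : ℝ} (ht : t ∈ Icc 0 m.T) (q : Pair → ℝ)
    (hbound : ∀ s ∈ Icc t m.T,
      |m.jumpGen G s (m.characteristic t q s) + c * G s (m.characteristic t q s)| ≤
        R * (D * Real.exp (R * (m.T - s)))) (hD : 0 ≤ D) :
    |G t q| ≤ D * Real.exp (R * (m.T - t)) := by
  obtain ⟨⟨Gt, Gq, hC1, heq⟩, hterminal⟩ := hG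
  have hderiv : ∀ s ∈ Ioo t m.T, HasDerivAt (fun s => G s (m.characteristic t q s))
      (-(m.jumpGen G s (m.characteristic t q s) + c * G s (m.characteristic t q s))) s :=
    fun s hs => by
      have hs' : s ∈ Ioo 0 m.T := ⟨ht.1.trans_lt hs.1, hs.2⟩
      refine (hC1.hasDerivAt_comp hs' fun k =>
        m.hasDerivAt_characteristic t q hs.2.le k).congr_deriv ?_
      have h := heq s (Ioo_subset_Ico_self hs') (m.characteristic t q s)
      rw [backwardOp, Pi.zero_apply, Pi.zero_apply] at h
      linarith
  have hcont : ContinuousOn (fun s => G s (m.characteristic t q s)) (Icc t m.T) :=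
    hC1.cont.comp (f := fun s => (s, m.characteristic t q s))
      (continuousOn_id.prodMk (continuousOn_pi.2 fun k s hs =>
        (m.hasDerivAt_characteristic t q hs.2 k).continuousAt.continuousWithinAt))
      fun s hs => ⟨⟨ht.1.trans hs.1, hs.2⟩, mem_univ _⟩
  have hexp : ∀ s, HasDerivAt (fun s => D * Real.exp (R * (m.T - s)))
      (-(R * (D * Real.exp (R * (m.T - s))))) s := fun s =>
    (((((hasDerivAt_id s).const_sub m.T).const_mul R).exp).const_mul D).congr_deriv (by
      simp only [id_eq]
      ring)
  have h := abs_le_of_abs_deriv_le ht.2 hcont hderiv hexp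
    (fun s hs => by simpa only [abs_neg, neg_neg] using hbound s (Ioo_subset_Icc_self hs))
    (by simpa [hterminal] using hD)
  rwa [m.characteristic_self] at h

theorem IsBackwardSolution.eq_zero (hF : ∀ k s, MemLp id p (m.F k s))
    (hG : m.IsBackwardSolution c K 0 G) (hgrowth : HasPolyGrowth m.T p G) {t : ℝ}
    (ht : t ∈ Icc 0 m.T) (q : Pair → ℝ) : G t q = 0 := by
  obtain ⟨L, hL, hjump⟩ := exists_abs_jumpGen_le hF
  obtain ⟨A, hA, hchar⟩ := m.exists_inventorySize_characteristic_le
  obtain ⟨M, hM, hGM⟩ := hgrowth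
  set R : ℝ := 2 * ((L + |c|) * A ^ p) with hR
  have hR0 : 0 ≤ R := by positivity
  refine eq_zero_of_abs_le_half (s := Icc 0 m.T ×ˢ univ) (f := fun z => G z.1 z.2)
    (w := fun z => Real.exp (R * (m.T - z.1)) * inventorySize z.2 ^ p) hM ?_ ?_
    (z := (t, q)) ⟨ht, mem_univ q⟩
  · rintro ⟨t, q⟩ ⟨ht, -⟩
    refine (hGM t ht q).trans ?_
    have hq := inventorySize_pos q
    gcongr
    exact le_mul_of_one_le_left (by positivity)
      (Real.one_le_exp (mul_nonneg hR0 (sub_nonneg.2 ht.2)))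
  · rintro M hM hGM ⟨t, q⟩ ⟨ht, -⟩
    have hq := inventorySize_pos q
    suffices |G t q| ≤ M / 2 * inventorySize q ^ p * Real.exp (R * (m.T - t)) by
      simpa only [mul_assoc, mul_comm, mul_left_comm] using this
    refine hG.abs_le_of_abs_jumpGen_add_le ht q (fun s hs => ?_) (by positivity)
    have hs' : s ∈ Icc 0 m.T := ⟨ht.1.trans hs.1, hs.2⟩
    set q' := m.characteristic t q s
    set E := Real.exp (R * (m.T - s))
    have : 0 < E := Real.exp_pos _
    have hGs : ∀ q, |G s q| ≤ M * E * inventorySize q ^ p := fun q => by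
      simpa only [mul_assoc] using hGM (s, q) ⟨hs', mem_univ q⟩
    have hq' : inventorySize q' ^ p ≤ (A * inventorySize q) ^ p :=
      pow_le_pow_left₀ (inventorySize_pos q').le (hchar t ht s hs' q) p
    calc |m.jumpGen G s q' + c * G s q'| ≤ |m.jumpGen G s q'| + |c| * |G s q'| := by
          rw [← abs_mul]
          exact abs_add_le _ _
      _ ≤ L * (M * E * inventorySize q' ^ p) + |c| * (M * E * inventorySize q' ^ p) := by
          gcongr
          exacts [hjump G s (M * E) (by positivity) hGs q', hGs q']
      _ = (L + |c|) * (M * E) * inventorySize q' ^ p := by ring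
      _ ≤ (L + |c|) * (M * E) * (A * inventorySize q) ^ p := by gcongr
      _ = R * (M / 2 * inventorySize q ^ p * E) := by
          rw [hR, mul_pow]
          ring

theorem IsBackwardSolution.eq {S H : ℝ → (Pair → ℝ) → ℝ} (hF : ∀ k s, MemLp id p (m.F k s))
    (hG : m.IsBackwardSolution c K S G) (hH : m.IsBackwardSolution c K S H)
    (hgrowthG : HasPolyGrowth m.T p G) (hgrowthH : HasPolyGrowth m.T p H) {t : ℝ}
    (ht : t ∈ Icc 0 m.T) (q : Pair → ℝ) : G t q = H t q := by
  have hgrowth : HasPolyGrowth m.T p (fun t q => -1 * H t q) := by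
    simpa only [zero_add] using
      (HasPolyGrowth.of_time (continuous_const (y := (-1 : ℝ)))).mul hgrowthH
  have hdiff := (hG.add hF (hH.const_mul (-1)) hgrowthG hgrowth).congr (S' := 0)
    (fun t _ => by funext q; simp) fun _ _ => rfl
  linarith [hdiff.eq_zero hF (hgrowthG.add hgrowth) ht q]

end Model

theorem IsRegular.isC1 {T : ℝ} {H : ℝ → ℝ → ℝ → (Pair → ℝ) → ℝ} (h : IsRegular T H) {x y : ℝ}
    (hx : 0 < x) (hy : 0 < y) :
    IsC1 T (fun t q => H t x y q) (fun t q => dT T H t x y q) (fun k t q => dQ k H t x y q) := by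
  have hmaps : ∀ I : Set ℝ, MapsTo (fun z : ℝ × (Pair → ℝ) => (z.1, x, y, z.2)) (I ×ˢ univ)
      (dom I) := fun I z hz => ⟨hz.1, hx, hy, mem_univ _⟩
  have hcont : Continuous (fun z : ℝ × (Pair → ℝ) => (z.1, x, y, z.2)) := by fun_prop
  exact
    { cont := h.cont.comp hcont.continuousOn (hmaps _)
      cont_t := h.cont_t.comp hcont.continuousOn (hmaps _)
      cont_q k := (h.cont_q k).comp hcont.continuousOn (hmaps _)
      deriv_t t ht q := (h.diff_t t ht x hx y hy q).hasDerivWithinAt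
      deriv_q k t ht q := (h.diff_q k t ht x hx y hy q).hasDerivAt }

/-- The coefficients are linear combinations of the values at `(1, 1)`, `(2, 1)` and `(1, 2)`. -/
theorem IsRegular.exists_isC1_of_quad {T : ℝ} {A B C : ℝ → (Pair → ℝ) → ℝ}
    (h : IsRegular T (quad A B C)) :
    (∃ At Aq, IsC1 T A At Aq) ∧ (∃ Bt Bq, IsC1 T B Bt Bq) ∧ ∃ Ct Cq, IsC1 T C Ct Cq := by
  have hcombination : ∀ (a b c : ℝ) (G : ℝ → (Pair → ℝ) → ℝ), (∀ t q, G t q =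
      a * quad A B C t 1 1 q + b * quad A B C t 2 1 q + c * quad A B C t 1 2 q) →
      ∃ Gt Gq, IsC1 T G Gt Gq := fun a b c G hG =>
    ⟨_, _, ((((h.isC1 one_pos one_pos).const_mul a).add
      ((h.isC1 two_pos one_pos).const_mul b)).add
        ((h.isC1 one_pos two_pos).const_mul c)).congr fun t _ q => hG t q⟩
  refine ⟨hcombination (-2) (2 / 3) (1 / 3) A ?_, hcombination (-2) (1 / 3) (2 / 3) B ?_,
    hcombination 5 (-1) (-1) C ?_⟩ <;>
  · intro t q
    simp only [quad]
    ring

theorem eq_zero_of_quadratic_eq_zero {u v w : ℝ}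
    (h : ∀ x > 0, ∀ y > 0, x ^ 2 * u + y ^ 2 * v + x * y * w = 0) : u = 0 ∧ v = 0 ∧ w = 0 := by
  have h11 := h 1 one_pos 1 one_pos
  have h21 := h 2 two_pos 1 one_pos
  have h12 := h 1 one_pos 2 two_pos
  exact ⟨by linarith, by linarith, by linarith⟩

namespace Model

/-- The backward equations for the coefficients of a solution of the equation for `H₁` that is
quadratic in the exchange rates. -/
structure IsCoeffSystem (m : Model) (A B C : ℝ → (Pair → ℝ) → ℝ) : Prop where
  xx : m.IsBackwardSolution (2 * m.μx + m.σx ^ 2) (1 / 2 * m.σx ^ 2) m.sourceXX A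
  yy : m.IsBackwardSolution (2 * m.μy + m.σy ^ 2) (1 / 2 * m.σy ^ 2) m.sourceYY B
  xy : m.IsBackwardSolution (m.μx + m.μy + m.ρ * m.σx * m.σy) (m.ρ * m.σx * m.σy) m.sourceXY C

variable {m : Model} {A B C : ℝ → (Pair → ℝ) → ℝ} {p : ℕ}

theorem IsCoeffSystem.isSolutionH1 (hF : ∀ k s, MemLp id p (m.F k s)) (h : m.IsCoeffSystem A B C)
    (hgrowthA : HasPolyGrowth m.T p A) (hgrowthB : HasPolyGrowth m.T p B)
    (hgrowthC : HasPolyGrowth m.T p C) : m.IsSolutionH1 (quad A B C) := by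
  obtain ⟨⟨⟨At, Aq, hA, heqA⟩, hterminalA⟩, ⟨⟨Bt, Bq, hB, heqB⟩, hterminalB⟩,
    ⟨⟨Ct, Cq, hC, heqC⟩, hterminalC⟩⟩ := h
  have hjA := fun k s t (ht : t ∈ Ico 0 m.T) q => integrableOn_inventoryJump hF hgrowthA
    (Ico_subset_Icc_self ht) (hA.continuous_q (Ico_subset_Icc_self ht)) k s q
  have hjB := fun k s t (ht : t ∈ Ico 0 m.T) q => integrableOn_inventoryJump hF hgrowthB
    (Ico_subset_Icc_self ht) (hB.continuous_q (Ico_subset_Icc_self ht)) k s q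
  have hjC := fun k s t (ht : t ∈ Ico 0 m.T) q => integrableOn_inventoryJump hF hgrowthC
    (Ico_subset_Icc_self ht) (hC.continuous_q (Ico_subset_Icc_self ht)) k s q
  exact
    { regular := isRegular_quad hA hB hC
      integrable k s t ht x _ y _ q :=
        integrableOn_jump_quad (hjA k s t ht q) (hjB k s t ht q) (hjC k s t ht q) x y
      pide t ht x hx y hy q := by
        rw [pideRHS_quad hA hB hC ht hx.ne' hy.ne' (fun k s => hjA k s t ht q)
          (fun k s => hjB k s t ht q) (fun k s => hjC k s t ht q), heqA t ht, heqB t ht, heqC t ht]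
        ring
      terminal x _ y _ q := by
        rw [quad, hterminalA, hterminalB, hterminalC]
        ring }

theorem isCoeffSystem_of_isSolutionH1 (hF : ∀ k s, MemLp id p (m.F k s))
    (h : m.IsSolutionH1 (quad A B C)) (hgrowthA : HasPolyGrowth m.T p A)
    (hgrowthB : HasPolyGrowth m.T p B) (hgrowthC : HasPolyGrowth m.T p C) :
    m.IsCoeffSystem A B C := by
  obtain ⟨⟨At, Aq, hA⟩, ⟨Bt, Bq, hB⟩, ⟨Ct, Cq, hC⟩⟩ := h.regular.exists_isC1_of_quad
  have hterminal : ∀ q, A m.T q = 0 ∧ B m.T q = 0 ∧ C m.T q = 0 := fun q =>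
    eq_zero_of_quadratic_eq_zero fun x hx y hy => by
      linear_combination (norm := (rw [quad]; ring)) h.terminal x hx y hy q
  have heq := fun t (ht : t ∈ Ico 0 m.T) q =>
    have ht' := Ico_subset_Icc_self ht
    have hjA := fun k s =>
      integrableOn_inventoryJump hF hgrowthA ht' (hA.continuous_q ht') k s q
    have hjB := fun k s =>
      integrableOn_inventoryJump hF hgrowthB ht' (hB.continuous_q ht') k s q
    have hjC := fun k s =>
      integrableOn_inventoryJump hF hgrowthC ht' (hC.continuous_q ht') k s q
    eq_zero_of_quadratic_eq_zero fun x hx y hy =>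
      (pideRHS_quad hA hB hC ht hx.ne' hy.ne' hjA hjB hjC).symm.trans (h.pide t ht x hx y hy q)
  exact
    { xx := ⟨⟨At, Aq, hA, fun t ht q => (heq t ht q).1⟩, fun q => (hterminal q).1⟩
      yy := ⟨⟨Bt, Bq, hB, fun t ht q => (heq t ht q).2.1⟩, fun q => (hterminal q).2.1⟩
      xy := ⟨⟨Ct, Cq, hC, fun t ht q => (heq t ht q).2.2⟩, fun q => (hterminal q).2.2⟩ }

end Model

/-- The vector of inventories with the given components. -/
def vec (qx qy qz : ℝ) : Pair → ℝ
  | .x => qx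
  | .y => qy
  | .z => qz

theorem inventorySize_eq (q : Pair → ℝ) :
    inventorySize q = 1 + |q .x| + |q .y| + |q .z| := by
  rw [inventorySize, sum_pair]
  ring

namespace Model

variable {m : Model} {p : ℕ} {H11 : ℝ → ℝ → ℝ → ℝ} {H12 : ℝ → ℝ → ℝ} {H13 : ℝ → ℝ → ℝ → ℝ → ℝ}

theorem HasGrowth.hasPolyGrowth (h : m.HasGrowth p H11 H12 H13) :
    HasPolyGrowth m.T p (fun t (q : Pair → ℝ) => H11 t (q .x) (q .z)) ∧
      HasPolyGrowth m.T p (fun t (q : Pair → ℝ) => H12 t (q .y)) ∧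
      HasPolyGrowth m.T p (fun t (q : Pair → ℝ) => H13 t (q .x) (q .y) (q .z)) := by
  obtain ⟨C, h⟩ := h
  have hmono : ∀ {v u w : ℝ}, 0 ≤ u → u ≤ w → |v| ≤ C * u ^ p → |v| ≤ |C| * w ^ p :=
    fun hu huw hv => hv.trans (mul_le_mul (le_abs_self C) (pow_le_pow_left₀ hu huw p)
      (pow_nonneg hu p) (abs_nonneg C))
  refine ⟨⟨|C|, abs_nonneg C, fun t ht q => ?_⟩, ⟨|C|, abs_nonneg C, fun t ht q => ?_⟩,
    ⟨|C|, abs_nonneg C, fun t ht q => ?_⟩⟩ <;>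
    obtain ⟨h11, h12, h13⟩ := h t ht (q .x) (q .y) (q .z) <;>
    rw [inventorySize_eq]
  · exact hmono (by positivity) (by linarith [abs_nonneg (q .y)]) h11
  · exact hmono (by positivity) (by linarith [abs_nonneg (q .x), abs_nonneg (q .z)]) h12
  · exact hmono (by positivity) le_rfl h13

theorem hasGrowth_of_hasPolyGrowth
    (h11 : HasPolyGrowth m.T p (fun t (q : Pair → ℝ) => H11 t (q .x) (q .z)))
    (h12 : HasPolyGrowth m.T p (fun t (q : Pair → ℝ) => H12 t (q .y)))
    (h13 : HasPolyGrowth m.T p (fun t (q : Pair → ℝ) => H13 t (q .x) (q .y) (q .z))) :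
    m.HasGrowth p H11 H12 H13 := by
  obtain ⟨A, hA, h11⟩ := h11
  obtain ⟨B, hB, h12⟩ := h12
  obtain ⟨C, hC, h13⟩ := h13
  have hmono : ∀ {v u D : ℝ}, 0 ≤ u → D ≤ A + B + C → |v| ≤ D * u ^ p →
      |v| ≤ (A + B + C) * u ^ p := fun hu hD hv =>
    hv.trans (mul_le_mul_of_nonneg_right hD (pow_nonneg hu p))
  refine ⟨A + B + C, fun t ht qx qy qz => ⟨?_, ?_, ?_⟩⟩
  · refine hmono (by positivity) (by linarith : A ≤ _) ?_
    simpa [inventorySize_eq, vec] using h11 t ht (vec qx 0 qz)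
  · refine hmono (by positivity) (by linarith : B ≤ _) ?_
    simpa [inventorySize_eq, vec] using h12 t ht (vec 0 qy 0)
  · refine hmono (by positivity) (by linarith : C ≤ _) ?_
    simpa [inventorySize_eq, vec] using h13 t ht (vec qx qy qz)

end Model

section Formulas

variable {Ω : Type*} [MeasurableSpace Ω] (m : Model) (P : Measure Ω)
  (Q : Pair → ℝ → ℝ → ℝ → Ω → ℝ)

theorem mul_discounted (K c T : ℝ) (f : ℝ → ℝ) (t : ℝ) :
    K * discounted c T f t = ∫ u in t..T, Real.exp (c * (u - t)) * K * f u := by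
  rw [discounted, ← intervalIntegral.integral_const_mul]
  simp only [mul_left_comm K, mul_assoc]

theorem feynmanKac_sourceXX :
    feynmanKac m P Q (2 * m.μx + m.σx ^ 2) (1 / 2 * m.σx ^ 2) m.sourceXX =
      fun t q => m.repH11 P Q t (q .x) (q .z) := by
  funext t q
  rw [feynmanKac, mul_discounted]
  rfl

theorem feynmanKac_sourceYY :
    feynmanKac m P Q (2 * m.μy + m.σy ^ 2) (1 / 2 * m.σy ^ 2) m.sourceYY =
      fun t q => m.repH12 P Q t (q .y) := by
  funext t q
  rw [feynmanKac, mul_discounted]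
  rfl

theorem feynmanKac_sourceXY :
    feynmanKac m P Q (m.μx + m.μy + m.ρ * m.σx * m.σy) (m.ρ * m.σx * m.σy) m.sourceXY =
      fun t q => m.repH13 P Q t (q .x) (q .y) (q .z) := by
  funext t q
  rw [feynmanKac, mul_discounted]
  rfl

end Formulas

section Formulas

variable {Ω : Type*} [MeasurableSpace Ω] {m : Model} {P : Measure Ω} [IsProbabilityMeasure P]
  {N : Pair → Side → ℝ≥0 → Ω → ℕ} {ξ : Pair → Side → ℕ → Ω → ℝ} {Q : Pair → ℝ → ℝ → ℝ → Ω → ℝ}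
  {p : ℕ}

theorem isCoeffSystem_rep (hflow : IsOrderFlow m P N ξ) (hF : ∀ k s, MemLp id 4 (m.F k s))
    (hQ : ∀ k, ∀ t ∈ Icc 0 m.T, ∀ q, IsAuxInventory m P N ξ k t q (Q k t q)) :
    m.IsCoeffSystem (fun t q => m.repH11 P Q t (q .x) (q .z)) (fun t q => m.repH12 P Q t (q .y))
      (fun t q => m.repH13 P Q t (q .x) (q .y) (q .z)) where
  xx := feynmanKac_sourceXX m P Q ▸
    (isRepresentable_sourceXX hflow hF hQ le_rfl).isBackwardSolution _ _
  yy := feynmanKac_sourceYY m P Q ▸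
    (isRepresentable_sourceYY hflow hF hQ le_rfl).isBackwardSolution _ _
  xy := feynmanKac_sourceXY m P Q ▸
    (isRepresentable_sourceXY hflow hF hQ le_rfl).isBackwardSolution _ _

theorem hasGrowth_rep (hflow : IsOrderFlow m P N ξ) (hF : ∀ k s, MemLp id p (m.F k s))
    (hQ : ∀ k, ∀ t ∈ Icc 0 m.T, ∀ q, IsAuxInventory m P N ξ k t q (Q k t q)) (hp : 4 ≤ p) :
    m.HasGrowth p (m.repH11 P Q) (m.repH12 P Q) (m.repH13 P Q) :=
  Model.hasGrowth_of_hasPolyGrowth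
    (feynmanKac_sourceXX m P Q ▸ (isRepresentable_sourceXX hflow hF hQ hp).growth _ _)
    (feynmanKac_sourceYY m P Q ▸ (isRepresentable_sourceYY hflow hF hQ hp).growth _ _)
    (feynmanKac_sourceXY m P Q ▸ (isRepresentable_sourceXY hflow hF hQ hp).growth _ _)

end Formulas

namespace Model

variable {m : Model} {p : ℕ} {H11 H11' : ℝ → ℝ → ℝ → ℝ} {H12 H12' : ℝ → ℝ → ℝ}
  {H13 H13' : ℝ → ℝ → ℝ → ℝ → ℝ}

theorem IsSolutionH1.eq_of_hasGrowth (hF : ∀ k s, MemLp id p (m.F k s))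
    (h : m.IsSolutionH1 (ansatz H11 H12 H13)) (h' : m.IsSolutionH1 (ansatz H11' H12' H13'))
    (hgrowth : m.HasGrowth p H11 H12 H13) (hgrowth' : m.HasGrowth p H11' H12' H13') {t : ℝ}
    (ht : t ∈ Icc 0 m.T) (qx qy qz : ℝ) :
    H11 t qx qz = H11' t qx qz ∧ H12 t qy = H12' t qy ∧
      H13 t qx qy qz = H13' t qx qy qz := by
  obtain ⟨hA, hB, hC⟩ := hgrowth.hasPolyGrowth
  obtain ⟨hA', hB', hC'⟩ := hgrowth'.hasPolyGrowth
  have hsystem := isCoeffSystem_of_isSolutionH1 hF h hA hB hC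
  have hsystem' := isCoeffSystem_of_isSolutionH1 hF h' hA' hB' hC'
  exact ⟨hsystem.xx.eq hF hsystem'.xx hA hA' ht (vec qx qy qz),
    hsystem.yy.eq hF hsystem'.yy hB hB' ht (vec qx qy qz),
    hsystem.xy.eq hF hsystem'.xy hC hC' ht (vec qx qy qz)⟩

end Model

end FX

end

theorem mainTheorem6 (m : FX.Model)
    (hF : ∀ k s, Integrable (fun r : ℝ => r ^ 4) (m.F k s))
    {Ω : Type*} [MeasurableSpace Ω] (P : Measure Ω) [IsProbabilityMeasure P]
    (N : FX.Pair → FX.Side → ℝ≥0 → Ω → ℕ) (ξ : FX.Pair → FX.Side → ℕ → Ω → ℝ)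
    (hflow : FX.IsOrderFlow m P N ξ)
    (Q : FX.Pair → ℝ → ℝ → ℝ → Ω → ℝ)
    (hQ : ∀ k, ∀ t ∈ Icc 0 m.T, ∀ q, FX.IsAuxInventory m P N ξ k t q (Q k t q)) :
    -- the expectations and the time integrals in the three formulas are finite
    (∀ t ∈ Icc 0 m.T, ∀ qx qy qz : ℝ,
      (∀ u ∈ Icc t m.T,
        Integrable (fun ω => (m.dxH0 u (Q .x t qx u ω) (Q .z t qz u ω)) ^ 2) P ∧
        Integrable (fun ω => (m.dyH0 u (Q .y t qy u ω)) ^ 2) P ∧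
        Integrable (fun ω =>
          m.dxH0 u (Q .x t qx u ω) (Q .z t qz u ω) * m.dyH0 u (Q .y t qy u ω)) P) ∧
      IntervalIntegrable (m.expXX P Q t qx qz) volume t m.T ∧
      IntervalIntegrable (m.expYY P Q t qy) volume t m.T ∧
      IntervalIntegrable (m.expXY P Q t qx qy qz) volume t m.T) ∧
    -- the formulas give a solution of the equation for `H₁`
    m.IsSolutionH1 (FX.Model.ansatz (m.repH11 P Q) (m.repH12 P Q) (m.repH13 P Q)) ∧
    m.HasGrowth 4 (m.repH11 P Q) (m.repH12 P Q) (m.repH13 P Q) ∧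
    -- every solution of the form of the ansatz is given by the formulas
    (∀ (H11 : ℝ → ℝ → ℝ → ℝ) (H12 : ℝ → ℝ → ℝ) (H13 : ℝ → ℝ → ℝ → ℝ → ℝ),
      m.IsSolutionH1 (FX.Model.ansatz H11 H12 H13) →
      (∃ p : ℕ, 4 ≤ p ∧ (∀ k s, Integrable (fun r : ℝ => r ^ p) (m.F k s)) ∧
        m.HasGrowth p H11 H12 H13) →
      ∀ t ∈ Icc 0 m.T, ∀ qx qy qz : ℝ,
        H11 t qx qz = m.repH11 P Q t qx qz ∧
        H12 t qy = m.repH12 P Q t qy ∧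
        H13 t qx qy qz = m.repH13 P Q t qx qy qz) := by
  have hmemLp : ∀ p : ℕ, 4 ≤ p → (∀ k s, Integrable (fun r : ℝ => r ^ p) (m.F k s)) →
      ∀ k s, MemLp id p (m.F k s) := fun p hp hFp k s =>
    FX.memLp_of_integrable_pow aestronglyMeasurable_id (by omega) (hFp k s)
  have hF4 := hmemLp 4 le_rfl hF
  have hXX := FX.isRepresentable_sourceXX hflow hF4 hQ le_rfl
  have hYY := FX.isRepresentable_sourceYY hflow hF4 hQ le_rfl
  have hXY := FX.isRepresentable_sourceXY hflow hF4 hQ le_rfl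
  have hgrowth := FX.hasGrowth_rep hflow hF4 hQ le_rfl
  obtain ⟨hA, hB, hC⟩ := hgrowth.hasPolyGrowth
  have hsolution : m.IsSolutionH1 (FX.Model.ansatz (m.repH11 P Q) (m.repH12 P Q) (m.repH13 P Q)) :=
    (FX.isCoeffSystem_rep hflow hF4 hQ).isSolutionH1 hF4 hA hB hC
  refine ⟨fun t ht qx qy qz => ⟨fun u hu => ?_, ?_, ?_, ?_⟩, hsolution, hgrowth, ?_⟩
  · exact ⟨hXX.integrable t ht u hu (FX.vec qx qy qz), hYY.integrable t ht u hu (FX.vec qx qy qz),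
      hXY.integrable t ht u hu (FX.vec qx qy qz)⟩
  · exact hXX.intervalIntegrable t ht (FX.vec qx qy qz)
  · exact hYY.intervalIntegrable t ht (FX.vec qx qy qz)
  · exact hXY.intervalIntegrable t ht (FX.vec qx qy qz)
  · rintro H11 H12 H13 hH ⟨p, hp, hFp, hgrowthH⟩ t ht qx qy qz
    exact hH.eq_of_hasGrowth (hmemLp p hp hFp) hsolution hgrowthH
      (FX.hasGrowth_rep hflow (hmemLp p hp hFp) hQ hp) ht qx qy qz
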